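/- Let $n,m\ge 1$ be integers, let $\mathbb F_n^+$ be the free unital semigroup on generators $g_1,\dots,g_n$ with identity $g_0$, let $\mathcal H$ be a complex Hilbert space, and for $X=(X_1,\dots,X_n)\in B(\mathcal H)^n$ and $\alpha=g_{i_1}\cdots g_{i_k}$ put $X_\alpha=X_{i_1}\cdots X_{i_k}$, $X_{g_0}=I$. Let $f=\sum_\alpha a_\alpha X_\alpha$ be a positive regular free holomorphic function: $a_\alpha\ge 0$, $a_{g_0}=0$, $a_{g_i}>0$ for all $i$, and for some $\rho>0$ the series $\sum_{k\ge0}\sum_{|\alpha|=k}a_\alpha X_\alpha$ converges in norm whenever $X\in B(\mathcal H)^n$ and $\|\sum_i X_iX_i^*\|<\rho$. *Domain.* For $X$ such that $\sum_{|\alpha|\ge1}a_\alpha X_\alpha X_\alpha^*$ converges in the weak operator topology put $\Phi_{f,X}(Y)=\sum_{|\alpha|\ge 1}a_\alpha X_\alpha YX_\alpha^*$ (WOT). The domain $\mathbf D_f^m(\mathcal H)$ is the set of all such $X$ with $(id-\Phi_{f,X})^k(I)\ge0$ for $1\le k\le m$. An $n$-tuple $X$ has the radial property if there is $\delta\in(0,1)$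 with $rX=(rX_1,\dots,rX_n)\in\mathbf D_f^m(\mathcal H)$ for all $r\in(\delta,1)$. $T\in\mathbf D_f^m(\mathcal H)$ is completely non-coisometric if there is no $h\ne0$ with $\langle\Phi_{f,T}^k(I)h,h\rangle=\|h\|^2$ for all $k\ge1$. *Universal model.* Let $b_{g_0}=1$ and $$b_\alpha=\sum_{j=1}^{|\alpha|}\binom{j+m-1}{m-1}\sum_{\gamma_1\cdots\gamma_j=\alpha,\ |\gamma_i|\ge1}a_{\gamma_1}\cdots a_{\gamma_j}\qquad(|\alpha|\ge1).$$ On the full Fock space $F^2(H_n)$ with orthonormal basis $(e_\alpha)_{\alpha\in\mathbb F_n^+}$, $1=e_{g_0}$, let $W_ie_\alpha=\sqrt{b_\alpha/b_{g_i\alpha}}\,e_{g_i\alpha}$ and $\Lambda_ie_\alpha=\sqrt{b_\alpha/b_{\alpha g_i}}\,e_{\alpha g_i}$. The Hardy algebra $F_n^\infty(\mathbf D_f^m)$ is the set of all $g\in B(F^2(H_n))$ for which there are $c_\beta\in\mathbb C$ with $\sum_\beta|c_\beta|^2/b_\beta<\infty$ and $gp=\sum_\beta c_\beta W_\beta p$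 for every finite linear combination $p$ of the $e_\alpha$. For such $g$ put $g(rT)=\sum_{k\ge0}\sum_{|\alpha|=k}c_\alpha r^{|\alpha|}T_\alpha$. *Berezin transform.* With $\tilde\alpha$ the reverse of $\alpha$, and whenever the inverse exists, $\mathbf B_T[g]\in B(\mathcal H)$ is given by $$\langle\mathbf B_T[g]x,y\rangle=\Big\langle\Big(I-\sum_{|\alpha|\ge1}a_{\tilde\alpha}\Lambda_\alpha^*\otimes T_{\tilde\alpha}\Big)^{-m}\big(g\otimes(id-\Phi_{f,T})^m(I)\big)\Big(I-\sum_{|\alpha|\ge1}a_{\tilde\alpha}\Lambda_\alpha\otimes T_{\tilde\alpha}^*\Big)^{-m}(1\otimes x),\,1\otimes y\Big\rangle .$$ **Theorem.** Assume that the universal model $(W_1,\dots,W_n)$ has the radial property, and let $T=(T_1,\dots,T_n)\in\mathbf D_f^m(\mathcal H)$ be completely non-coisometric with the radial property. Then $F_n^\infty(\mathbf D_f^m)$ is a unital subalgebra of $B(F^2(H_n))$; for every $g\in F_n^\infty(\mathbf D_f^m)$ the series $g(rT)$ converges in norm for $0\le r<1$; the limit $$\Phi(g)=\text{SOT-}\lim_{r\to1^-}g(rT)$$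 exists; and the map $\Phi:F_n^\infty(\mathbf D_f^m)\to B(\mathcal H)$ has the following properties. (i) $\mathbf B_{rT}$ is well defined for all $r<1$ close to $1$, and $\Phi(g)=\text{SOT-}\lim_{r\to1^-}\mathbf B_{rT}[g]$ for every $g\in F_n^\infty(\mathbf D_f^m)$. (ii) $\Phi$ is WOT-continuous on bounded sets and SOT-continuous on bounded sets. (iii) $\Phi$ is a unital completely contractive algebra homomorphism. -/

import Mathlib

open Filter Topology
open scoped TensorProduct

noncomputable section

namespace NCDomain

/-! ### Words, the full Fock space, creation operators -/

/-- The unital free semigroup on `n` generators. -/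
abbrev Word (n : ℕ) : Type := FreeMonoid (Fin n)

/-- The monomial `X_α = X_{i₁} ⋯ X_{i_k}` for `α = g_{i₁} ⋯ g_{i_k}`. -/
def mon {n : ℕ} {A : Type*} [Monoid A] (X : Fin n → A) (α : Word n) : A :=
  FreeMonoid.lift X α

/-- The homogeneous sum `∑_{|α| = k} F α`; words of length `k` are listed by `Fin k → Fin n`. -/
def homSum {n : ℕ} {A : Type*} [AddCommMonoid A] (k : ℕ) (F : Word n → A) : A :=
  ∑ w : Fin k → Fin n, F (FreeMonoid.ofList (List.ofFn w))

/-- The full Fock space over an `n`-dimensional Hilbert space, realised on its canonical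
orthonormal basis `(e_α)`, i.e. as `ℓ²` of the free semigroup. -/
abbrev Fock (n : ℕ) : Type := lp (fun _ : Word n => ℂ) 2

/-- The canonical orthonormal basis `(e_α)` of the full Fock space. -/
def fockBasis (n : ℕ) : HilbertBasis (Word n) ℂ (Fock n) :=
  HilbertBasis.ofRepr (LinearIsometryEquiv.refl ℂ (Fock n))

/-- The basis vector `e_α`; `e_1` is the vacuum vector. -/
def e {n : ℕ} (α : Word n) : Fock n := fockBasis n α

/-- The isometry with `e_α ↦ e_{g_i α}`. -/
def leftCreation {n : ℕ} (i : Fin n) : Fock n →L[ℂ] Fock n :=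
  ((fockBasis n).orthonormal.comp (fun α : Word n => FreeMonoid.of i * α)
    (mul_right_injective (FreeMonoid.of i))).orthogonalFamily.linearIsometry.toContinuousLinearMap

/-- The isometry with `e_α ↦ e_{α g_i}`. -/
def rightCreation {n : ℕ} (i : Fin n) : Fock n →L[ℂ] Fock n :=
  ((fockBasis n).orthonormal.comp (fun α : Word n => α * FreeMonoid.of i)
    (mul_left_injective (FreeMonoid.of i))).orthogonalFamily.linearIsometry.toContinuousLinearMap

theorem memlp_diag {n : ℕ} {d : Word n → ℝ} {C : ℝ} (hC : ∀ α, |d α| ≤ C) (φ : Fock n) :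
    Memℓp (fun α => (d α : ℂ) * φ α) 2 := by
  have h := ((lp.memℓp φ).const_mul (C : ℂ))
  refine memℓp_gen (((memℓp_gen_iff (by norm_num)).1 h).of_nonneg_of_le (fun α => by positivity)
    fun α => ?_)
  refine Real.rpow_le_rpow (norm_nonneg _) ?_ (by norm_num)
  have h0 : 0 ≤ C := (abs_nonneg _).trans (hC α)
  simp only [norm_mul, Complex.norm_real, Real.norm_eq_abs, abs_of_nonneg h0]
  exact mul_le_mul_of_nonneg_right (hC α) (norm_nonneg _)

theorem norm_diag_le {n : ℕ} {d : Word n → ℝ} {C : ℝ} (hC : ∀ α, |d α| ≤ C) (φ : Fock n) :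
    ‖(⟨fun α => (d α : ℂ) * φ α, memlp_diag hC φ⟩ : Fock n)‖ ≤ C * ‖φ‖ := by
  have h0 : 0 ≤ C := (abs_nonneg _).trans (hC 1)
  have key : ‖(⟨fun α => (d α : ℂ) * φ α, memlp_diag hC φ⟩ : Fock n)‖ ≤ ‖(C : ℂ) • φ‖ := by
    refine lp.norm_mono (by norm_num) fun α => ?_
    simp only [lp.coeFn_smul, Pi.smul_apply, smul_eq_mul, norm_mul, Complex.norm_real,
      Real.norm_eq_abs, abs_of_nonneg h0]
    exact mul_le_mul_of_nonneg_right (hC α) (norm_nonneg _)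
  rwa [norm_smul, Complex.norm_real, Real.norm_eq_abs, abs_of_nonneg h0] at key

open Classical in
/-- The diagonal operator `e_α ↦ d_α e_α` for a bounded family `d` (and `0` if `d` is unbounded). -/
def diagOp {n : ℕ} (d : Word n → ℝ) : Fock n →L[ℂ] Fock n :=
  if h : ∃ C, ∀ α, |d α| ≤ C then
    LinearMap.mkContinuous
      { toFun := fun φ => ⟨fun α => (d α : ℂ) * φ α, memlp_diag h.choose_spec φ⟩
        map_add' := fun φ ψ => by ext α; exact mul_add _ _ _
        map_smul' := fun c φ => by ext α; exact mul_left_comm _ _ _ }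
      h.choose (norm_diag_le h.choose_spec)
  else 0

/-! ### Operator topologies -/

section Topologies

variable {E : Type*} [NormedAddCommGroup E] [NormedSpace ℂ E]

/-- The weak operator topology on `B(E)`. -/
abbrev wot (E : Type*) [NormedAddCommGroup E] [NormedSpace ℂ E] : TopologicalSpace (E →L[ℂ] E) :=
  TopologicalSpace.induced (fun A => (ContinuousLinearMapWOT.ofCLM A : E →WOT[ℂ] E)) inferInstance

/-- The strong operator topology on `B(E)`. -/
abbrev sot (E : Type*) [NormedAddCommGroup E] [NormedSpace ℂ E] : TopologicalSpace (E →L[ℂ] E) :=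
  TopologicalSpace.induced
    (fun A => (ContinuousLinearMap.toPointwiseConvergenceCLM ℂ (RingHom.id ℂ) E E A : E →Lₚₜ[ℂ] E))
    inferInstance

/-- The family `F` is (unconditionally) summable in the weak operator topology. -/
def WOTSummable {ι : Type*} (F : ι → E →L[ℂ] E) : Prop := @Summable _ _ _ (wot E) F (.unconditional ι)

/-- The sum of a WOT-summable family. -/
def wotSum {ι : Type*} (F : ι → E →L[ℂ] E) : E →L[ℂ] E := @tsum _ _ _ (wot E) F (.unconditional ι)

/-- The family `F` is (unconditionally) summable in the strong operator topology. -/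
def SOTSummable {ι : Type*} (F : ι → E →L[ℂ] E) : Prop := @Summable _ _ _ (sot E) F (.unconditional ι)

/-- The sum of a SOT-summable family. -/
def sotSum {ι : Type*} (F : ι → E →L[ℂ] E) : E →L[ℂ] E := @tsum _ _ _ (sot E) F (.unconditional ι)

/-- `SOT-lim_{r → 1, r < 1} G r = A`. -/
def SOTLimOne (G : ℝ → E →L[ℂ] E) (A : E →L[ℂ] E) : Prop := Tendsto G (𝓝[<] 1) (@nhds _ (sot E) A)

end Topologies

/-! ### Positive regular free holomorphic functions and noncommutative domains -/

section Domains

variable {n : ℕ} {H : Type*} [NormedAddCommGroup H] [InnerProductSpace ℂ H] [CompleteSpace H]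

/-- `∑ a_α X_α` is a positive regular free holomorphic function on the noncommutative ball
`{X ∈ B(H)ⁿ : ‖∑ X_i X_i*‖ < ρ}`. -/
structure IsPositiveRegular (H : Type*) [NormedAddCommGroup H] [InnerProductSpace ℂ H]
    [CompleteSpace H] (a : Word n → ℝ) (ρ : ℝ) : Prop where
  nonneg : ∀ α, 0 ≤ a α
  map_one : a 1 = 0
  pos : ∀ i, 0 < a (FreeMonoid.of i)
  converges : ∀ X : Fin n → H →L[ℂ] H, ‖∑ i, X i * ContinuousLinearMap.adjoint (X i)‖ < ρ →
    ∃ S : H →L[ℂ] H,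
      Tendsto (fun N => ∑ k ∈ Finset.range N, homSum k fun α => (a α : ℂ) • mon X α) atTop (𝓝 S)

/-- The coefficient `b_α^{(m)}`: the sum over all factorizations `α = γ₁ ⋯ γ_j` into nonempty words
of `a_{γ₁} ⋯ a_{γ_j} * (j + m - 1).choose (m - 1)`. Factorizations into nonempty words are indexed
by the compositions of the length of `α`; the empty word gives `b_1 = 1`. -/
def bCoeff (a : Word n → ℝ) (m : ℕ) (α : Word n) : ℝ :=
  ∑ c : Composition α.toList.length,
    (((α.toList.splitWrtComposition c).map fun γ => a (FreeMonoid.ofList γ)).prod) *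
      ((c.length + m - 1).choose (m - 1) : ℝ)

/-- The universal model `W_i = S_i D_i`, `W_i e_α = √(b_α / b_{g_i α}) e_{g_i α}`. -/
def modelW (a : Word n → ℝ) (m : ℕ) (i : Fin n) : Fock n →L[ℂ] Fock n :=
  leftCreation i ∘L
    diagOp fun α => Real.sqrt (bCoeff a m α / bCoeff a m (FreeMonoid.of i * α))

/-- The weighted right creation operators `Λ_i e_α = √(b_α / b_{α g_i}) e_{α g_i}`. -/
def modelΛ (a : Word n → ℝ) (m : ℕ) (i : Fin n) : Fock n →L[ℂ] Fock n :=
  rightCreation i ∘L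
    diagOp fun α => Real.sqrt (bCoeff a m α / bCoeff a m (α * FreeMonoid.of i))

/-- The terms `a_α X_α Y X_α*` of the series defining `Φ_{f,X}(Y)`. (The term of the empty word
vanishes because `a_1 = 0`.) -/
def phiTerm (a : Word n → ℝ) (X : Fin n → H →L[ℂ] H) (Y : H →L[ℂ] H) (α : Word n) : H →L[ℂ] H :=
  (a α : ℂ) • (mon X α * Y * ContinuousLinearMap.adjoint (mon X α))

/-- `Φ_{f,X}(Y) = ∑ a_α X_α Y X_α*`, a WOT-convergent sum. -/
def phi (a : Word n → ℝ) (X : Fin n → H →L[ℂ] H) (Y : H →L[ℂ] H) : H →L[ℂ] H :=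
  wotSum (phiTerm a X Y)

/-- `(id - Φ_{f,X})^k (I)`. -/
def defect (a : Word n → ℝ) (X : Fin n → H →L[ℂ] H) (k : ℕ) : H →L[ℂ] H :=
  (fun Y => Y - phi a X Y)^[k] 1

/-- The noncommutative domain `D_f^m(H)`: the series `∑ a_α X_α X_α*` converges in the weak operator
topology and `(id - Φ_{f,X})^k (I) ≥ 0` for `1 ≤ k ≤ m`. -/
def domain (a : Word n → ℝ) (m : ℕ) (H : Type*) [NormedAddCommGroup H] [InnerProductSpace ℂ H]
    [CompleteSpace H] : Set (Fin n → H →L[ℂ] H) :=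
  {X | WOTSummable (phiTerm a X 1) ∧ ∀ k, 1 ≤ k → k ≤ m → (defect a X k).IsPositive}

/-- `rX = (rX₁, …, rX_n)`. -/
def scale (r : ℝ) (X : Fin n → H →L[ℂ] H) : Fin n → H →L[ℂ] H := fun i => (r : ℂ) • X i

/-- The radial property of `X` with respect to `D_f^m(H)`: `rX` is in the domain for all `r < 1` close
to `1`. -/
def HasRadialProperty (a : Word n → ℝ) (m : ℕ) (X : Fin n → H →L[ℂ] H) : Prop :=
  ∃ δ : ℝ, 0 < δ ∧ δ < 1 ∧ ∀ r : ℝ, δ < r → r < 1 → scale r X ∈ domain a m H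

/-- Complete non-coisometry: no `h ≠ 0` has `⟨Φ_{f,T}^k(I) h, h⟩ = ‖h‖²` for all `k ≥ 1`. -/
def IsCNC (a : Word n → ℝ) (T : Fin n → H →L[ℂ] H) : Prop :=
  ¬ ∃ h : H, h ≠ 0 ∧ ∀ k : ℕ, 1 ≤ k → inner ℂ h (((phi a T)^[k] 1) h) = ((‖h‖ ^ 2 : ℝ) : ℂ)

end Domains

/-! ### The Hardy algebra -/

section Hardy

variable {n : ℕ}

/-- The bounded operator `g` on the Fock space is given by the formal series `∑ c_β W_β`:
`∑ |c_β|² / b_β < ∞`, and `g p = ∑ c_β W_β p` for every polynomial `p`, i.e. every finite linear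
combination of the `e_α`. -/
def HasFourierSeries (a : Word n → ℝ) (m : ℕ) (g : Fock n →L[ℂ] Fock n) (c : Word n → ℂ) : Prop :=
  (Summable fun β => ‖c β‖ ^ 2 / bCoeff a m β) ∧
    ∀ p ∈ Submodule.span ℂ (Set.range (e : Word n → Fock n)),
      HasSum (fun β => c β • mon (modelW a m) β p) (g p)

/-- The underlying set of the Hardy algebra `F_n^∞(D_f^m)`. -/
def hardySet (a : Word n → ℝ) (m : ℕ) : Set (Fock n →L[ℂ] Fock n) :=
  {g | ∃ c, HasFourierSeries a m g c}

variable {H : Type*} [NormedAddCommGroup H] [InnerProductSpace ℂ H]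

/-- The homogeneous part `∑_{|α| = k} c_α r^{|α|} T_α`. -/
def homPart (c : Word n → ℂ) (T : Fin n → H →L[ℂ] H) (r : ℝ) (k : ℕ) : H →L[ℂ] H :=
  homSum k fun α => (c α * (r : ℂ) ^ α.length) • mon T α

/-- `g_r(T) = g(rT) = ∑_k ∑_{|α| = k} c_α r^{|α|} T_α`, a norm-convergent series. -/
def evalRadial (c : Word n → ℂ) (T : Fin n → H →L[ℂ] H) (r : ℝ) : H →L[ℂ] H :=
  ∑' k, homPart c T r k

end Hardy

/-! ### The noncommutative Berezin transform -/

section Berezin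

variable {n : ℕ} {H : Type*} [NormedAddCommGroup H] [InnerProductSpace ℂ H] [CompleteSpace H]

/-- The Hilbert space tensor product. -/
abbrev HTensor (E F : Type*) [NormedAddCommGroup E] [InnerProductSpace ℂ E]
    [NormedAddCommGroup F] [InnerProductSpace ℂ F] : Type _ :=
  UniformSpace.Completion (E ⊗[ℂ] F)

/-- The bounded operator `A ⊗ B` on the Hilbert space tensor product. -/
def tensorOp {E F : Type*} [NormedAddCommGroup E] [InnerProductSpace ℂ E]
    [NormedAddCommGroup F] [InnerProductSpace ℂ F] (A : E →L[ℂ] E) (B : F →L[ℂ] F) :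
    HTensor E F →L[ℂ] HTensor E F :=
  (TensorProduct.mapL A B).completion

/-- `x ↦ 1 ⊗ x`, where `1` is the vacuum vector of the Fock space. -/
def vacuumTensor (n : ℕ) (H : Type*) [NormedAddCommGroup H] [InnerProductSpace ℂ H] :
    H →L[ℂ] HTensor (Fock n) H :=
  UniformSpace.Completion.toComplL ∘L TensorProduct.mkL ℂ (Fock n) H (e 1)

/-- The terms `a_{α̃} Λ_α ⊗ T_{α̃}*`, where `α̃` is the reverse of `α`. -/
def berezinTerm (a : Word n → ℝ) (m : ℕ) (T : Fin n → H →L[ℂ] H) (α : Word n) :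
    HTensor (Fock n) H →L[ℂ] HTensor (Fock n) H :=
  (a α.reverse : ℂ) •
    tensorOp (mon (modelΛ a m) α) (ContinuousLinearMap.adjoint (mon T α.reverse))

/-- `I - ∑ a_{α̃} Λ_α ⊗ T_{α̃}*`, the series being SOT-convergent. -/
def berezinPencil (a : Word n → ℝ) (m : ℕ) (T : Fin n → H →L[ℂ] H) :
    HTensor (Fock n) H →L[ℂ] HTensor (Fock n) H :=
  1 - sotSum (berezinTerm a m T)

/-- The formula for the Berezin transform at `T` makes sense: `T` is in the domain, the series in it
converges, and the operator to be inverted is invertible. -/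
def BerezinDefined (a : Word n → ℝ) (m : ℕ) (T : Fin n → H →L[ℂ] H) : Prop :=
  T ∈ domain a m H ∧ SOTSummable (berezinTerm a m T) ∧ IsUnit (berezinPencil a m T)

/-- The noncommutative Berezin transform:
`⟨B_T[g] x, y⟩ = ⟨(R*)^m (g ⊗ Δ²) R^m (1 ⊗ x), 1 ⊗ y⟩`, where
`R = (I - ∑ a_{α̃} Λ_α ⊗ T_{α̃}*)⁻¹`, so that `R* = (I - ∑ a_{α̃} Λ_α* ⊗ T_{α̃})⁻¹`, and
`Δ² = (id - Φ_{f,T})^m (I)`. -/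
def berezin (a : Word n → ℝ) (m : ℕ) (T : Fin n → H →L[ℂ] H) (g : Fock n →L[ℂ] Fock n) :
    H →L[ℂ] H :=
  ContinuousLinearMap.adjoint (vacuumTensor n H) ∘L
    ContinuousLinearMap.adjoint (Ring.inverse (berezinPencil a m T) ^ m) ∘L
      tensorOp g (defect a T m) ∘L
        (Ring.inverse (berezinPencil a m T) ^ m) ∘L vacuumTensor n H

end Berezin

/-! ### Maps on algebras of operators -/

section Maps

variable {K H : Type*} [NormedAddCommGroup K] [InnerProductSpace ℂ K]
  [NormedAddCommGroup H] [InnerProductSpace ℂ H]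

/-- The operator on the direct sum of `k` copies of `E` given by a `k × k` matrix over `B(E)`. -/
def matOp {E : Type*} [NormedAddCommGroup E] [InnerProductSpace ℂ E] {k : ℕ}
    (A : Matrix (Fin k) (Fin k) (E →L[ℂ] E)) :
    PiLp 2 (fun _ : Fin k => E) →L[ℂ] PiLp 2 (fun _ : Fin k => E) :=
  (PiLp.continuousLinearEquiv 2 ℂ (fun _ : Fin k => E)).symm.toContinuousLinearMap ∘L
    ContinuousLinearMap.pi fun i => ∑ j, A i j ∘L PiLp.proj 2 (fun _ : Fin k => E) j

/-- `Φ` is completely contractive on the subalgebra `F` of `B(K)`. -/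
def IsCompletelyContractive (F : Subalgebra ℂ (K →L[ℂ] K)) (Φ : F → H →L[ℂ] H) : Prop :=
  ∀ (k : ℕ) (g : Matrix (Fin k) (Fin k) F),
    ‖matOp (g.map Φ)‖ ≤ ‖matOp (g.map fun x => (x : K →L[ℂ] K))‖

/-- `Φ` is WOT-continuous on bounded sets. -/
def WOTContinuousOnBounded (F : Subalgebra ℂ (K →L[ℂ] K)) (Φ : F → H →L[ℂ] H) : Prop :=
  ∀ S : Set F, Bornology.IsBounded S →
    @ContinuousOn _ _ (TopologicalSpace.induced Subtype.val (wot K)) (wot H) Φ S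

/-- `Φ` is SOT-continuous on bounded sets. -/
def SOTContinuousOnBounded (F : Subalgebra ℂ (K →L[ℂ] K)) (Φ : F → H →L[ℂ] H) : Prop :=
  ∀ S : Set F, Bornology.IsBounded S →
    @ContinuousOn _ _ (TopologicalSpace.induced Subtype.val (sot K)) (sot H) Φ S

end Maps

end NCDomain

end

noncomputable section

namespace NCDomain

/-! ### Factorizations of words and the coefficients of the universal model -/

section Coefficients

variable {n : ℕ}

/-! Write Δ_p = (id - Φ_{f,X})^p(I). The b_α are the coefficients of (1 - f)^{-m}, and the estimates
rest on the recursion (1 - f)^{-(p+1)} = (1 - f)^{-p} + (1 - f)^{-(p+1)} f (`powCoeff_succ`). Summed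
against Δ_{p+1} = Δ_p - Φ(Δ_p), it gives ∑ b_α X_α Δ_m X_α* ≤ I on the domain, with equality if Φ(I)
≤ qI for some q < 1. Hence the Berezin kernel K x = ∑ √b_α e_α ⊗ Δ_m^{1/2} X_α* x is a contraction.
It is an isometry at X = rT when r < 1 and rT lies in the domain, because Φ_{rT}(I) ≤ r² I.

Since K*(e_α ⊗ h) = √b_α X_α Δ_m^{1/2} h, the weights of W_i are exactly those for which g(X) K* =
K*(g ⊗ I) as soon as the series of g(X) converges (`IsKernel.intertwine`). At rT this gives g(rT) =
K*(g ⊗ I)K, a completely contractive compression. The m-th power of the inverse pencil maps 1 ⊗ x to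
∑ √b_α e_α ⊗ X_α* x (`IsKernel.inverse_pencil_pow`), so the same compression is the Berezin
transform (`berezin_eq_eval`).

At T itself K need not be isometric and the series of g(T) need not converge. But complete
non-coisometry makes K injective (`eq_zero_of_quad_defect_eq_zero`), so K* has dense range. There
g(rT) K*(e_α ⊗ x) is K* of r^{-|α|} δ_r(g e_α) ⊗ x, where δ_r e_β = r^{|β|} e_β, and this tends to
K*(g e_α ⊗ x). With ‖g(rT)‖ ≤ ‖g‖ the strong limit Φ(g) exists and satisfies Φ(g) K* = K*(g ⊗ I)
(`IsKernel.exists_limit`). This relation determines Φ(g), so Φ is a unital homomorphism; together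
with ‖Φ(g)‖ ≤ ‖g‖ it gives both continuity statements. Complete contractivity passes to the limit.
The Hardy set is an algebra because it is the commutant of the Λ_i
(`RegularCoeff.hardySet_eq_centralizer`). -/

/-- All factorizations of a word into nonempty words. -/
def facts (l : List (Fin n)) : Finset (List (List (Fin n))) :=
  Finset.univ.image fun c : Composition l.length => l.splitWrtComposition c

theorem mem_facts {l : List (Fin n)} {L : List (List (Fin n))} :
    L ∈ facts l ↔ L.flatten = l ∧ ∀ γ ∈ L, γ ≠ [] := by
  simp only [facts, Finset.mem_image, Finset.mem_univ, true_and]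
  constructor
  · rintro ⟨c, rfl⟩
    exact ⟨l.flatten_splitWrtComposition c, fun γ hγ =>
      List.length_pos_iff.1 (List.length_pos_of_mem_splitWrtComposition hγ)⟩
  · rintro ⟨rfl, h⟩
    refine ⟨⟨L.map List.length, ?_, ?_⟩, List.splitWrtComposition_flatten L _ rfl⟩
    · intro i hi
      obtain ⟨γ, hγ, rfl⟩ := List.mem_map.1 hi
      exact List.length_pos_iff.2 (h γ hγ)
    · rw [List.length_flatten]

/-- A composition is recovered from the lengths of its blocks, so nothing is counted twice. Lists of
factors avoid the dependence of the index type on the length of the word. -/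
theorem sum_composition_eq_sum_facts (l : List (Fin n)) (G : List (List (Fin n)) → ℝ) :
    ∑ c : Composition l.length, G (l.splitWrtComposition c) = ∑ L ∈ facts l, G L := by
  rw [facts, Finset.sum_image]
  intro c _ d _ h
  have := congrArg (List.map List.length) h
  simp only [List.map_length_splitWrtComposition] at this
  exact Composition.ext this

theorem facts_nil : facts ([] : List (Fin n)) = {[]} := by
  ext L
  rw [mem_facts, Finset.mem_singleton]
  constructor
  · rintro ⟨h, h'⟩
    rw [List.flatten_eq_nil_iff] at h
    by_contra hL
    obtain ⟨γ, hγ⟩ := List.exists_mem_of_ne_nil L hL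
    exact h' γ hγ (h γ hγ)
  · rintro rfl
    simp

/-- The last factor is a nonempty suffix, and the remaining factors factorize the complementary
prefix. This is the source of `powCoeff_succ`. -/
theorem facts_eq_biUnion {l : List (Fin n)} (hl : l ≠ []) :
    facts l = (Finset.range l.length).biUnion fun i =>
      (facts (l.take i)).image fun L => L ++ [l.drop i] := by
  ext L
  simp only [Finset.mem_biUnion, Finset.mem_range, Finset.mem_image, mem_facts]
  constructor
  · rintro ⟨rfl, h⟩
    rcases List.eq_nil_or_concat' L with rfl | ⟨L', γ, rfl⟩
    · simp at hl
    · have hγ := List.length_pos_iff.2 (h γ (by simp))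
      exact ⟨L'.flatten.length, by simp [hγ], L', ⟨by simp, fun δ hδ => h δ (by simp [hδ])⟩,
        by simp⟩
  · rintro ⟨i, hi, L', ⟨h1, h2⟩, rfl⟩
    refine ⟨by simp [h1], fun γ hγ => ?_⟩
    rcases List.mem_append.1 hγ with hγ | hγ
    · exact h2 γ hγ
    · rw [List.mem_singleton.1 hγ]
      simpa using hi

theorem sum_facts {l : List (Fin n)} (hl : l ≠ []) (G : List (List (Fin n)) → ℝ) :
    ∑ L ∈ facts l, G L =
      ∑ i ∈ Finset.range l.length, ∑ L ∈ facts (l.take i), G (L ++ [l.drop i]) := by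
  rw [facts_eq_biUnion hl, Finset.sum_biUnion]
  · refine Finset.sum_congr rfl fun i _ => ?_
    rw [Finset.sum_image]
    intro L _ L' _ h
    exact List.append_cancel_right h
  · intro i hi j hj hij
    rw [Function.onFun, Finset.disjoint_left]
    intro L h1 h2
    obtain ⟨L1, -, rfl⟩ := Finset.mem_image.1 h1
    obtain ⟨L2, -, h⟩ := Finset.mem_image.1 h2
    have h3 := congrArg List.length (List.append_inj_right' h rfl |> List.singleton_inj.1)
    simp only [List.length_drop] at h3
    have := Finset.mem_range.1 hi
    have := Finset.mem_range.1 hj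
    omega

/-- The coefficients of `(1 - f)^{-p}`, where `f` is the formal series with coefficients `a`. -/
def powCoeff (a : Word n → ℝ) (p : ℕ) (α : Word n) : ℝ :=
  ∑ L ∈ facts α.toList,
    (L.map fun γ => a (FreeMonoid.ofList γ)).prod * (Nat.multichoose p L.length : ℝ)

theorem bCoeff_eq_powCoeff (a : Word n → ℝ) {m : ℕ} (hm : 1 ≤ m) (α : Word n) :
    bCoeff a m α = powCoeff a m α := by
  rw [bCoeff, powCoeff, ← sum_composition_eq_sum_facts]
  refine Finset.sum_congr rfl fun c _ => ?_
  rw [List.length_splitWrtComposition, Nat.multichoose_eq]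
  congr 2
  -- The complementary lower indices `m - 1` and `j` add up to `j + m - 1` only because `1 ≤ m`.
  rw [add_comm m, ← Nat.choose_symm_of_eq_add]
  omega

/-- The convolution of two families of coefficients. -/
def conv (u v : Word n → ℝ) (γ : Word n) : ℝ :=
  ∑ i ∈ Finset.range (γ.length + 1),
    u (FreeMonoid.ofList (γ.toList.take i)) * v (FreeMonoid.ofList (γ.toList.drop i))

theorem powCoeff_one (a : Word n → ℝ) (p : ℕ) : powCoeff a p 1 = 1 := by
  simp [powCoeff, facts_nil]

theorem powCoeff_zero (a : Word n → ℝ) {α : Word n} (hα : α ≠ 1) : powCoeff a 0 α = 0 := by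
  refine Finset.sum_eq_zero fun L hL => ?_
  rcases L with _ | ⟨γ, L⟩
  · exact absurd (mem_facts.1 hL).1.symm hα
  · simp

/-- On formal series this is (1 - f)^{-(p+1)} = (1 - f)^{-p} + (1 - f)^{-(p+1)} f. On coefficients:
detach the last factor and use Pascal's rule for `Nat.multichoose`. -/
theorem powCoeff_succ {a : Word n → ℝ} (ha : a 1 = 0) (p : ℕ) (α : Word n) :
    powCoeff a (p + 1) α = powCoeff a p α + conv (powCoeff a (p + 1)) a α := by
  by_cases hα : α = 1
  · subst hα
    simp [powCoeff_one, conv, ha]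
  have hl : α.toList ≠ [] := hα
  rw [conv, Finset.sum_range_succ]
  -- The cut at the very end would leave an empty last factor; its term vanishes because `a 1 = 0`.
  have h0 : a (FreeMonoid.ofList (α.toList.drop α.length)) = 0 := by
    rw [FreeMonoid.length, List.drop_length]; exact ha
  rw [h0, mul_zero, add_zero, powCoeff, powCoeff, sum_facts hl, sum_facts hl,
    FreeMonoid.length, ← Finset.sum_add_distrib]
  refine Finset.sum_congr rfl fun i _ => ?_
  rw [powCoeff, Finset.sum_mul, FreeMonoid.toList_ofList, ← Finset.sum_add_distrib]
  refine Finset.sum_congr rfl fun L _ => ?_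
  simp only [List.map_append, List.prod_append, List.map_cons, List.map_nil, List.prod_cons,
    List.prod_nil, List.length_append, List.length_cons, List.length_nil,
    Nat.multichoose_succ_succ, Nat.cast_add, mul_one, zero_add]
  ring

theorem powCoeff_nonneg {a : Word n → ℝ} (ha : ∀ α, 0 ≤ a α) (p : ℕ) (α : Word n) :
    0 ≤ powCoeff a p α := by
  refine Finset.sum_nonneg fun L _ => mul_nonneg (List.prod_nonneg fun x hx => ?_) (by positivity)
  obtain ⟨γ, -, rfl⟩ := List.mem_map.1 hx
  exact ha _

theorem conv_nonneg {u v : Word n → ℝ} (hu : ∀ α, 0 ≤ u α) (hv : ∀ α, 0 ≤ v α) (γ : Word n) :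
    0 ≤ conv u v γ :=
  Finset.sum_nonneg fun _ _ => mul_nonneg (hu _) (hv _)

theorem conv_powCoeff_le {a : Word n → ℝ} (h0 : ∀ α, 0 ≤ a α) (ha : a 1 = 0) (p : ℕ)
    (α : Word n) : conv (powCoeff a (p + 1)) a α ≤ powCoeff a (p + 1) α := by
  rw [powCoeff_succ ha p α]
  linarith [powCoeff_nonneg h0 p α]

theorem powCoeff_mono {a : Word n → ℝ} (h0 : ∀ α, 0 ≤ a α) (ha : a 1 = 0) (α : Word n) :
    Monotone fun p => powCoeff a p α := by
  refine monotone_nat_of_le_succ fun p => ?_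
  rw [powCoeff_succ ha p α]
  linarith [conv_nonneg (powCoeff_nonneg h0 (p + 1)) h0 α]

theorem mul_le_conv {u v : Word n → ℝ} (hu : ∀ α, 0 ≤ u α) (hv : ∀ α, 0 ≤ v α) (β γ : Word n) :
    u β * v γ ≤ conv u v (β * γ) := by
  have h := Finset.single_le_sum (s := Finset.range ((β * γ).length + 1)) (a := β.length)
    (f := fun i => u (FreeMonoid.ofList ((β * γ).toList.take i)) *
      v (FreeMonoid.ofList ((β * γ).toList.drop i)))
    (fun i _ => mul_nonneg (hu _) (hv _)) (by simp [FreeMonoid.length_mul])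
  refine le_trans (le_of_eq ?_) h
  simp [FreeMonoid.length]

theorem powCoeff_mul_right {a : Word n → ℝ} (h0 : ∀ α, 0 ≤ a α) (ha : a 1 = 0) (p : ℕ)
    (α β : Word n) : powCoeff a (p + 1) α * a β ≤ powCoeff a (p + 1) (α * β) :=
  (mul_le_conv (powCoeff_nonneg h0 _) h0 α β).trans (conv_powCoeff_le h0 ha p _)

theorem conv_of_mul (u v : Word n → ℝ) (i : Fin n) (α : Word n) :
    conv u v (FreeMonoid.of i * α) = u 1 * v (FreeMonoid.of i * α) +
      conv (fun β => u (FreeMonoid.of i * β)) v α := by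
  rw [conv, FreeMonoid.length_mul, FreeMonoid.length_of, add_comm 1, Finset.sum_range_succ',
    add_comm]
  rfl

/-- The recursion works at the right end of a word, so a letter on the left has to be carried
through it: induction on `p`, and inside it (`key`) on the length of `α`. -/
theorem powCoeff_mul_left {a : Word n → ℝ} (h0 : ∀ α, 0 ≤ a α) (ha : a 1 = 0) (i : Fin n)
    (p : ℕ) (α : Word n) :
    a (FreeMonoid.of i) * powCoeff a (p + 1) α ≤ powCoeff a (p + 1) (FreeMonoid.of i * α) := by
  have key : ∀ p, (∀ α, a (FreeMonoid.of i) * powCoeff a p α ≤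
        powCoeff a p (FreeMonoid.of i * α) + powCoeff a (p + 1) 1 * a (FreeMonoid.of i * α)) →
      ∀ N, ∀ α : Word n, α.length ≤ N →
      a (FreeMonoid.of i) * powCoeff a (p + 1) α ≤
        powCoeff a (p + 1) (FreeMonoid.of i * α) := by
    intro p hp N
    induction N with
    | zero =>
      intro α hα
      have : α = 1 := FreeMonoid.length_eq_zero.1 (Nat.le_zero.1 hα)
      subst this
      have := powCoeff_mul_right h0 ha p 1 (FreeMonoid.of i)
      simpa [powCoeff_one] using this
    | succ N ih =>
      intro α hα
      rw [powCoeff_succ ha p α, powCoeff_succ ha p (FreeMonoid.of i * α), conv_of_mul, mul_add]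
      have h1 : a (FreeMonoid.of i) * conv (powCoeff a (p + 1)) a α ≤
          conv (fun β => powCoeff a (p + 1) (FreeMonoid.of i * β)) a α := by
        rw [conv, conv, Finset.mul_sum]
        refine Finset.sum_le_sum fun j hj => ?_
        rw [← mul_assoc]
        by_cases hjl : j = α.length
        · have : a (FreeMonoid.ofList (α.toList.drop j)) = 0 := by
            rw [hjl, FreeMonoid.length, List.drop_length]; exact ha
          simp [this]
        · refine mul_le_mul_of_nonneg_right (ih _ ?_) (h0 _)
          have := Finset.mem_range.1 hj
          simp only [FreeMonoid.length, FreeMonoid.toList_ofList, List.length_take] at *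
          omega
      linarith [hp α]
  -- The extra term is the cut of `g_i α` at position 0 in the recursion for `p + 1`. It is needed
  -- at `p = 0`, `α = 1`, where the left side is `a_{g_i}` while (1 - f)^0 has coefficient 0 at
  -- `g_i`.
  have hp : ∀ p, ∀ α, a (FreeMonoid.of i) * powCoeff a p α ≤
        powCoeff a p (FreeMonoid.of i * α) + powCoeff a (p + 1) 1 * a (FreeMonoid.of i * α) := by
    intro p
    induction p with
    | zero =>
      intro α
      by_cases hα : α = 1
      · subst hα
        have := powCoeff_nonneg h0 0 (FreeMonoid.of i * 1)
        simp [powCoeff_one] at this ⊢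
        exact this
      · rw [powCoeff_zero a hα, mul_zero]
        exact add_nonneg (powCoeff_nonneg h0 _ _)
          (mul_nonneg (powCoeff_nonneg h0 _ _) (h0 _))
    | succ p ih =>
      intro α
      have := key p ih _ α le_rfl
      have := mul_nonneg (powCoeff_nonneg h0 (p + 1 + 1) 1) (h0 (FreeMonoid.of i * α))
      linarith
  exact key p (hp p) _ α le_rfl

theorem powCoeff_pos {a : Word n → ℝ} (h0 : ∀ α, 0 ≤ a α) (ha : a 1 = 0)
    (hpos : ∀ i, 0 < a (FreeMonoid.of i)) (p : ℕ) (α : Word n) : 0 < powCoeff a (p + 1) α := by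
  induction α using FreeMonoid.inductionOn' with
  | one => simp [powCoeff_one]
  | of_mul i α ih => exact (mul_pos (hpos i) ih).trans_le (powCoeff_mul_left h0 ha i p α)

/-- Pairs of words correspond to words with a marked cut. -/
def cutEquiv (n : ℕ) : Word n × Word n ≃ Σ γ : Word n, Fin (γ.length + 1) where
  toFun p := ⟨p.1 * p.2, ⟨p.1.length, by rw [FreeMonoid.length_mul]; omega⟩⟩
  invFun s := (FreeMonoid.ofList (s.1.toList.take s.2), FreeMonoid.ofList (s.1.toList.drop s.2))
  left_inv p := by
    ext1
    · exact List.take_left' rfl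
    · exact List.drop_left' rfl
  right_inv s := by
    obtain ⟨γ, i, hi⟩ := s
    have h1 : FreeMonoid.ofList (γ.toList.take i) * FreeMonoid.ofList (γ.toList.drop i) = γ :=
      List.take_append_drop i γ.toList
    have h2 : (FreeMonoid.ofList (γ.toList.take i)).length = i := by
      simp only [FreeMonoid.length, FreeMonoid.toList_ofList, List.length_take] at *
      omega
    refine Sigma.ext h1 ?_
    exact (Fin.heq_ext_iff (congrArg (fun δ : Word n => δ.length + 1) h1)).2 h2

/-- A Cauchy product: pairs of words are words with a marked cut. In `ENNReal` the rearrangement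
needs no summability. -/
theorem tsum_tsum_mul_eq_tsum_conv {u v F : Word n → ℝ} (hu : ∀ α, 0 ≤ u α) (hv : ∀ α, 0 ≤ v α)
    (hF : ∀ α, 0 ≤ F α) :
    ∑' α, ∑' β, ENNReal.ofReal (u α * v β * F (α * β)) =
      ∑' γ, ENNReal.ofReal (conv u v γ * F γ) := by
  rw [← ENNReal.tsum_prod (f := fun α β => ENNReal.ofReal (u α * v β * F (α * β))),
    ← (cutEquiv n).symm.tsum_eq, ENNReal.tsum_sigma']
  refine tsum_congr fun γ => ?_
  rw [tsum_fintype, conv, Finset.sum_range, Finset.sum_mul, ENNReal.ofReal_sum_of_nonneg]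
  · refine Finset.sum_congr rfl fun i _ => ?_
    have h1 : FreeMonoid.ofList (γ.toList.take i) * FreeMonoid.ofList (γ.toList.drop i) = γ :=
      List.take_append_drop i γ.toList
    simp only [cutEquiv, Equiv.coe_fn_symm_mk, h1]
  · exact fun i _ => mul_nonneg (mul_nonneg (hu _) (hv _)) (hF _)

end Coefficients

/-! ### The universal model and the Hardy algebra -/

section Model

variable {n : ℕ}

/-- The conditions on the coefficients of a positive regular free holomorphic function. -/
structure RegularCoeff (a : Word n → ℝ) : Prop where
  nonneg : ∀ α, 0 ≤ a α
  map_one : a 1 = 0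
  pos : ∀ i, 0 < a (FreeMonoid.of i)

theorem bCoeff_one (a : Word n → ℝ) {m : ℕ} (hm : 1 ≤ m) : bCoeff a m 1 = 1 := by
  rw [bCoeff_eq_powCoeff a hm, powCoeff_one]

theorem RegularCoeff.bCoeff_pos {a : Word n → ℝ} (ha : RegularCoeff a) {m : ℕ} (hm : 1 ≤ m)
    (α : Word n) : 0 < bCoeff a m α := by
  obtain ⟨p, rfl⟩ := Nat.exists_eq_add_of_le' hm
  rw [bCoeff_eq_powCoeff a hm]
  exact powCoeff_pos ha.nonneg ha.map_one ha.pos p α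

/-- The difference of the two sides is a coefficient of (1 - f)^{-(m-1)}, hence nonnegative. This is
what makes the row of the `√a_β Λ_β̃` contractive. -/
theorem RegularCoeff.conv_bCoeff_le {a : Word n → ℝ} (ha : RegularCoeff a) {m : ℕ} (hm : 1 ≤ m)
    (α : Word n) : conv (bCoeff a m) a α ≤ bCoeff a m α := by
  obtain ⟨p, rfl⟩ := Nat.exists_eq_add_of_le' hm
  rw [funext (bCoeff_eq_powCoeff a hm)]
  exact conv_powCoeff_le ha.nonneg ha.map_one p α

theorem RegularCoeff.mul_bCoeff_le {a : Word n → ℝ} (ha : RegularCoeff a) {m : ℕ} (hm : 1 ≤ m)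
    (i : Fin n) (α : Word n) :
    a (FreeMonoid.of i) * bCoeff a m α ≤ bCoeff a m (FreeMonoid.of i * α) := by
  obtain ⟨p, rfl⟩ := Nat.exists_eq_add_of_le' hm
  simp only [bCoeff_eq_powCoeff a hm]
  exact powCoeff_mul_left ha.nonneg ha.map_one i p α

theorem RegularCoeff.bCoeff_mul_le {a : Word n → ℝ} (ha : RegularCoeff a) {m : ℕ} (hm : 1 ≤ m)
    (i : Fin n) (α : Word n) :
    bCoeff a m α * a (FreeMonoid.of i) ≤ bCoeff a m (α * FreeMonoid.of i) := by
  obtain ⟨p, rfl⟩ := Nat.exists_eq_add_of_le' hm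
  simp only [bCoeff_eq_powCoeff a hm]
  exact powCoeff_mul_right ha.nonneg ha.map_one p α _

/-! ### The basis of the Fock space and the weighted creation operators. -/

theorem e_eq_single [DecidableEq (Word n)] (α : Word n) : e α = lp.single 2 α (1 : ℂ) :=
  ((fockBasis n).repr_symm_single α).symm

theorem e_apply [DecidableEq (Word n)] (α β : Word n) :
    (e α : Fock n) β = if β = α then 1 else 0 := by
  rw [e_eq_single, lp.single_apply]
  by_cases h : β = α
  · subst h; simp
  · simp [h]

theorem orthonormal_e : Orthonormal ℂ (e : Word n → Fock n) := (fockBasis n).orthonormal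

theorem hasSum_e (φ : Fock n) : HasSum (fun α => φ α • e α) φ := (fockBasis n).hasSum_repr φ

theorem topologicalClosure_span_e :
    (Submodule.span ℂ (Set.range (e : Word n → Fock n))).topologicalClosure = ⊤ :=
  (fockBasis n).dense_span

theorem dense_span_e : Dense (Submodule.span ℂ (Set.range (e : Word n → Fock n)) : Set (Fock n)) :=
  Submodule.dense_iff_topologicalClosure_eq_top.2 topologicalClosure_span_e

theorem ext_e {G : Type*} [NormedAddCommGroup G] [NormedSpace ℂ G] {A B : Fock n →L[ℂ] G}
    (h : ∀ α, A (e α) = B (e α)) : A = B :=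
  ContinuousLinearMap.ext_on dense_span_e (by rintro _ ⟨α, rfl⟩; exact h α)

theorem linearIsometry_orthogonalFamily_e {v : Word n → Fock n} (hv : Orthonormal ℂ v)
    (α : Word n) : hv.orthogonalFamily.linearIsometry (e α) = v α := by
  classical
  rw [e_eq_single, hv.orthogonalFamily.linearIsometry_apply_single]
  simp

theorem leftCreation_e (i : Fin n) (α : Word n) :
    leftCreation i (e α) = e (FreeMonoid.of i * α) :=
  linearIsometry_orthogonalFamily_e (orthonormal_e.comp _ (mul_right_injective _)) α

theorem rightCreation_e (i : Fin n) (α : Word n) :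
    rightCreation i (e α) = e (α * FreeMonoid.of i) :=
  linearIsometry_orthogonalFamily_e (orthonormal_e.comp _ (mul_left_injective _)) α

theorem diagOp_apply {d : Word n → ℝ} {C : ℝ} (hC : ∀ α, |d α| ≤ C) (φ : Fock n) (α : Word n) :
    diagOp d φ α = (d α : ℂ) * φ α := by
  rw [diagOp, dif_pos ⟨C, hC⟩]
  rfl

theorem diagOp_e {d : Word n → ℝ} {C : ℝ} (hC : ∀ α, |d α| ≤ C) (α : Word n) :
    diagOp d (e α) = (d α : ℂ) • e α := by
  classical
  ext β
  rw [diagOp_apply hC, lp.coeFn_smul, Pi.smul_apply, e_apply, smul_eq_mul]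
  split_ifs with h
  · rw [h]
  · simp

theorem norm_diagOp_apply_le {d : Word n → ℝ} {C : ℝ} (hC : ∀ α, |d α| ≤ C) (φ : Fock n) :
    ‖diagOp d φ‖ ≤ C * ‖φ‖ := by
  convert norm_diag_le hC φ using 2
  ext α
  exact diagOp_apply hC φ α

variable {a : Word n → ℝ} {m : ℕ}

/-- `diagOp` has the default value 0 on unbounded families, so a bound is needed before the action
of `modelW` on the basis can be computed. -/
theorem RegularCoeff.sqrt_div_left_le (ha : RegularCoeff a) (hm : 1 ≤ m) (i : Fin n)
    (α : Word n) :
    |√(bCoeff a m α / bCoeff a m (FreeMonoid.of i * α))| ≤ √(1 / a (FreeMonoid.of i)) := by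
  rw [abs_of_nonneg (Real.sqrt_nonneg _)]
  refine Real.sqrt_le_sqrt ?_
  rw [div_le_div_iff₀ (ha.bCoeff_pos hm _) (ha.pos i)]
  linarith [ha.mul_bCoeff_le hm i α]

theorem RegularCoeff.sqrt_div_right_le (ha : RegularCoeff a) (hm : 1 ≤ m) (i : Fin n)
    (α : Word n) :
    |√(bCoeff a m α / bCoeff a m (α * FreeMonoid.of i))| ≤ √(1 / a (FreeMonoid.of i)) := by
  rw [abs_of_nonneg (Real.sqrt_nonneg _)]
  refine Real.sqrt_le_sqrt ?_
  rw [div_le_div_iff₀ (ha.bCoeff_pos hm _) (ha.pos i)]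
  linarith [ha.bCoeff_mul_le hm i α]

/-- The weight `√(b_α / b_β)`. -/
def wt (a : Word n → ℝ) (m : ℕ) (α β : Word n) : ℂ := ((√(bCoeff a m α / bCoeff a m β) : ℝ) : ℂ)

theorem RegularCoeff.wt_self (ha : RegularCoeff a) (hm : 1 ≤ m) (α : Word n) :
    wt a m α α = 1 := by
  rw [wt, div_self (ha.bCoeff_pos hm α).ne', Real.sqrt_one, Complex.ofReal_one]

/-- The weights telescope; the identities between monomials in weighted shifts reduce to this. -/
theorem RegularCoeff.wt_mul_wt (ha : RegularCoeff a) (hm : 1 ≤ m) (α β γ : Word n) :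
    wt a m α β * wt a m β γ = wt a m α γ := by
  rw [wt, wt, wt, ← Complex.ofReal_mul, ← Real.sqrt_mul (div_nonneg (ha.bCoeff_pos hm α).le
    (ha.bCoeff_pos hm β).le), div_mul_div_cancel₀ (ha.bCoeff_pos hm β).ne']

theorem RegularCoeff.wt_ne_zero (ha : RegularCoeff a) (hm : 1 ≤ m) (α β : Word n) :
    wt a m α β ≠ 0 := by
  intro h
  have := ha.wt_mul_wt hm α β α
  rw [h, zero_mul, ha.wt_self hm] at this
  exact zero_ne_one this

theorem RegularCoeff.modelW_e (ha : RegularCoeff a) (hm : 1 ≤ m) (i : Fin n) (α : Word n) :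
    modelW a m i (e α) = wt a m α (FreeMonoid.of i * α) • e (FreeMonoid.of i * α) := by
  rw [modelW, ContinuousLinearMap.comp_apply, diagOp_e (ha.sqrt_div_left_le hm i), map_smul,
    leftCreation_e]
  rfl

theorem RegularCoeff.modelΛ_e (ha : RegularCoeff a) (hm : 1 ≤ m) (i : Fin n) (α : Word n) :
    modelΛ a m i (e α) = wt a m α (α * FreeMonoid.of i) • e (α * FreeMonoid.of i) := by
  rw [modelΛ, ContinuousLinearMap.comp_apply, diagOp_e (ha.sqrt_div_right_le hm i), map_smul,
    rightCreation_e]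
  rfl

/-! ### Monomials in the model operators, and the Hardy set as a commutant. -/

theorem mon_one {A : Type*} [Monoid A] (X : Fin n → A) : mon X 1 = 1 := map_one _

theorem mon_mul {A : Type*} [Monoid A] (X : Fin n → A) (α β : Word n) :
    mon X (α * β) = mon X α * mon X β := map_mul _ _ _

theorem mon_of {A : Type*} [Monoid A] (X : Fin n → A) (i : Fin n) :
    mon X (FreeMonoid.of i) = X i := FreeMonoid.lift_eval_of _ _

theorem RegularCoeff.mon_modelW_e (ha : RegularCoeff a) (hm : 1 ≤ m) (β α : Word n) :
    mon (modelW a m) β (e α) = wt a m α (β * α) • e (β * α) := by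
  induction β using FreeMonoid.inductionOn' with
  | one => rw [mon_one, one_mul, ha.wt_self hm, one_smul]; rfl
  | of_mul i β ih =>
    rw [mon_mul, mon_of, mul_apply_eq_comp, ih, map_smul, ha.modelW_e hm, smul_smul,
      ← mul_assoc, ha.wt_mul_wt hm]

/-- The rightmost operator acts first and appends its letter first, so the reversed monomial appends
`β` in its own order. The base word changes along the induction, hence the generalization over `α`.
-/
theorem RegularCoeff.mon_modelΛ_reverse_e (ha : RegularCoeff a) (hm : 1 ≤ m) (β α : Word n) :
    mon (modelΛ a m) β.reverse (e α) = wt a m α (α * β) • e (α * β) := by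
  induction β using FreeMonoid.inductionOn' generalizing α with
  | one =>
    change mon (modelΛ a m) 1 (e α) = _
    rw [mon_one, mul_one, ha.wt_self hm, one_smul]; rfl
  | of_mul i β ih =>
    rw [FreeMonoid.reverse_mul, FreeMonoid.reverse_of, mon_mul, mon_of,
      mul_apply_eq_comp, ha.modelΛ_e hm, map_smul, ih, smul_smul, ha.wt_mul_wt hm,
      mul_assoc]

/-- Left and right multiplication of words commute, and both orders telescope to the same weight. -/
theorem RegularCoeff.commute_modelW_modelΛ (ha : RegularCoeff a) (hm : 1 ≤ m) (β : Word n)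
    (i : Fin n) : mon (modelW a m) β * modelΛ a m i = modelΛ a m i * mon (modelW a m) β := by
  refine ext_e fun α => ?_
  rw [mul_apply_eq_comp, mul_apply_eq_comp, ha.modelΛ_e hm, map_smul,
    ha.mon_modelW_e hm, ha.mon_modelW_e hm, map_smul, ha.modelΛ_e hm, smul_smul, smul_smul,
    ha.wt_mul_wt hm, ha.wt_mul_wt hm, mul_assoc]

theorem RegularCoeff.modelΛ_mem_span (ha : RegularCoeff a) (hm : 1 ≤ m) (i : Fin n)
    {p : Fock n} (hp : p ∈ Submodule.span ℂ (Set.range (e : Word n → Fock n))) :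
    modelΛ a m i p ∈ Submodule.span ℂ (Set.range (e : Word n → Fock n)) := by
  induction hp using Submodule.span_induction with
  | mem x hx =>
    obtain ⟨α, rfl⟩ := hx
    rw [ha.modelΛ_e hm]
    exact Submodule.smul_mem _ _ (Submodule.subset_span ⟨_, rfl⟩)
  | zero => simp
  | add x y _ _ hx hy => rw [map_add]; exact Submodule.add_mem _ hx hy
  | smul c x _ hx => rw [map_smul]; exact Submodule.smul_mem _ _ hx

/-- Elements of the Hardy set commute with the weighted right creation operators. -/
theorem RegularCoeff.comm_of_hasFourierSeries (ha : RegularCoeff a) (hm : 1 ≤ m)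
    {g : Fock n →L[ℂ] Fock n} {c : Word n → ℂ} (hg : HasFourierSeries a m g c) (i : Fin n) :
    modelΛ a m i * g = g * modelΛ a m i := by
  refine ext_e fun α => ?_
  have hα : e α ∈ Submodule.span ℂ (Set.range (e : Word n → Fock n)) :=
    Submodule.subset_span ⟨α, rfl⟩
  have h1 := (hg.2 _ hα).mapL (modelΛ a m i)
  have h2 := hg.2 _ (ha.modelΛ_mem_span hm i hα)
  refine h1.unique (h2.congr_fun fun β => ?_)
  rw [map_smul]
  congr 1
  exact (congrArg (fun A : Fock n →L[ℂ] Fock n => A (e α))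
    (ha.commute_modelW_modelΛ hm β i)).symm

theorem summable_norm_sq (φ : Fock n) : Summable fun α => ‖φ α‖ ^ 2 := by
  have := (memℓp_gen_iff (p := 2) (by norm_num)).1 (lp.memℓp φ)
  simpa using this

/-- Operators commuting with the weighted right creation operators have a Fourier series. -/
theorem RegularCoeff.hasFourierSeries_of_comm (ha : RegularCoeff a) (hm : 1 ≤ m)
    {g : Fock n →L[ℂ] Fock n} (hg : ∀ i, modelΛ a m i * g = g * modelΛ a m i) :
    HasFourierSeries a m g fun β => wt a m β 1 * g (e 1) β := by
  refine ⟨?_, fun p hp => ?_⟩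
  · refine (summable_norm_sq (g (e 1))).congr fun β => ?_
    have hb := ha.bCoeff_pos hm β
    rw [norm_mul, wt, Complex.norm_real, Real.norm_of_nonneg (Real.sqrt_nonneg _), mul_pow,
      Real.sq_sqrt (div_nonneg hb.le (ha.bCoeff_pos hm 1).le), bCoeff_one a hm]
    field_simp
  -- At the vacuum the series is the basis expansion of `g (e 1)`. As `e_{α g_i}` is a multiple of
  -- `Λ_i e_α`, and `g` and all `W_β` commute with `Λ_i`, the expansion passes from `e_α` to `e_{α
  -- g_i}`.
  · induction hp using Submodule.span_induction with
    | mem x hx =>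
      obtain ⟨α, rfl⟩ := hx
      induction α using List.reverseRecOn with
      | nil =>
        change HasSum (fun β => _ • mon (modelW a m) β (e 1)) (g (e 1))
        convert hasSum_e (g (e 1)) using 2 with β
        rw [ha.mon_modelW_e hm, smul_smul, mul_one, mul_right_comm, ha.wt_mul_wt hm,
          ha.wt_self hm, one_mul]
      | append_singleton α i ih =>
        change HasSum (fun β => _ • mon (modelW a m) β (e (FreeMonoid.ofList α * FreeMonoid.of i)))
          (g (e (FreeMonoid.ofList α * FreeMonoid.of i)))
        have he : e (FreeMonoid.ofList α * FreeMonoid.of i) =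
            (wt a m (FreeMonoid.ofList α) (FreeMonoid.ofList α * FreeMonoid.of i))⁻¹ •
              modelΛ a m i (e (FreeMonoid.ofList α)) := by
          rw [ha.modelΛ_e hm, smul_smul, inv_mul_cancel₀ (ha.wt_ne_zero hm _ _), one_smul]
        have h1 := (ih.mapL (modelΛ a m i)).const_smul
          (wt a m (FreeMonoid.ofList α) (FreeMonoid.ofList α * FreeMonoid.of i))⁻¹
        have h2 := congrArg (fun A : Fock n →L[ℂ] Fock n => A (e (FreeMonoid.ofList α))) (hg i)
        simp only [mul_apply_eq_comp] at h2
        rw [he, map_smul, ← h2]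
        refine h1.congr_fun fun β => ?_
        have h3 := congrArg (fun A : Fock n →L[ℂ] Fock n => A (e (FreeMonoid.ofList α)))
          (ha.commute_modelW_modelΛ hm β i)
        simp only [mul_apply_eq_comp] at h3
        rw [map_smul, map_smul, h3, smul_comm]
        rfl
    | zero => simp
    | add x y _ _ hx hy =>
      rw [map_add]
      simpa only [map_add, smul_add] using hx.add hy
    | smul t x _ hx =>
      rw [map_smul]
      refine (hx.const_smul t).congr_fun fun β => ?_
      rw [map_smul, smul_comm]

/-- As a commutant the Hardy set is visibly a unital algebra; no product of Fourier series has to be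
formed. -/
theorem RegularCoeff.hardySet_eq_centralizer (ha : RegularCoeff a) (hm : 1 ≤ m) :
    (Subalgebra.centralizer ℂ (Set.range (modelΛ a m)) : Set (Fock n →L[ℂ] Fock n)) =
      hardySet a m := by
  ext g
  simp only [SetLike.mem_coe, Subalgebra.mem_centralizer_iff, Set.forall_mem_range]
  exact ⟨fun hg => ⟨_, ha.hasFourierSeries_of_comm hm hg⟩,
    fun ⟨c, hc⟩ i => ha.comm_of_hasFourierSeries hm hc i⟩

theorem RegularCoeff.hasSum_apply_e (ha : RegularCoeff a) (hm : 1 ≤ m)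
    {g : Fock n →L[ℂ] Fock n} {c : Word n → ℂ} (hg : HasFourierSeries a m g c) (α : Word n) :
    HasSum (fun β => (c β * wt a m α (β * α)) • e (β * α)) (g (e α)) := by
  refine (hg.2 _ (Submodule.subset_span ⟨α, rfl⟩)).congr_fun fun β => ?_
  rw [ha.mon_modelW_e hm, smul_smul]

end Model

/-! ### Hilbert space tensor products -/

section Tensor

variable {E F E' F' E'' F'' G : Type*} [NormedAddCommGroup E] [InnerProductSpace ℂ E]
  [NormedAddCommGroup F] [InnerProductSpace ℂ F] [NormedAddCommGroup E'] [InnerProductSpace ℂ E']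
  [NormedAddCommGroup F'] [InnerProductSpace ℂ F']
  [NormedAddCommGroup E''] [InnerProductSpace ℂ E'']
  [NormedAddCommGroup F''] [InnerProductSpace ℂ F''] [NormedAddCommGroup G] [NormedSpace ℂ G]

/-- The elementary tensor `φ ⊗ x` in the Hilbert space tensor product. -/
def ten : E →L[ℂ] F →L[ℂ] HTensor E F :=
  (ContinuousLinearMap.compL ℂ F (E ⊗[ℂ] F) (HTensor E F) UniformSpace.Completion.toComplL) ∘L
    TensorProduct.mkL ℂ E F

theorem ten_apply (φ : E) (x : F) : ten φ x = ((φ ⊗ₜ[ℂ] x : E ⊗[ℂ] F) : HTensor E F) := rfl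

theorem inner_ten (φ ψ : E) (x y : F) :
    inner ℂ (ten φ x) (ten ψ y) = inner ℂ φ ψ * inner ℂ x y := by
  rw [ten_apply, ten_apply, UniformSpace.Completion.inner_coe, TensorProduct.inner_tmul]

theorem ext_ten {A B : HTensor E F →L[ℂ] G} (h : ∀ φ x, A (ten φ x) = B (ten φ x)) : A = B := by
  ext z
  induction z using UniformSpace.Completion.induction_on with
  | hp => exact isClosed_eq A.continuous B.continuous
  | ih z =>
    induction z using TensorProduct.induction_on with
    | zero => rw [UniformSpace.Completion.coe_zero, map_zero, map_zero]
    | tmul φ x => exact h φ x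
    | add z w hz hw => rw [UniformSpace.Completion.coe_add, map_add, map_add, hz, hw]

/-- The bounded operator `A ⊗ B` between Hilbert space tensor products. -/
def tensorMap (A : E →L[ℂ] E') (B : F →L[ℂ] F') : HTensor E F →L[ℂ] HTensor E' F' :=
  (TensorProduct.mapL A B).completion

theorem tensorOp_eq_tensorMap (A : E →L[ℂ] E) (B : F →L[ℂ] F) : tensorOp A B = tensorMap A B := rfl

theorem tensorMap_ten (A : E →L[ℂ] E') (B : F →L[ℂ] F') (φ : E) (x : F) :
    tensorMap A B (ten φ x) = ten (A φ) (B x) := by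
  rw [tensorMap, ten_apply, ContinuousLinearMap.completion_apply_coe, TensorProduct.mapL_tmul]
  rfl

theorem tensorOp_ten (A : E →L[ℂ] E) (B : F →L[ℂ] F) (φ : E) (x : F) :
    tensorOp A B (ten φ x) = ten (A φ) (B x) := tensorMap_ten A B φ x

theorem tensorMap_comp (A : E' →L[ℂ] E'') (B : F' →L[ℂ] F'') (C : E →L[ℂ] E') (D : F →L[ℂ] F') :
    tensorMap A B ∘L tensorMap C D = tensorMap (A ∘L C) (B ∘L D) :=
  ext_ten fun φ x => by simp only [ContinuousLinearMap.comp_apply, tensorMap_ten]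

theorem comp_conj {F : Type*} [NormedAddCommGroup F] [NormedSpace ℂ F] (J : G →L[ℂ] F)
    (L : F →L[ℂ] G) {P Q R : G →L[ℂ] G} (h : R = P ∘L Q ∘L P) :
    J ∘L R ∘L L = (J ∘L P) ∘L Q ∘L (P ∘L L) := by
  rw [h]
  rfl

/-- This form lets the defect `D²` in the Berezin transform be split between the two kernels. -/
theorem tensorOp_comp_self (g : E →L[ℂ] E) (D : F →L[ℂ] F) :
    tensorOp g (D ∘L D) = tensorOp 1 D ∘L tensorOp g 1 ∘L tensorOp 1 D := by
  refine ext_ten fun φ x => ?_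
  simp only [ContinuousLinearMap.comp_apply, tensorOp_ten, one_apply_eq_self]

theorem norm_tensorMap_apply_le (A : E →L[ℂ] E') (B : F →L[ℂ] F') (z : HTensor E F) :
    ‖tensorMap A B z‖ ≤ ‖A‖ * ‖B‖ * ‖z‖ := by
  induction z using UniformSpace.Completion.induction_on with
  | hp => exact isClosed_le (by fun_prop) (by fun_prop)
  | ih z =>
    rw [tensorMap, ContinuousLinearMap.completion_apply_coe, UniformSpace.Completion.norm_coe,
      UniformSpace.Completion.norm_coe]
    exact (TensorProduct.mapL A B).le_of_opNorm_le (TensorProduct.norm_mapL_le A B) z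

/-- The two arguments are reduced to elementary tensors one at a time, with a conjugation in
between. The adjoints are supplied as maps, so the factors need not be complete. -/
theorem inner_tensorMap_left {A : E →L[ℂ] E'} {A' : E' →L[ℂ] E} {B : F →L[ℂ] F'} {B' : F' →L[ℂ] F}
    (hA : ∀ u v, inner ℂ (A u) v = inner ℂ u (A' v))
    (hB : ∀ u v, inner ℂ (B u) v = inner ℂ u (B' v)) (z : HTensor E F) (w : HTensor E' F') :
    inner ℂ (tensorMap A B z) w = inner ℂ z (tensorMap A' B' w) := by
  have h1 : ∀ φ x, (innerSL ℂ (tensorMap A B (ten φ x))) =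
      innerSL ℂ (ten φ x) ∘L tensorMap A' B' := by
    intro φ x
    refine ext_ten fun ψ y => ?_
    simp only [innerSL_apply_apply, ContinuousLinearMap.comp_apply, tensorMap_ten, inner_ten, hA,
      hB]
  have h2 : innerSL ℂ w ∘L tensorMap A B = innerSL ℂ (tensorMap A' B' w) := by
    refine ext_ten fun φ x => ?_
    have := congrArg (fun L : HTensor E' F' →L[ℂ] ℂ => (starRingEnd ℂ) (L w)) (h1 φ x)
    simpa [inner_conj_symm] using this
  have := congrArg (fun L : HTensor E F →L[ℂ] ℂ => (starRingEnd ℂ) (L z)) h2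
  simpa [inner_conj_symm] using this

end Tensor

/-! ### Coordinates on the tensor product with the Fock space -/

section Coordinates

variable {n : ℕ} {H : Type*} [NormedAddCommGroup H] [InnerProductSpace ℂ H]

theorem ext_ten_e {G : Type*} [NormedAddCommGroup G] [NormedSpace ℂ G]
    {A B : HTensor (Fock n) H →L[ℂ] G}
    (h : ∀ α x, A (ten (e α) x) = B (ten (e α) x)) : A = B := by
  refine ext_ten fun φ x => ?_
  have : A ∘L (ten (E := Fock n) (F := H)).flip x = B ∘L (ten (E := Fock n) (F := H)).flip x :=
    ext_e fun α => h α x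
  exact congrArg (fun L : Fock n →L[ℂ] G => L φ) this

variable [CompleteSpace H]

/-- The coordinate of index `α` of a vector of `F² ⊗ H = ⨁_α e_α ⊗ H`. -/
def coord (H : Type*) [NormedAddCommGroup H] [InnerProductSpace ℂ H] [CompleteSpace H]
    (α : Word n) : HTensor (Fock n) H →L[ℂ] H :=
  ContinuousLinearMap.adjoint (ten (e α))

theorem inner_e_left (α : Word n) (φ : Fock n) : inner ℂ (e α) φ = φ α :=
  ((fockBasis n).repr_apply_apply φ α).symm

theorem coord_ten (α : Word n) (φ : Fock n) (x : H) : coord H α (ten φ x) = φ α • x := by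
  refine ext_inner_left ℂ fun y => ?_
  rw [coord, ContinuousLinearMap.adjoint_inner_right, inner_ten, inner_e_left, inner_smul_right]

/-- The embedding `x ↦ e_α ⊗ x` as an isometry. -/
def tenIsometry (H : Type*) [NormedAddCommGroup H] [InnerProductSpace ℂ H] (α : Word n) :
    H →ₗᵢ[ℂ] HTensor (Fock n) H :=
  (ten (e α) : H →L[ℂ] HTensor (Fock n) H).toLinearMap.isometryOfInner fun x y => by
    change inner ℂ (ten (e α) x) (ten (e α) y) = _
    rw [inner_ten, inner_self_eq_norm_sq_to_K, orthonormal_e.1 α]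
    simp

theorem isHilbertSum_tenIsometry :
    IsHilbertSum ℂ (fun _ : Word n => H) (tenIsometry H) := by
  refine IsHilbertSum.mk ?_ ?_
  · intro α β hαβ x y
    change inner ℂ (ten (e α) x) (ten (e β) y) = 0
    rw [inner_ten, orthonormal_e.2 hαβ, zero_mul]
  · rw [top_le_iff, Submodule.topologicalClosure_eq_top_iff, Submodule.eq_bot_iff]
    intro z hz
    have h0 : innerSL ℂ z = 0 := by
      refine ext_ten_e fun α x => ?_
      rw [Submodule.mem_orthogonal'] at hz
      exact hz _ (Submodule.mem_iSup_of_mem α ⟨x, rfl⟩)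
    have := congrArg (fun L : HTensor (Fock n) H →L[ℂ] ℂ => L z) h0
    simpa using this

/-- The identification of `F² ⊗ H` with the space of square summable families in `H`. -/
def coordEquiv : HTensor (Fock n) H ≃ₗᵢ[ℂ] lp (fun _ : Word n => H) 2 :=
  isHilbertSum_tenIsometry.linearIsometryEquiv

theorem coordEquiv_apply (z : HTensor (Fock n) H) (α : Word n) :
    coordEquiv z α = coord H α z := by
  classical
  refine ext_inner_left ℂ fun y : H => ?_
  have h : coordEquiv (ten (e α) y) = lp.single 2 α y := by
    rw [← LinearIsometryEquiv.eq_symm_apply]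
    exact (isHilbertSum_tenIsometry.linearIsometryEquiv_symm_apply_single y).symm
  rw [coord, ContinuousLinearMap.adjoint_inner_right,
    ← coordEquiv.inner_map_map (ten (e α) y), h]
  exact (lp.inner_single_left (𝕜 := ℂ) α y (coordEquiv z)).symm

theorem hasSum_norm_coord_sq (z : HTensor (Fock n) H) :
    HasSum (fun α => ‖coord H α z‖ ^ 2) (‖z‖ ^ 2) := by
  have := lp.hasSum_norm (p := 2) (by norm_num) (coordEquiv z)
  simpa [coordEquiv_apply] using this

theorem tsum_norm_coord_sq (z : HTensor (Fock n) H) :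
    ∑' α, ENNReal.ofReal (‖coord H α z‖ ^ 2) = ENNReal.ofReal (‖z‖ ^ 2) := by
  rw [← (hasSum_norm_coord_sq z).tsum_eq, ENNReal.ofReal_tsum_of_nonneg (fun _ => by positivity)
    (hasSum_norm_coord_sq z).summable]

theorem ext_coord {z w : HTensor (Fock n) H} (h : ∀ α, coord H α z = coord H α w) : z = w := by
  refine coordEquiv.injective ?_
  ext α
  rw [coordEquiv_apply, coordEquiv_apply, h]

theorem exists_coord_eq {f : Word n → H} (hf : Summable fun α => ‖f α‖ ^ 2) :
    ∃ z : HTensor (Fock n) H, ∀ α, coord H α z = f α := by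
  have hm : Memℓp f 2 := memℓp_gen (by simpa using hf)
  refine ⟨coordEquiv.symm ⟨f, hm⟩, fun α => ?_⟩
  rw [← coordEquiv_apply, LinearIsometryEquiv.apply_symm_apply]

theorem summable_of_tsum_ofReal_le {ι : Type*} {f : ι → ℝ} (hf : ∀ i, 0 ≤ f i) {C : ℝ}
    (h : ∑' i, ENNReal.ofReal (f i) ≤ ENNReal.ofReal C) : Summable f := by
  have := ENNReal.summable_toReal (ne_top_of_le_ne_top ENNReal.ofReal_ne_top h)
  exact this.congr fun i => ENNReal.toReal_ofReal (hf i)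

/-- A column of operators `B_α` with `∑ ‖B_α x‖² ≤ C ‖x‖²` defines an operator into `F² ⊗ H`. -/
theorem exists_column {B : Word n → H →L[ℂ] H} {C : ℝ} (hC : 0 ≤ C)
    (hB : ∀ x, ∑' α, ENNReal.ofReal (‖B α x‖ ^ 2) ≤ ENNReal.ofReal (C * ‖x‖ ^ 2)) :
    ∃ K : H →L[ℂ] HTensor (Fock n) H, ∀ x α, coord H α (K x) = B α x := by
  have hs : ∀ x, Summable fun α => ‖B α x‖ ^ 2 := fun x =>
    summable_of_tsum_ofReal_le (fun _ => by positivity) (hB x)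
  choose k hk using fun x => exists_coord_eq (hs x)
  refine ⟨LinearMap.mkContinuous
    { toFun := k
      map_add' := fun x y => ext_coord fun α => by rw [map_add, hk, hk, hk, map_add]
      map_smul' := fun c x => ext_coord fun α => by
        rw [RingHom.id_apply, map_smul, hk, hk, map_smul] } (√C) fun x => ?_, hk⟩
  refine abs_le_of_sq_le_sq' ?_ (by positivity) |>.2
  rw [mul_pow, Real.sq_sqrt hC]
  have h := hB x
  simp only [← hk, tsum_norm_coord_sq] at h
  exact (ENNReal.ofReal_le_ofReal_iff (by positivity)).1 h

theorem adjoint_ten_of_coord {K : H →L[ℂ] HTensor (Fock n) H} {B : Word n → H →L[ℂ] H}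
    (hK : ∀ x α, coord H α (K x) = B α x) (α : Word n) (x : H) :
    ContinuousLinearMap.adjoint K (ten (e α) x) = ContinuousLinearMap.adjoint (B α) x := by
  refine ext_inner_right ℂ fun y => ?_
  rw [ContinuousLinearMap.adjoint_inner_left, ContinuousLinearMap.adjoint_inner_left, ← hK, coord,
    ContinuousLinearMap.adjoint_inner_right]

theorem coord_tensorOp_one (B : H →L[ℂ] H) (α : Word n) (z : HTensor (Fock n) H) :
    coord H α (tensorOp 1 B z) = B (coord H α z) := by
  have : coord H α ∘L tensorOp 1 B = B ∘L coord H α := ext_ten fun φ x => by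
    simp only [ContinuousLinearMap.comp_apply, tensorOp_ten, coord_ten, map_smul]
    rfl
  exact congrArg (fun L : HTensor (Fock n) H →L[ℂ] H => L z) this

end Coordinates

/-! ### Amplifications of matrices of operators -/

section Matrices

variable {E F : Type*} [NormedAddCommGroup E] [InnerProductSpace ℂ E]
  [NormedAddCommGroup F] [InnerProductSpace ℂ F] {k : ℕ}

theorem matOp_apply (A : Matrix (Fin k) (Fin k) (E →L[ℂ] E)) (x : PiLp 2 fun _ : Fin k => E)
    (i : Fin k) : matOp A x i = ∑ j, A i j (x j) := by
  simp [matOp]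

theorem norm_matOp_le {A : Matrix (Fin k) (Fin k) (E →L[ℂ] E)} {C : ℝ} (hC : 0 ≤ C)
    (h : ∀ x : Fin k → E, ∑ i, ‖∑ j, A i j (x j)‖ ^ 2 ≤ C ^ 2 * ∑ j, ‖x j‖ ^ 2) :
    ‖matOp A‖ ≤ C := by
  refine ContinuousLinearMap.opNorm_le_bound _ hC fun x => ?_
  refine abs_le_of_sq_le_sq' ?_ (by positivity) |>.2
  rw [mul_pow, PiLp.norm_sq_eq_of_L2, PiLp.norm_sq_eq_of_L2]
  simpa only [matOp_apply] using h x

theorem sum_norm_matOp_sq_le (A : Matrix (Fin k) (Fin k) (E →L[ℂ] E)) (x : Fin k → E) :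
    ∑ i, ‖∑ j, A i j (x j)‖ ^ 2 ≤ ‖matOp A‖ ^ 2 * ∑ j, ‖x j‖ ^ 2 := by
  have h := (matOp A).le_opNorm (WithLp.toLp 2 x)
  have h2 := pow_le_pow_left₀ (norm_nonneg _) h 2
  rw [mul_pow, PiLp.norm_sq_eq_of_L2, PiLp.norm_sq_eq_of_L2] at h2
  simpa only [matOp_apply] using h2

/-- The `j`-th coordinate embedding of `E` into the direct sum of `k` copies of `E`. -/
def injPi (E : Type*) [NormedAddCommGroup E] [InnerProductSpace ℂ E] (j : Fin k) :
    E →L[ℂ] PiLp 2 fun _ : Fin k => E :=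
  (PiLp.continuousLinearEquiv 2 ℂ (fun _ : Fin k => E)).symm.toContinuousLinearMap ∘L
    ContinuousLinearMap.single ℂ (fun _ : Fin k => E) j

theorem injPi_apply (i j : Fin k) (x : E) : injPi E j x i = if i = j then x else 0 := by
  simp [injPi]

/-- The `i`-th coordinate projection of the direct sum of `k` copies of `E`. -/
def projPi (E : Type*) [NormedAddCommGroup E] [InnerProductSpace ℂ E] (i : Fin k) :
    (PiLp 2 fun _ : Fin k => E) →L[ℂ] E := PiLp.proj 2 (fun _ : Fin k => E) i

theorem projPi_apply (i : Fin k) (x : PiLp 2 fun _ : Fin k => E) : projPi E i x = x i := rfl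

/-- Pythagoras for E^k ⊗ F = (E ⊗ F)^k: injection and projection, tensored with 1, are adjoint to
each other, and their products sum to the identity. -/
theorem norm_sq_eq_sum_projPi (w : HTensor (PiLp 2 fun _ : Fin k => E) F) :
    ‖w‖ ^ 2 = ∑ i, ‖tensorMap (projPi E i) (1 : F →L[ℂ] F) w‖ ^ 2 := by
  have h1 : (∑ i, tensorMap (injPi E i) (1 : F →L[ℂ] F) ∘L
      tensorMap (projPi E i) (1 : F →L[ℂ] F) :
        HTensor (PiLp 2 fun _ : Fin k => E) F →L[ℂ] HTensor (PiLp 2 fun _ : Fin k => E) F) =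
      ContinuousLinearMap.id ℂ _ := by
    refine ext_ten fun φ x => ?_
    have h : ∑ i, injPi E i (projPi E i φ) = φ := by
      ext i
      simp [injPi_apply, projPi_apply]
    simp only [sum_apply, ContinuousLinearMap.comp_apply, tensorMap_ten,
      ContinuousLinearMap.id_apply]
    conv_rhs => rw [← h, map_sum, sum_apply]
    rfl
  have h2 : ∀ (i : Fin k) z, inner ℂ w (tensorMap (injPi E i) (1 : F →L[ℂ] F) z) =
      inner ℂ (tensorMap (projPi E i) (1 : F →L[ℂ] F) w) z := by
    intro i z
    refine (inner_tensorMap_left (fun u v => ?_) (fun u v => rfl) w z).symm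
    rw [PiLp.inner_apply, Finset.sum_eq_single i]
    · simp [injPi_apply, projPi_apply]
    · intro j _ hj; simp [injPi_apply, hj]
    · simp
  have h3 : inner ℂ w w = ∑ i, inner ℂ (tensorMap (projPi E i) (1 : F →L[ℂ] F) w)
      (tensorMap (projPi E i) (1 : F →L[ℂ] F) w) := by
    have h := congrArg (fun L : HTensor (PiLp 2 fun _ : Fin k => E) F →L[ℂ]
      HTensor (PiLp 2 fun _ : Fin k => E) F => inner ℂ w (L w)) h1
    simp only [sum_apply, ContinuousLinearMap.comp_apply, inner_sum, h2,
      ContinuousLinearMap.id_apply] at h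
    exact h.symm
  simp only [inner_self_eq_norm_sq_to_K] at h3
  exact_mod_cast h3

/-- Under E^k ⊗ F = (E ⊗ F)^k the matrix (A_ij ⊗ 1) is `matOp A` ⊗ 1, and ‖B ⊗ 1‖ ≤ ‖B‖. Complete
contractivity of compressions comes from here. -/
theorem sum_norm_tensorOp_sq_le (A : Matrix (Fin k) (Fin k) (E →L[ℂ] E))
    (z : Fin k → HTensor E F) :
    ∑ i, ‖∑ j, tensorOp (A i j) (1 : F →L[ℂ] F) (z j)‖ ^ 2 ≤ ‖matOp A‖ ^ 2 * ∑ j, ‖z j‖ ^ 2 := by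
  set w := ∑ j, tensorMap (injPi E j) (1 : F →L[ℂ] F) (z j) with hw
  have h1 : ∀ i, tensorMap (projPi E i) (1 : F →L[ℂ] F) w = z i := by
    intro i
    rw [hw, map_sum, Finset.sum_eq_single i]
    · rw [← ContinuousLinearMap.comp_apply, tensorMap_comp]
      have : tensorMap (projPi E i ∘L injPi E i) ((1 : F →L[ℂ] F) ∘L (1 : F →L[ℂ] F)) =
          ContinuousLinearMap.id ℂ (HTensor E F) := ext_ten fun φ x => by
        simp only [tensorMap_ten, ContinuousLinearMap.comp_apply, projPi_apply, injPi_apply,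
          if_true]
        rfl
      rw [this]; rfl
    · intro j _ hj
      rw [← ContinuousLinearMap.comp_apply, tensorMap_comp]
      have : tensorMap (projPi E i ∘L injPi E j) ((1 : F →L[ℂ] F) ∘L (1 : F →L[ℂ] F)) = 0 :=
        ext_ten fun φ x => by simp [tensorMap_ten, projPi_apply, injPi_apply, hj.symm]
      rw [this]; rfl
    · simp
  have h2 : ∀ i, tensorMap (projPi E i) (1 : F →L[ℂ] F) (tensorMap (matOp A) (1 : F →L[ℂ] F) w) =
      ∑ j, tensorOp (A i j) (1 : F →L[ℂ] F) (z j) := by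
    intro i
    rw [hw, map_sum, map_sum]
    refine Finset.sum_congr rfl fun j _ => ?_
    rw [← ContinuousLinearMap.comp_apply, ← ContinuousLinearMap.comp_apply, tensorMap_comp,
      tensorMap_comp, tensorOp_eq_tensorMap]
    congr 2
    ext x
    simp only [ContinuousLinearMap.comp_apply, projPi_apply, matOp_apply, injPi_apply]
    rw [Finset.sum_eq_single j (fun l _ hl => by simp [hl]) (by simp), if_pos rfl]
  simp only [← h2, ← norm_sq_eq_sum_projPi]
  rw [← Finset.sum_congr rfl fun j _ => congrArg (fun y => ‖y‖ ^ 2) (h1 j),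
    ← norm_sq_eq_sum_projPi, ← mul_pow]
  refine pow_le_pow_left₀ (norm_nonneg _) ((norm_tensorMap_apply_le _ _ _).trans ?_) 2
  refine mul_le_mul_of_nonneg_right ?_ (norm_nonneg _)
  exact mul_le_of_le_one_right (norm_nonneg _) ContinuousLinearMap.norm_id_le

end Matrices

/-! ### Operator topologies -/

section Topologies

theorem tendsto_sot_iff {E : Type*} [NormedAddCommGroup E] [NormedSpace ℂ E] {ι : Type*}
    {G : ι → E →L[ℂ] E} {l : Filter ι} {A : E →L[ℂ] E} :
    Tendsto G l (@nhds _ (sot E) A) ↔ ∀ x, Tendsto (fun i => G i x) l (𝓝 (A x)) := by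
  rw [nhds_induced, tendsto_comap_iff, PointwiseConvergenceCLM.tendsto_iff_forall_tendsto]
  rfl

theorem tendsto_wot_iff {E : Type*} [NormedAddCommGroup E] [InnerProductSpace ℂ E]
    [CompleteSpace E] {ι : Type*} {G : ι → E →L[ℂ] E} {l : Filter ι} {A : E →L[ℂ] E} :
    Tendsto G l (@nhds _ (wot E) A) ↔
      ∀ x y, Tendsto (fun i => inner ℂ y (G i x)) l (𝓝 (inner ℂ y (A x))) := by
  rw [nhds_induced, tendsto_comap_iff,
    ContinuousLinearMapWOT.tendsto_iff_forall_dual_apply_tendsto]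
  refine ⟨fun h x y => h x (innerSL ℂ y), fun h x f => ?_⟩
  have := h x ((InnerProductSpace.toDual ℂ E).symm f)
  simpa using this

theorem t2Space_wot (E : Type*) [NormedAddCommGroup E] [InnerProductSpace ℂ E]
    [CompleteSpace E] : @T2Space _ (wot E) :=
  @T2Space.of_injective_continuous _ _ (wot E) _ _ _ ContinuousLinearMapWOT.ofCLM_injective
    continuous_induced_dom

theorem t2Space_sot (E : Type*) [NormedAddCommGroup E] [InnerProductSpace ℂ E] :
    @T2Space _ (sot E) :=
  @T2Space.of_injective_continuous _ _ (sot E) _ _ _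
    (fun _ _ h => ContinuousLinearMap.ext fun x =>
      congrArg (fun L : E →Lₚₜ[ℂ] E => L x) h)
    continuous_induced_dom

theorem wotSum_eq {E : Type*} [NormedAddCommGroup E] [InnerProductSpace ℂ E]
    [CompleteSpace E] {ι : Type*} {F : ι → E →L[ℂ] E} {S : E →L[ℂ] E}
    (h : ∀ x y, HasSum (fun i => inner ℂ y (F i x)) (inner ℂ y (S x))) : wotSum F = S := by
  refine @HasSum.tsum_eq _ _ _ (wot E) _ _ _ (t2Space_wot E) inferInstance ?_
  refine tendsto_wot_iff.2 fun x y => ?_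
  simpa [HasSum, sum_apply, inner_sum] using h x y

theorem hasSum_sot {E : Type*} [NormedAddCommGroup E] [InnerProductSpace ℂ E]
    {ι : Type*} {F : ι → E →L[ℂ] E} {S : E →L[ℂ] E}
    (h : ∀ x, HasSum (fun i => F i x) (S x)) :
    @HasSum _ _ _ (sot E) F S (.unconditional ι) := by
  refine tendsto_sot_iff.2 fun x => ?_
  simpa [HasSum, sum_apply] using h x

theorem sotSum_eq {E : Type*} [NormedAddCommGroup E] [InnerProductSpace ℂ E]
    {ι : Type*} {F : ι → E →L[ℂ] E} {S : E →L[ℂ] E}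
    (h : ∀ x, HasSum (fun i => F i x) (S x)) : sotSum F = S :=
  @HasSum.tsum_eq _ _ _ (sot E) _ _ _ (t2Space_sot E) inferInstance (hasSum_sot h)

end Topologies

/-! ### Rows of operators -/

section Rows

variable {K L : Type*} [NormedAddCommGroup K] [InnerProductSpace ℂ K] [CompleteSpace K]
  [NormedAddCommGroup L] [InnerProductSpace ℂ L] [CompleteSpace L] {ι : Type*}

/-- The row with entries `A_i` has norm at most `√D`. -/
def IsRow (A : ι → L →L[ℂ] K) (D : ℝ) : Prop :=
  ∀ y, ∑' i, ENNReal.ofReal (‖ContinuousLinearMap.adjoint (A i) y‖ ^ 2) ≤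
    ENNReal.ofReal (D * ‖y‖ ^ 2)

theorem IsRow.sum_le {A : ι → L →L[ℂ] K} {D : ℝ} (hA : IsRow A D) (hD : 0 ≤ D) (s : Finset ι)
    (y : K) : ∑ i ∈ s, ‖ContinuousLinearMap.adjoint (A i) y‖ ^ 2 ≤ D * ‖y‖ ^ 2 := by
  have h := (ENNReal.sum_le_tsum s).trans (hA y)
  rw [← ENNReal.ofReal_sum_of_nonneg (fun _ _ => by positivity)] at h
  exact (ENNReal.ofReal_le_ofReal_iff (by positivity)).1 h

/-- Pair `w = ∑ A_i v_i` with itself, move each `A_i` across and apply Cauchy–Schwarz; a factor ‖w‖²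
cancels. -/
theorem IsRow.norm_sum_sq_le {A : ι → L →L[ℂ] K} {D : ℝ} (hA : IsRow A D) (hD : 0 ≤ D)
    (s : Finset ι) (v : ι → L) :
    ‖∑ i ∈ s, A i (v i)‖ ^ 2 ≤ D * ∑ i ∈ s, ‖v i‖ ^ 2 := by
  set w := ∑ i ∈ s, A i (v i) with hw
  have h1 : ‖w‖ ^ 2 ≤ ∑ i ∈ s, ‖ContinuousLinearMap.adjoint (A i) w‖ * ‖v i‖ := by
    have : ((‖w‖ ^ 2 : ℝ) : ℂ) = ∑ i ∈ s, inner ℂ (ContinuousLinearMap.adjoint (A i) w) (v i) := by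
      have := inner_self_eq_norm_sq_to_K (𝕜 := ℂ) w
      rw [Complex.ofReal_pow]
      refine this.symm.trans ?_
      conv_lhs => rw [hw, inner_sum]
      simp only [ContinuousLinearMap.adjoint_inner_left, hw]
    have h2 := congrArg norm this
    rw [Complex.norm_real, Real.norm_of_nonneg (by positivity)] at h2
    rw [h2]
    exact (norm_sum_le _ _).trans (Finset.sum_le_sum fun i _ => norm_inner_le_norm _ _)
  have h2 := Finset.sum_mul_sq_le_sq_mul_sq s (fun i => ‖ContinuousLinearMap.adjoint (A i) w‖)
    (fun i => ‖v i‖)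
  have h3 := hA.sum_le hD s w
  have h4 : 0 ≤ ∑ i ∈ s, ‖v i‖ ^ 2 := Finset.sum_nonneg fun _ _ => by positivity
  have h5 : (‖w‖ ^ 2) ^ 2 ≤ (D * ‖w‖ ^ 2) * ∑ i ∈ s, ‖v i‖ ^ 2 :=
    (pow_le_pow_left₀ (by positivity) h1 2).trans (h2.trans (mul_le_mul_of_nonneg_right h3 h4))
  rcases (norm_nonneg w).eq_or_lt with h | h
  · rw [← h]
    simp only [ne_eq, OfNat.ofNat_ne_zero, not_false_eq_true, zero_pow]
    positivity
  · have h6 : 0 < ‖w‖ ^ 2 := by positivity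
    refine le_of_mul_le_mul_left ?_ h6
    nlinarith

theorem summable_of_norm_sum_sq_le {E : Type*} [NormedAddCommGroup E] [CompleteSpace E]
    {f : ι → E} {t : ι → ℝ} {D : ℝ} (hD : 0 ≤ D) (ht : Summable t)
    (h : ∀ s : Finset ι, ‖∑ i ∈ s, f i‖ ^ 2 ≤ D * ∑ i ∈ s, t i) : Summable f := by
  rw [summable_iff_vanishing_norm]
  intro ε hε
  -- `D + 1` because `D` may be 0.
  have hε' : 0 < ε ^ 2 / (D + 1) := by positivity
  obtain ⟨s, hs⟩ := summable_iff_vanishing_norm.1 ht _ hε'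
  refine ⟨s, fun u hu => ?_⟩
  refine lt_of_pow_lt_pow_left₀ 2 hε.le ((h u).trans_lt ?_)
  have h1 := (le_abs_self _).trans_lt (hs u hu)
  rw [lt_div_iff₀ (by positivity)] at h1
  have h2 : 0 ≤ D * ∑ i ∈ u, t i := (by positivity : (0:ℝ) ≤ _).trans (h u)
  by_cases h3 : 0 ≤ ∑ i ∈ u, t i
  · nlinarith
  · nlinarith

theorem IsRow.summable {A : ι → L →L[ℂ] K} {D : ℝ} (hA : IsRow A D) (hD : 0 ≤ D)
    {v : ι → L} (hv : Summable fun i => ‖v i‖ ^ 2) : Summable fun i => A i (v i) :=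
  summable_of_norm_sum_sq_le hD hv fun s => hA.norm_sum_sq_le hD s v

theorem IsRow.norm_tsum_sq_le {A : ι → L →L[ℂ] K} {D : ℝ} (hA : IsRow A D) (hD : 0 ≤ D)
    {v : ι → L} (hv : Summable fun i => ‖v i‖ ^ 2) :
    ‖∑' i, A i (v i)‖ ^ 2 ≤ D * ∑' i, ‖v i‖ ^ 2 :=
  le_of_tendsto_of_tendsto ((hA.summable hD hv).hasSum.norm.pow 2) (hv.hasSum.const_mul D)
    (Eventually.of_forall fun s => hA.norm_sum_sq_le hD s v)

/-- The operator `∑ A_i B_i` for a bounded row `A` and a bounded column `B`. -/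
theorem IsRow.exists_sum_comp {A : ι → L →L[ℂ] K} {D : ℝ} (hA : IsRow A D) (hD : 0 ≤ D)
    {B : ι → K →L[ℂ] L} {C : ℝ} (hC : 0 ≤ C)
    (hB : ∀ y, ∑' i, ENNReal.ofReal (‖B i y‖ ^ 2) ≤ ENNReal.ofReal (C * ‖y‖ ^ 2)) :
    ∃ S : K →L[ℂ] K, (∀ y, HasSum (fun i => A i (B i y)) (S y)) ∧ ‖S‖ ^ 2 ≤ D * C := by
  have hs : ∀ y, Summable fun i => ‖B i y‖ ^ 2 := fun y =>
    summable_of_tsum_ofReal_le (fun _ => by positivity) (hB y)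
  have hB' : ∀ y, ∑' i, ‖B i y‖ ^ 2 ≤ C * ‖y‖ ^ 2 := fun y => by
    have h := hB y
    rw [← ENNReal.ofReal_tsum_of_nonneg (fun _ => by positivity) (hs y)] at h
    exact (ENNReal.ofReal_le_ofReal_iff (by positivity)).1 h
  have hS : ∀ y, HasSum (fun i => A i (B i y)) (∑' i, A i (B i y)) := fun y =>
    (hA.summable hD (hs y)).hasSum
  have hb : ∀ y, ‖∑' i, A i (B i y)‖ ≤ √(D * C) * ‖y‖ := fun y => by
    refine abs_le_of_sq_le_sq' ?_ (by positivity) |>.2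
    rw [mul_pow, Real.sq_sqrt (by positivity), mul_assoc]
    exact (hA.norm_tsum_sq_le hD (hs y)).trans (mul_le_mul_of_nonneg_left (hB' y) hD)
  refine ⟨LinearMap.mkContinuous
    { toFun := fun y => ∑' i, A i (B i y)
      map_add' := fun y z => by
        refine HasSum.tsum_eq ?_
        simpa only [map_add] using (hS y).add (hS z)
      map_smul' := fun c y => by
        refine HasSum.tsum_eq ?_
        simpa only [map_smul, RingHom.id_apply] using (hS y).const_smul c } (√(D * C)) hb, hS, ?_⟩
  refine (pow_le_pow_left₀ (norm_nonneg _)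
    (LinearMap.mkContinuous_norm_le _ (Real.sqrt_nonneg (D * C)) _) 2).trans (le_of_eq (Real.sq_sqrt (by positivity)))

end Rows

/-! ### The positive map `Φ_{f,X}` -/

section Phi

variable {n : ℕ} {H : Type*} [NormedAddCommGroup H] [InnerProductSpace ℂ H]

theorem mon_scale (r : ℝ) (X : Fin n → H →L[ℂ] H) (α : Word n) :
    mon (scale r X) α = ((r : ℂ) ^ α.length) • mon X α := by
  induction α using FreeMonoid.inductionOn' with
  | one => simp [mon_one]
  | of_mul i α ih =>
    rw [mon_mul, mon_mul, mon_of, mon_of, ih, FreeMonoid.length_mul, FreeMonoid.length_of,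
      pow_add, pow_one, scale, smul_mul_smul_comm]

theorem smul_mon_scale (c : ℂ) (r : ℝ) (X : Fin n → H →L[ℂ] H) (α : Word n) :
    (c * (r : ℂ) ^ α.length) • mon X α = c • mon (scale r X) α := by
  rw [mon_scale, smul_smul]

/-- The quadratic form of an operator. -/
def quad (Y : H →L[ℂ] H) (x : H) : ℝ := (inner ℂ x (Y x)).re

theorem quad_one (x : H) : quad (1 : H →L[ℂ] H) x = ‖x‖ ^ 2 := by
  rw [quad, one_apply_eq_self]
  exact inner_self_eq_norm_sq (𝕜 := ℂ) x

theorem quad_sub (Y Z : H →L[ℂ] H) (x : H) : quad (Y - Z) x = quad Y x - quad Z x := by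
  rw [quad, sub_apply, inner_sub_right, Complex.sub_re]
  rfl

theorem quad_nonneg {Y : H →L[ℂ] H} (hY : Y.IsPositive) (x : H) : 0 ≤ quad Y x :=
  hY.re_inner_nonneg_right x

theorem inner_eq_quad {Y : H →L[ℂ] H} (hY : Y.IsPositive) (x : H) :
    inner ℂ x (Y x) = (quad Y x : ℂ) := by
  have h := (ContinuousLinearMap.isPositive_iff_complex Y).1 hY x
  rw [hY.inner_left_eq_inner_right] at h
  exact h.1.symm

variable [CompleteSpace H] {a : Word n → ℝ} {X : Fin n → H →L[ℂ] H} {q : ℝ}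

/-- `Φ_{f,X}(I) ≤ q I`, expressed by quadratic forms. -/
def PhiLe (a : Word n → ℝ) (X : Fin n → H →L[ℂ] H) (q : ℝ) : Prop :=
  ∀ x, ∑' α, ENNReal.ofReal (a α * ‖ContinuousLinearMap.adjoint (mon X α) x‖ ^ 2) ≤
    ENNReal.ofReal (q * ‖x‖ ^ 2)

theorem adjoint_mon_mul (X : Fin n → H →L[ℂ] H) (α β : Word n) (x : H) :
    ContinuousLinearMap.adjoint (mon X (α * β)) x =
      ContinuousLinearMap.adjoint (mon X β) (ContinuousLinearMap.adjoint (mon X α) x) := by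
  refine ext_inner_right ℂ fun y => ?_
  simp only [ContinuousLinearMap.adjoint_inner_left, mon_mul, mul_apply_eq_comp]

theorem adjoint_mon_one (X : Fin n → H →L[ℂ] H) (x : H) :
    ContinuousLinearMap.adjoint (mon X 1) x = x := by
  refine ext_inner_right ℂ fun y => ?_
  rw [ContinuousLinearMap.adjoint_inner_left, mon_one, one_apply_eq_self]

theorem norm_adjoint_mon_scale (r : ℝ) (X : Fin n → H →L[ℂ] H) (α : Word n) (x : H) :
    ‖ContinuousLinearMap.adjoint (mon (scale r X) α) x‖ ^ 2 =
      (r ^ 2) ^ α.length * ‖ContinuousLinearMap.adjoint (mon X α) x‖ ^ 2 := by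
  rw [mon_scale, map_smulₛₗ, smul_apply, norm_smul]
  simp only [map_pow, Complex.conj_ofReal, norm_pow, Complex.norm_real, Real.norm_eq_abs]
  rw [mul_pow, ← pow_mul, mul_comm _ 2, pow_mul, sq_abs]

/-- Since `a 1 = 0`, only words of length at least one contribute, and each gains a factor at most
`r²`. For `r < 1` this is the strict bound behind everything done at `rT`. -/
theorem PhiLe.phiLe_scale (ha : RegularCoeff a) (hX : PhiLe a X 1) {r : ℝ} (h0 : 0 ≤ r) (h1 : r ≤ 1) :
    PhiLe a (scale r X) (r ^ 2) := by
  intro x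
  have h2 : r ^ 2 ≤ 1 := pow_le_one₀ h0 h1
  calc _ ≤ ∑' α, ENNReal.ofReal (r ^ 2) *
        ENNReal.ofReal (a α * ‖ContinuousLinearMap.adjoint (mon X α) x‖ ^ 2) := by
        refine ENNReal.tsum_le_tsum fun α => ?_
        rw [← ENNReal.ofReal_mul (by positivity)]
        refine ENNReal.ofReal_le_ofReal ?_
        by_cases hα : α = 1
        · simp [hα, ha.map_one]
        rw [norm_adjoint_mon_scale, mul_left_comm]
        refine mul_le_mul_of_nonneg_right ?_ (mul_nonneg (ha.nonneg α) (by positivity))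
        exact pow_le_of_le_one (by positivity) h2 (fun h => hα (FreeMonoid.length_eq_zero.1 h))
    _ ≤ _ := by
        rw [ENNReal.tsum_mul_left, ENNReal.ofReal_mul (by positivity)]
        gcongr
        simpa using hX x

theorem PhiLe.isRow (ha : RegularCoeff a) (hX : PhiLe a X q) :
    IsRow (fun α => ((√(a α) : ℝ) : ℂ) • mon X α) q := by
  intro y
  refine le_of_eq_of_le (tsum_congr fun α => ?_) (hX y)
  rw [map_smulₛₗ, smul_apply, norm_smul, mul_pow]
  simp [Real.sq_sqrt (ha.nonneg α)]

/-- `phi` is defined by a weak sum; as the product of the bounded row `√a_α X_α` and the bounded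
column `√a_α Y X_α*` it converges strongly. -/
theorem PhiLe.hasSum_phi (ha : RegularCoeff a) (hX : PhiLe a X q) (hq : 0 ≤ q) (Y : H →L[ℂ] H)
    (x : H) : HasSum (fun α => phiTerm a X Y α x) (phi a X Y x) := by
  have hY : ∀ y, ∑' α, ENNReal.ofReal (‖(((√(a α) : ℝ) : ℂ) •
      (Y ∘L ContinuousLinearMap.adjoint (mon X α))) y‖ ^ 2) ≤
        ENNReal.ofReal ((‖Y‖ ^ 2 * q) * ‖y‖ ^ 2) := by
    intro y
    rw [mul_assoc, ENNReal.ofReal_mul (by positivity)]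
    refine le_trans ?_ (mul_le_mul_right (hX y) _)
    rw [← ENNReal.tsum_mul_left]
    refine ENNReal.tsum_le_tsum fun α => ?_
    rw [← ENNReal.ofReal_mul (by positivity)]
    refine ENNReal.ofReal_le_ofReal ?_
    rw [smul_apply, norm_smul, mul_pow, ContinuousLinearMap.comp_apply,
      Complex.norm_real, Real.norm_of_nonneg (Real.sqrt_nonneg _), Real.sq_sqrt (ha.nonneg α),
      mul_left_comm, ← mul_pow]
    exact mul_le_mul_of_nonneg_left (pow_le_pow_left₀ (norm_nonneg _) (Y.le_opNorm _) 2)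
      (ha.nonneg α)
  obtain ⟨S, hS, -⟩ := (hX.isRow ha).exists_sum_comp hq (by positivity) hY
  have hS' : ∀ y, HasSum (fun α => phiTerm a X Y α y) (S y) := by
    intro y
    refine (hS y).congr_fun fun α => ?_
    simp only [phiTerm, smul_apply, map_smul, smul_smul]
    rw [← Complex.ofReal_mul, Real.mul_self_sqrt (ha.nonneg α)]
    rfl
  have : phi a X Y = S := wotSum_eq fun y z => (hS' y).mapL (innerSL ℂ z)
  rw [this]
  exact hS' x

theorem phi_sub (ha : RegularCoeff a) (hX : PhiLe a X q) (hq : 0 ≤ q) (Y Z : H →L[ℂ] H) :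
    phi a X (Y - Z) = phi a X Y - phi a X Z := by
  ext x
  refine (hX.hasSum_phi ha hq (Y - Z) x).unique ?_
  refine ((hX.hasSum_phi ha hq Y x).sub (hX.hasSum_phi ha hq Z x)).congr_fun fun α => ?_
  simp only [phiTerm, smul_apply, mul_apply_eq_comp,
    sub_apply, map_sub, smul_sub]

theorem PhiLe.hasSum_inner_phi (ha : RegularCoeff a) (hX : PhiLe a X q) (hq : 0 ≤ q)
    (Y : H →L[ℂ] H) (x : H) :
    HasSum (fun α => (a α : ℂ) * inner ℂ (ContinuousLinearMap.adjoint (mon X α) x)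
      (Y (ContinuousLinearMap.adjoint (mon X α) x))) (inner ℂ x (phi a X Y x)) := by
  refine ((hX.hasSum_phi ha hq Y x).mapL (innerSL ℂ x)).congr_fun fun α => ?_
  rw [innerSL_apply_apply, phiTerm, smul_apply, inner_smul_right, mul_apply_eq_comp,
    mul_apply_eq_comp, ContinuousLinearMap.adjoint_inner_left]

theorem PhiLe.hasSum_quad_phi (ha : RegularCoeff a) (hX : PhiLe a X q) (hq : 0 ≤ q)
    (Y : H →L[ℂ] H) (x : H) :
    HasSum (fun α => a α * quad Y (ContinuousLinearMap.adjoint (mon X α) x))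
      (quad (phi a X Y) x) := by
  refine ((hX.hasSum_inner_phi ha hq Y x).mapL Complex.reCLM).congr_fun fun α => ?_
  rw [Complex.reCLM_apply, Complex.re_ofReal_mul]
  rfl

theorem PhiLe.isPositive_phi (ha : RegularCoeff a) (hX : PhiLe a X q) (hq : 0 ≤ q)
    {Y : H →L[ℂ] H} (hY : Y.IsPositive) : (phi a X Y).IsPositive := by
  have h1 : ∀ x, inner ℂ x (phi a X Y x) = (quad (phi a X Y) x : ℂ) := by
    intro x
    refine (hX.hasSum_inner_phi ha hq Y x).unique ?_
    refine ((hX.hasSum_quad_phi ha hq Y x).mapL Complex.ofRealCLM).congr_fun fun α => ?_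
    rw [inner_eq_quad hY, Complex.ofRealCLM_apply, Complex.ofReal_mul]
  have h2 : ∀ x, 0 ≤ quad (phi a X Y) x := fun x =>
    (hX.hasSum_quad_phi ha hq Y x).nonneg fun α => mul_nonneg (ha.nonneg α) (quad_nonneg hY _)
  rw [ContinuousLinearMap.isPositive_iff_complex]
  intro x
  rw [← inner_conj_symm, h1, Complex.conj_ofReal]
  exact ⟨by simp, by simpa using h2 x⟩

theorem PhiLe.tsum_quad_phi (ha : RegularCoeff a) (hX : PhiLe a X q) (hq : 0 ≤ q)
    {Y : H →L[ℂ] H} (hY : Y.IsPositive) (x : H) :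
    ∑' α, ENNReal.ofReal (a α * quad Y (ContinuousLinearMap.adjoint (mon X α) x)) =
      ENNReal.ofReal (quad (phi a X Y) x) := by
  have h := hX.hasSum_quad_phi ha hq Y x
  rw [← h.tsum_eq, ENNReal.ofReal_tsum_of_nonneg
    (fun α => mul_nonneg (ha.nonneg α) (quad_nonneg hY _)) h.summable]

/-! ### Weighted sums of the defects over all words. -/

theorem defect_zero (a : Word n → ℝ) (X : Fin n → H →L[ℂ] H) : defect a X 0 = 1 := rfl

theorem defect_succ (a : Word n → ℝ) (X : Fin n → H →L[ℂ] H) (p : ℕ) :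
    defect a X (p + 1) = defect a X p - phi a X (defect a X p) :=
  Function.iterate_succ_apply' _ _ _

theorem isPositive_defect {m : ℕ} (hX : X ∈ domain a m H) {p : ℕ} (hp : p ≤ m) :
    (defect a X p).IsPositive := by
  rcases p.eq_zero_or_pos with rfl | h
  · exact ContinuousLinearMap.isPositive_one
  · exact hX.2 p h hp

/-- The quadratic form of the weak sum is ∑ a_α ‖X_α* x‖², and positivity of the first defect I -
Φ(I), available since `1 ≤ m`, bounds it. -/
theorem phiLe_of_mem_domain (ha : RegularCoeff a) {m : ℕ} (hm : 1 ≤ m) (hX : X ∈ domain a m H) :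
    PhiLe a X 1 := by
  intro x
  obtain ⟨S, hS⟩ := hX.1
  have h1 : ∀ y z, HasSum (fun α => inner ℂ z (phiTerm a X 1 α y)) (inner ℂ z (S y)) := by
    intro y z
    have := tendsto_wot_iff.1 hS y z
    simpa only [HasSum, sum_apply, inner_sum] using this
  have h2 : phi a X 1 = S := wotSum_eq h1
  have h3 : HasSum (fun α => a α * ‖ContinuousLinearMap.adjoint (mon X α) x‖ ^ 2)
      (quad (phi a X 1) x) := by
    rw [h2]
    refine ((h1 x x).mapL Complex.reCLM).congr_fun fun α => ?_
    rw [phiTerm, smul_apply, inner_smul_right, mul_apply_eq_comp, mul_one,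
      ← ContinuousLinearMap.adjoint_inner_left, Complex.reCLM_apply, Complex.re_ofReal_mul]
    congr 1
    exact (inner_self_eq_norm_sq (𝕜 := ℂ) _).symm
  rw [← ENNReal.ofReal_tsum_of_nonneg (fun α => mul_nonneg (ha.nonneg α) (by positivity))
    h3.summable, h3.tsum_eq]
  refine ENNReal.ofReal_le_ofReal ?_
  have h4 := quad_nonneg (hX.2 1 le_rfl hm) x
  rw [defect_succ, defect_zero, quad_sub, quad_one] at h4
  linarith

/-- This is Δ_{p+1} + Φ(Δ_p) = Δ_p, compressed by all X_α* x and summed with weights `u`. Written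
without subtraction, it remains valid when the sums are infinite. -/
theorem PhiLe.tsum_quad_defect_succ (ha : RegularCoeff a) (hX : PhiLe a X q) (hq : 0 ≤ q) {p : ℕ}
    (h0 : (defect a X p).IsPositive) (h1 : (defect a X (p + 1)).IsPositive) {u : Word n → ℝ}
    (hu : ∀ α, 0 ≤ u α) (x : H) :
    ∑' α, ENNReal.ofReal (u α * quad (defect a X (p + 1))
        (ContinuousLinearMap.adjoint (mon X α) x)) +
      ∑' α, ENNReal.ofReal (conv u a α * quad (defect a X p)
        (ContinuousLinearMap.adjoint (mon X α) x)) =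
      ∑' α, ENNReal.ofReal (u α * quad (defect a X p)
        (ContinuousLinearMap.adjoint (mon X α) x)) := by
  rw [← tsum_tsum_mul_eq_tsum_conv hu ha.nonneg (fun α => quad_nonneg h0 _), ← ENNReal.tsum_add]
  refine tsum_congr fun α => ?_
  have h2 : ∑' β, ENNReal.ofReal (u α * a β * quad (defect a X p)
      (ContinuousLinearMap.adjoint (mon X (α * β)) x)) =
      ENNReal.ofReal (u α * quad (phi a X (defect a X p))
        (ContinuousLinearMap.adjoint (mon X α) x)) := by
    rw [ENNReal.ofReal_mul (hu α), ← hX.tsum_quad_phi ha hq h0, ← ENNReal.tsum_mul_left]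
    refine tsum_congr fun β => ?_
    rw [← ENNReal.ofReal_mul (hu α), mul_assoc, adjoint_mon_mul]
  rw [h2, ← ENNReal.ofReal_add (mul_nonneg (hu α) (quad_nonneg h1 _))
    (mul_nonneg (hu α) (quad_nonneg (hX.isPositive_phi ha hq h0) _)), ← mul_add, defect_succ,
    quad_sub, sub_add_cancel]

/-- A family of coefficients truncated at length `N`. -/
def trunc (u : Word n → ℝ) (N : ℕ) (α : Word n) : ℝ := if α.length ≤ N then u α else 0

theorem trunc_nonneg {u : Word n → ℝ} (hu : ∀ α, 0 ≤ u α) (N : ℕ) (α : Word n) :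
    0 ≤ trunc u N α := by
  rw [trunc]; split_ifs
  exacts [hu α, le_rfl]

/-- Prefixes of a word of length at most `N` are not truncated, so there the recursion is exact; on
longer words the left side is 0. Truncation makes the sums finite, so that terms can be cancelled.
-/
theorem trunc_powCoeff_le (ha : RegularCoeff a) (p N : ℕ) (α : Word n) :
    trunc (powCoeff a (p + 1)) N α ≤ powCoeff a p α + conv (trunc (powCoeff a (p + 1)) N) a α := by
  by_cases h : α.length ≤ N
  · rw [trunc, if_pos h, powCoeff_succ ha.map_one]
    refine le_of_eq (congrArg _ (Finset.sum_congr rfl fun i _ => ?_))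
    rw [trunc, if_pos]
    simp only [FreeMonoid.length, FreeMonoid.toList_ofList, List.length_take] at *
    omega
  · rw [trunc, if_neg h]
    exact add_nonneg (powCoeff_nonneg ha.nonneg p α)
      (conv_nonneg (trunc_nonneg (powCoeff_nonneg ha.nonneg _) N) ha.nonneg α)

theorem tsum_trunc_ne_top (u F : Word n → ℝ) (N : ℕ) :
    ∑' α, ENNReal.ofReal (trunc u N α * F α) ≠ ⊤ := by
  have hfin : {α : Word n | α.length ≤ N}.Finite := List.finite_length_le (Fin n) N
  rw [tsum_eq_sum (s := hfin.toFinset)]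
  · exact ENNReal.sum_ne_top.2 fun _ _ => ENNReal.ofReal_ne_top
  · intro α hα
    rw [Set.Finite.mem_toFinset, Set.mem_ofPred_eq] at hα
    rw [trunc, if_neg hα, zero_mul, ENNReal.ofReal_zero]

theorem tsum_le_of_trunc_le {u F : Word n → ℝ} {C : ENNReal}
    (h : ∀ N, ∑' α, ENNReal.ofReal (trunc u N α * F α) ≤ C) :
    ∑' α, ENNReal.ofReal (u α * F α) ≤ C := by
  rw [ENNReal.tsum_eq_iSup_sum]
  refine iSup_le fun s => ?_
  refine le_trans ?_ ((ENNReal.sum_le_tsum s).trans (h (s.sup FreeMonoid.length)))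
  refine Finset.sum_le_sum fun α hα => ?_
  rw [trunc, if_pos (Finset.le_sup (f := FreeMonoid.length) hα)]

theorem tsum_powCoeff_zero (F : Word n → ℝ) :
    ∑' α, ENNReal.ofReal (powCoeff a 0 α * F α) = ENNReal.ofReal (F 1) := by
  rw [tsum_eq_single 1]
  · rw [powCoeff_one, one_mul]
  · intro α hα
    rw [powCoeff_zero a hα, zero_mul, ENNReal.ofReal_zero]

/-- `∑ b_α X_α (id - Φ)^p(I) X_α* ≤ I`. -/
theorem tsum_powCoeff_quad_defect_le (ha : RegularCoeff a) {m : ℕ} (hm : 1 ≤ m)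
    (hX : X ∈ domain a m H) {p : ℕ} (hp : p ≤ m) (x : H) :
    ∑' α, ENNReal.ofReal (powCoeff a p α * quad (defect a X p)
      (ContinuousLinearMap.adjoint (mon X α) x)) ≤ ENNReal.ofReal (‖x‖ ^ 2) := by
  induction p with
  | zero => rw [tsum_powCoeff_zero, adjoint_mon_one, defect_zero, quad_one]
  | succ p ih =>
    -- The recursion for the coefficients and the one for the defects share the sum weighted by
    -- `conv`. Truncation makes it finite, and it cancels.
    refine tsum_le_of_trunc_le fun N => le_trans ?_ (ih (by omega))
    have h0 := isPositive_defect hX (p := p) (by omega)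
    have h1 := (phiLe_of_mem_domain ha hm hX).tsum_quad_defect_succ ha zero_le_one h0
      (isPositive_defect hX hp) (trunc_nonneg (powCoeff_nonneg ha.nonneg (p + 1)) N) x
    have h2 : ∑' α, ENNReal.ofReal (trunc (powCoeff a (p + 1)) N α * quad (defect a X p)
        (ContinuousLinearMap.adjoint (mon X α) x)) ≤
        ∑' α, ENNReal.ofReal (powCoeff a p α * quad (defect a X p)
          (ContinuousLinearMap.adjoint (mon X α) x)) +
        ∑' α, ENNReal.ofReal (conv (trunc (powCoeff a (p + 1)) N) a α * quad (defect a X p)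
          (ContinuousLinearMap.adjoint (mon X α) x)) := by
      rw [← ENNReal.tsum_add]
      refine ENNReal.tsum_le_tsum fun α => ?_
      refine le_trans (ENNReal.ofReal_le_ofReal ?_) ENNReal.ofReal_add_le
      rw [← add_mul]
      exact mul_le_mul_of_nonneg_right (trunc_powCoeff_le ha p N α) (quad_nonneg h0 _)
    have h3 : ∑' α, ENNReal.ofReal (conv (trunc (powCoeff a (p + 1)) N) a α *
        quad (defect a X p) (ContinuousLinearMap.adjoint (mon X α) x)) ≠ ⊤ :=
      ne_top_of_le_ne_top (tsum_trunc_ne_top (powCoeff a (p + 1)) _ N)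
        (le_add_self.trans h1.le)
    rw [← h1] at h2
    exact (ENNReal.add_le_add_iff_right h3).1 h2

/-- `∑ b_α X_α X_α* ≤ (1 - q)^{-p} I` if `Φ(I) ≤ q I`. -/
theorem PhiLe.tsum_powCoeff_norm_le (ha : RegularCoeff a) (hX : PhiLe a X q) (hq : 0 ≤ q)
    (hq1 : q < 1) (p : ℕ) (x : H) :
    ∑' α, ENNReal.ofReal (powCoeff a p α * ‖ContinuousLinearMap.adjoint (mon X α) x‖ ^ 2) ≤
      ENNReal.ofReal (((1 - q) ^ p)⁻¹ * ‖x‖ ^ 2) := by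
  have hq' : 0 < 1 - q := by linarith
  induction p with
  | zero => rw [tsum_powCoeff_zero, adjoint_mon_one]; simp
  | succ p ih =>
    refine tsum_le_of_trunc_le fun N => ?_
    have hu := trunc_nonneg (powCoeff_nonneg ha.nonneg (p + 1)) N
    -- With `t` the truncated sum, `h1` and `h2` lead to t ≤ (1 - q)^{-p} ‖x‖² + q t; since `t` is
    -- finite this can be solved for `t`.
    have h1 : ∑' α, ENNReal.ofReal (conv (trunc (powCoeff a (p + 1)) N) a α *
        ‖ContinuousLinearMap.adjoint (mon X α) x‖ ^ 2) ≤ ENNReal.ofReal q *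
        ∑' α, ENNReal.ofReal (trunc (powCoeff a (p + 1)) N α *
          ‖ContinuousLinearMap.adjoint (mon X α) x‖ ^ 2) := by
      rw [← tsum_tsum_mul_eq_tsum_conv hu ha.nonneg (fun α => by positivity),
        ← ENNReal.tsum_mul_left]
      refine ENNReal.tsum_le_tsum fun α => ?_
      rw [← ENNReal.ofReal_mul hq, mul_left_comm, ENNReal.ofReal_mul (hu α)]
      refine le_trans (le_of_eq ?_) (mul_le_mul_right (hX _) _)
      rw [← ENNReal.tsum_mul_left]
      refine tsum_congr fun β => ?_
      rw [← ENNReal.ofReal_mul (hu α), mul_assoc, adjoint_mon_mul]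
    have h2 : ∑' α, ENNReal.ofReal (trunc (powCoeff a (p + 1)) N α *
        ‖ContinuousLinearMap.adjoint (mon X α) x‖ ^ 2) ≤
        ∑' α, ENNReal.ofReal (powCoeff a p α *
          ‖ContinuousLinearMap.adjoint (mon X α) x‖ ^ 2) +
        ∑' α, ENNReal.ofReal (conv (trunc (powCoeff a (p + 1)) N) a α *
          ‖ContinuousLinearMap.adjoint (mon X α) x‖ ^ 2) := by
      rw [← ENNReal.tsum_add]
      refine ENNReal.tsum_le_tsum fun α => ?_
      refine le_trans (ENNReal.ofReal_le_ofReal ?_) ENNReal.ofReal_add_le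
      rw [← add_mul]
      exact mul_le_mul_of_nonneg_right (trunc_powCoeff_le ha p N α) (by positivity)
    have h3 := h2.trans (add_le_add ih h1)
    rw [← ENNReal.ofReal_toReal (tsum_trunc_ne_top (powCoeff a (p + 1)) _ N),
      ← ENNReal.ofReal_mul hq, ← ENNReal.ofReal_add (by positivity) (by positivity),
      ENNReal.ofReal_le_ofReal_iff (by positivity)] at h3
    rw [← ENNReal.ofReal_toReal (tsum_trunc_ne_top (powCoeff a (p + 1)) _ N)]
    refine ENNReal.ofReal_le_ofReal ?_
    set t := (∑' α, ENNReal.ofReal (trunc (powCoeff a (p + 1)) N α *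
        ‖ContinuousLinearMap.adjoint (mon X α) x‖ ^ 2)).toReal
    rw [pow_succ, mul_inv, mul_right_comm, ← div_eq_mul_inv, le_div_iff₀ hq']
    linarith

theorem quad_defect_le (ha : RegularCoeff a) (hX : PhiLe a X q) (hq : 0 ≤ q) {p : ℕ}
    (h : ∀ k ≤ p, (defect a X k).IsPositive) (x : H) : quad (defect a X p) x ≤ ‖x‖ ^ 2 := by
  induction p with
  | zero => rw [defect_zero, quad_one]
  | succ p ih =>
    rw [defect_succ, quad_sub]
    have h1 := quad_nonneg (hX.isPositive_phi ha hq (h p (by omega))) x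
    have h2 := ih fun k hk => h k (by omega)
    linarith

/-- `∑ b_α X_α (id - Φ)^p(I) X_α* = I` if `Φ(I) ≤ q I` with `q < 1`. -/
theorem tsum_powCoeff_quad_defect_eq (ha : RegularCoeff a) {m : ℕ}
    (hX : X ∈ domain a m H) (hXq : PhiLe a X q) (hq : 0 ≤ q) (hq1 : q < 1) {p : ℕ} (hp : p ≤ m)
    (x : H) :
    ∑' α, ENNReal.ofReal (powCoeff a p α * quad (defect a X p)
      (ContinuousLinearMap.adjoint (mon X α) x)) = ENNReal.ofReal (‖x‖ ^ 2) := by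
  induction p with
  | zero => rw [tsum_powCoeff_zero, adjoint_mon_one, defect_zero, quad_one]
  | succ p ih =>
    rw [← ih (by omega)]
    have h0 := isPositive_defect hX (p := p) (by omega)
    have h1 := hXq.tsum_quad_defect_succ ha hq h0
      (isPositive_defect hX hp) (powCoeff_nonneg ha.nonneg (p + 1)) x
    have hc := conv_nonneg (powCoeff_nonneg ha.nonneg (p + 1)) ha.nonneg
    have h2 : ∑' α, ENNReal.ofReal (powCoeff a (p + 1) α * quad (defect a X p)
        (ContinuousLinearMap.adjoint (mon X α) x)) =
        ∑' α, ENNReal.ofReal (powCoeff a p α * quad (defect a X p)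
          (ContinuousLinearMap.adjoint (mon X α) x)) +
        ∑' α, ENNReal.ofReal (conv (powCoeff a (p + 1)) a α * quad (defect a X p)
          (ContinuousLinearMap.adjoint (mon X α) x)) := by
      rw [← ENNReal.tsum_add]
      refine tsum_congr fun α => ?_
      rw [← ENNReal.ofReal_add (mul_nonneg (powCoeff_nonneg ha.nonneg p α) (quad_nonneg h0 _))
        (mul_nonneg (hc α) (quad_nonneg h0 _)), ← add_mul, ← powCoeff_succ ha.map_one]
    -- Here `q < 1` makes the common sum finite without truncation, so the equality survives.
    have h3 : ∑' α, ENNReal.ofReal (conv (powCoeff a (p + 1)) a α *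
        quad (defect a X p) (ContinuousLinearMap.adjoint (mon X α) x)) ≠ ⊤ := by
      refine ne_top_of_le_ne_top ENNReal.ofReal_ne_top
        (le_trans (ENNReal.tsum_le_tsum fun α => ENNReal.ofReal_le_ofReal ?_)
          (hXq.tsum_powCoeff_norm_le ha hq hq1 (p + 1) x))
      exact mul_le_mul (conv_powCoeff_le ha.nonneg ha.map_one p α)
        (quad_defect_le ha hXq hq (fun k hk => isPositive_defect hX (by omega)) _)
        (quad_nonneg h0 _) (powCoeff_nonneg ha.nonneg _ _)
    exact (ENNReal.add_left_inj h3).1 (h1.trans h2)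

/-! ### Complete non-coisometry -/

theorem isPositive_iterate_phi (ha : RegularCoeff a) (hX : PhiLe a X q) (hq : 0 ≤ q)
    {Y : H →L[ℂ] H} (hY : Y.IsPositive) (k : ℕ) : ((phi a X)^[k] Y).IsPositive := by
  induction k with
  | zero => exact hY
  | succ k ih => rw [Function.iterate_succ_apply']; exact hX.isPositive_phi ha hq ih

theorem iterate_phi_sub (ha : RegularCoeff a) (hX : PhiLe a X q) (hq : 0 ≤ q)
    (Y Z : H →L[ℂ] H) (k : ℕ) :
    (phi a X)^[k] (Y - Z) = (phi a X)^[k] Y - (phi a X)^[k] Z := by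
  induction k with
  | zero => rfl
  | succ k ih => simp only [Function.iterate_succ_apply', ih, phi_sub ha hX hq]

theorem quad_iterate_phi_eq_zero (ha : RegularCoeff a) (hX : PhiLe a X q) (hq : 0 ≤ q)
    {Y : H →L[ℂ] H} {x : H}
    (h : ∀ α, quad Y (ContinuousLinearMap.adjoint (mon X α) x) = 0) (k : ℕ) (α : Word n) :
    quad ((phi a X)^[k] Y) (ContinuousLinearMap.adjoint (mon X α) x) = 0 := by
  induction k generalizing α with
  | zero => exact h α
  | succ k ih =>
    rw [Function.iterate_succ_apply']
    refine (hX.hasSum_quad_phi ha hq _ _).unique (hasSum_zero.congr_fun fun β => ?_)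
    rw [← adjoint_mon_mul, ih, mul_zero]

/-- For completely non-coisometric `X`, the vectors killed by all `(id - Φ)^m(I) X_α*` vanish. -/
theorem eq_zero_of_quad_defect_eq_zero (ha : RegularCoeff a) {m : ℕ} (hm : 1 ≤ m)
    (hX : X ∈ domain a m H) (hcnc : IsCNC a X) {x : H}
    (h : ∀ α, quad (defect a X m) (ContinuousLinearMap.adjoint (mon X α) x) = 0) : x = 0 := by
  have hX1 := phiLe_of_mem_domain ha hm hX
  set s : ℕ → ℕ → ℝ := fun p k => quad ((phi a X)^[k] (defect a X p)) x with hs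
  have hs0 : ∀ p ≤ m, ∀ k, 0 ≤ s p k := fun p hp k =>
    quad_nonneg (isPositive_iterate_phi ha hX1 zero_le_one (isPositive_defect hX hp) k) x
  have hsucc : ∀ p k, s (p + 1) k = s p k - s p (k + 1) := by
    intro p k
    simp only [hs]
    rw [defect_succ, iterate_phi_sub ha hX1 zero_le_one, quad_sub, Function.iterate_succ_apply]
  -- Descent from `m` to 1. If `s (p + 2)` vanishes, then `s (p + 1)` is constant in `k`, so `s p`
  -- is affine with slope `-s (p + 1) 0`; nonnegativity of both forces the slope to be 0.
  have hzero : ∀ j, j < m → ∀ k, s (m - j) k = 0 := by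
    intro j
    induction j with
    | zero =>
      intro _ k
      have := quad_iterate_phi_eq_zero ha hX1 zero_le_one h k 1
      rwa [adjoint_mon_one] at this
    | succ j ih =>
      intro hj
      obtain ⟨p, hp⟩ : ∃ p, m - (j + 1) = p + 1 := ⟨m - (j + 1) - 1, by omega⟩
      have hp' : m - j = p + 2 := by omega
      rw [hp'] at ih
      rw [hp]
      have h1 : ∀ k, s (p + 1) k = s (p + 1) 0 := by
        intro k
        induction k with
        | zero => rfl
        | succ k ihk => linarith [hsucc (p + 1) k, ih (by omega) k]
      have h2 : ∀ k : ℕ, s p k = s p 0 - k * s (p + 1) 0 := by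
        intro k
        induction k with
        | zero => simp
        | succ k ihk =>
          have := hsucc p k
          rw [h1] at this
          push_cast
          linarith
      have h3 : s (p + 1) 0 = 0 := by
        refine le_antisymm ?_ (hs0 _ (by omega) _)
        by_contra hpos
        obtain ⟨k, hk⟩ := exists_nat_gt (s p 0 / s (p + 1) 0)
        rw [div_lt_iff₀ (not_le.1 hpos)] at hk
        linarith [h2 k, hs0 p (by omega) k]
      intro k
      rw [h1, h3]
  -- The vanishing of `s 1` makes `s 0` constant in `k`, which is what complete non-coisometry
  -- forbids for `x ≠ 0`.
  have hconst : ∀ k, s 0 k = ‖x‖ ^ 2 := by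
    intro k
    induction k with
    | zero => exact quad_one x
    | succ k ih =>
      have h1 := hzero (m - 1) (by omega) k
      rw [show m - (m - 1) = 0 + 1 by omega, hsucc] at h1
      linarith
  by_contra hx
  refine hcnc ⟨x, hx, fun k _ => ?_⟩
  rw [inner_eq_quad (isPositive_iterate_phi ha hX1 zero_le_one
    ContinuousLinearMap.isPositive_one k)]
  exact congrArg Complex.ofReal (hconst k)

/-- Positive operators have self-adjoint square roots. -/
theorem exists_sqrt {Y : H →L[ℂ] H} (hY : Y.IsPositive) :
    ∃ D : H →L[ℂ] H, ContinuousLinearMap.adjoint D = D ∧ D ∘L D = Y := by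
  have h0 : 0 ≤ Y := (ContinuousLinearMap.nonneg_iff_isPositive Y).2 hY
  exact ⟨CFC.sqrt Y, (CFC.sqrt_nonneg Y).isSelfAdjoint, CFC.sqrt_mul_sqrt_self Y h0⟩

theorem norm_sqrt_sq {Y D : H →L[ℂ] H} (hD : ContinuousLinearMap.adjoint D = D)
    (hD2 : D ∘L D = Y) (x : H) : ‖D x‖ ^ 2 = quad Y x := by
  rw [quad, ← hD2, ContinuousLinearMap.comp_apply]
  nth_rw 2 [← hD]
  rw [ContinuousLinearMap.adjoint_inner_right]
  exact (inner_self_eq_norm_sq (𝕜 := ℂ) _).symm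

end Phi

/-! ### Evaluation of Fourier series -/

section Evaluation

variable {n : ℕ} {H : Type*} [NormedAddCommGroup H] [InnerProductSpace ℂ H] [CompleteSpace H]
  {a : Word n → ℝ} {m : ℕ} {X : Fin n → H →L[ℂ] H} {q : ℝ} {c : Word n → ℂ}

theorem norm_real_smul_sq {E : Type*} [NormedAddCommGroup E] [NormedSpace ℂ E] {t : ℝ}
    (ht : 0 ≤ t) (x : E) : ‖((√t : ℝ) : ℂ) • x‖ ^ 2 = t * ‖x‖ ^ 2 := by
  rw [norm_smul, mul_pow, Complex.norm_real, Real.norm_of_nonneg (Real.sqrt_nonneg _),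
    Real.sq_sqrt ht]

theorem PhiLe.isRow_bCoeff (ha : RegularCoeff a) (hm : 1 ≤ m) (hX : PhiLe a X q) (hq : 0 ≤ q)
    (hq1 : q < 1) :
    IsRow (fun α => ((√(bCoeff a m α) : ℝ) : ℂ) • mon X α) ((1 - q) ^ m)⁻¹ := by
  intro y
  refine le_of_eq_of_le (tsum_congr fun α => ?_) (hX.tsum_powCoeff_norm_le ha hq hq1 m y)
  rw [map_smulₛₗ, Complex.conj_ofReal, smul_apply, norm_real_smul_sq (ha.bCoeff_pos hm α).le,
    bCoeff_eq_powCoeff a hm]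

/-- Apply the bounded row `√b_β X_β` to the vectors `(c_β / √b_β) x`. The resulting bound on finite
sums is uniform over unit vectors, so the summability is in operator norm. -/
theorem PhiLe.summable_eval (ha : RegularCoeff a) (hm : 1 ≤ m) (hX : PhiLe a X q) (hq : 0 ≤ q)
    (hq1 : q < 1) (hc : Summable fun β => ‖c β‖ ^ 2 / bCoeff a m β) :
    Summable fun β => c β • mon X β := by
  have hD : (0 : ℝ) ≤ ((1 - q) ^ m)⁻¹ := by
    have : 0 < 1 - q := by linarith
    positivity
  refine summable_of_norm_sum_sq_le hD hc fun s => ?_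
  have hs : 0 ≤ ∑ β ∈ s, ‖c β‖ ^ 2 / bCoeff a m β :=
    Finset.sum_nonneg fun β _ => div_nonneg (by positivity) (ha.bCoeff_pos hm β).le
  rw [← Real.sq_sqrt (mul_nonneg hD hs)]
  refine pow_le_pow_left₀ (norm_nonneg _) (ContinuousLinearMap.opNorm_le_bound _ (by positivity)
    fun x => ?_) 2
  refine abs_le_of_sq_le_sq' ?_ (by positivity) |>.2
  rw [mul_pow, Real.sq_sqrt (mul_nonneg hD hs)]
  have h := (hX.isRow_bCoeff ha hm hq hq1).norm_sum_sq_le hD s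
    fun β => (c β / ((√(bCoeff a m β) : ℝ) : ℂ)) • x
  have h1 : ∀ β, ((√(bCoeff a m β) : ℝ) : ℂ) ≠ 0 := fun β =>
    Complex.ofReal_ne_zero.2 (Real.sqrt_pos.2 (ha.bCoeff_pos hm β)).ne'
  have h2 : ∀ β, (((√(bCoeff a m β) : ℝ) : ℂ) • mon X β)
      ((c β / ((√(bCoeff a m β) : ℝ) : ℂ)) • x) = (c β • mon X β) x := by
    intro β
    rw [map_smul, smul_apply, smul_smul, div_mul_cancel₀ _ (h1 β), smul_apply]
  have h3 : ∀ β, ‖(c β / ((√(bCoeff a m β) : ℝ) : ℂ)) • x‖ ^ 2 =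
      ‖c β‖ ^ 2 / bCoeff a m β * ‖x‖ ^ 2 := by
    intro β
    rw [norm_smul, mul_pow, norm_div, div_pow, Complex.norm_real,
      Real.norm_of_nonneg (Real.sqrt_nonneg _), Real.sq_sqrt (ha.bCoeff_pos hm β).le]
  simp only [h2, h3] at h
  rw [← Finset.sum_mul, ← mul_assoc] at h
  rwa [sum_apply]

/-- Grouping a summable family indexed by words into homogeneous parts. -/
theorem hasSum_homSum {E : Type*} [NormedAddCommGroup E] [CompleteSpace E] {F : Word n → E} {S : E}
    (h : HasSum F S) : HasSum (fun k => homSum k F) S := by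
  have h1 : HasSum (F ∘ (List.equivSigmaTuple (α := Fin n)).symm) S :=
    (List.equivSigmaTuple (α := Fin n)).symm.hasSum_iff.2 h
  exact h1.sigma fun k => hasSum_fintype _

theorem PhiLe.hasSum_homPart (ha : RegularCoeff a) (hm : 1 ≤ m) (hX : PhiLe a X 1) {r : ℝ}
    (h0 : 0 ≤ r) (h1 : r < 1) (hc : Summable fun β => ‖c β‖ ^ 2 / bCoeff a m β) :
    HasSum (homPart c X r) (∑' β, c β • mon (scale r X) β) := by
  have h := (hX.phiLe_scale ha h0 h1.le).summable_eval ha hm (by positivity)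
    (pow_lt_one₀ h0 h1 two_ne_zero) hc
  have h2 := hasSum_homSum h.hasSum
  refine h2.congr_fun fun k => ?_
  simp only [homPart, smul_mon_scale]

theorem PhiLe.hasSum_evalRadial (ha : RegularCoeff a) (hm : 1 ≤ m) (hX : PhiLe a X 1) {r : ℝ}
    (h0 : 0 ≤ r) (h1 : r < 1) (hc : Summable fun β => ‖c β‖ ^ 2 / bCoeff a m β) :
    HasSum (fun β => c β • mon (scale r X) β) (evalRadial c X r) := by
  rw [evalRadial, (hX.hasSum_homPart ha hm h0 h1 hc).tsum_eq]
  exact ((hX.phiLe_scale ha h0 h1.le).summable_eval ha hm (by positivity)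
    (pow_lt_one₀ h0 h1 two_ne_zero) hc).hasSum

/-! ### The Berezin kernel -/

/-- `K : H → F² ⊗ H` is the operator `x ↦ ∑ √b_α e_α ⊗ D X_α* x`. -/
def IsKernel (a : Word n → ℝ) (m : ℕ) (X : Fin n → H →L[ℂ] H) (D : H →L[ℂ] H)
    (K : H →L[ℂ] HTensor (Fock n) H) : Prop :=
  ∀ x α, coord H α (K x) =
    (((√(bCoeff a m α) : ℝ) : ℂ) • (D ∘L ContinuousLinearMap.adjoint (mon X α))) x

theorem exists_kernel_of_mem_domain (ha : RegularCoeff a) (hm : 1 ≤ m) (hX : X ∈ domain a m H) :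
    ∃ D K, ContinuousLinearMap.adjoint D = D ∧ D ∘L D = defect a X m ∧ IsKernel a m X D K := by
  obtain ⟨D, hD, hD2⟩ := exists_sqrt (isPositive_defect hX le_rfl)
  have h : ∀ x, ∑' α, ENNReal.ofReal (‖(((√(bCoeff a m α) : ℝ) : ℂ) •
      (D ∘L ContinuousLinearMap.adjoint (mon X α))) x‖ ^ 2) ≤ ENNReal.ofReal (1 * ‖x‖ ^ 2) := by
    intro x
    rw [one_mul]
    refine le_of_eq_of_le (tsum_congr fun α => ?_)
      (tsum_powCoeff_quad_defect_le ha hm hX le_rfl x)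
    rw [smul_apply, norm_real_smul_sq (ha.bCoeff_pos hm α).le, ContinuousLinearMap.comp_apply,
      norm_sqrt_sq hD hD2, bCoeff_eq_powCoeff a hm]
  obtain ⟨K, hK⟩ := exists_column zero_le_one h
  exact ⟨D, K, hD, hD2, hK⟩

theorem exists_kernel_one (ha : RegularCoeff a) (hm : 1 ≤ m) (hX : PhiLe a X q) (hq : 0 ≤ q)
    (hq1 : q < 1) : ∃ L, IsKernel a m X 1 L := by
  have hD : (0 : ℝ) ≤ ((1 - q) ^ m)⁻¹ := by
    have : 0 < 1 - q := by linarith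
    positivity
  refine exists_column hD fun x => ?_
  refine le_of_eq_of_le (tsum_congr fun α => ?_) (hX.tsum_powCoeff_norm_le ha hq hq1 m x)
  rw [smul_apply, norm_real_smul_sq (ha.bCoeff_pos hm α).le, bCoeff_eq_powCoeff a hm]
  rfl

theorem IsKernel.isometry (ha : RegularCoeff a) (hm : 1 ≤ m) (hX : X ∈ domain a m H)
    (hXq : PhiLe a X q) (hq : 0 ≤ q) (hq1 : q < 1) {D : H →L[ℂ] H}
    {K : H →L[ℂ] HTensor (Fock n) H} (hD : ContinuousLinearMap.adjoint D = D)
    (hD2 : D ∘L D = defect a X m) (hK : IsKernel a m X D K) (x : H) : ‖K x‖ = ‖x‖ := by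
  have h := tsum_norm_coord_sq (K x)
  rw [← sq_eq_sq₀ (norm_nonneg _) (norm_nonneg _),
    ← ENNReal.ofReal_eq_ofReal_iff (by positivity) (by positivity), ← h,
    ← tsum_powCoeff_quad_defect_eq ha hX hXq hq hq1 le_rfl x]
  refine tsum_congr fun α => ?_
  rw [hK, smul_apply, norm_real_smul_sq (ha.bCoeff_pos hm α).le, ContinuousLinearMap.comp_apply,
      norm_sqrt_sq hD hD2, bCoeff_eq_powCoeff a hm]

theorem IsKernel.adjoint_ten {D : H →L[ℂ] H} {K : H →L[ℂ] HTensor (Fock n) H}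
    (hD : ContinuousLinearMap.adjoint D = D) (hK : IsKernel a m X D K) (α : Word n) (h : H) :
    ContinuousLinearMap.adjoint K (ten (e α) h) =
      ((√(bCoeff a m α) : ℝ) : ℂ) • mon X α (D h) := by
  rw [adjoint_ten_of_coord hK, map_smulₛₗ, Complex.conj_ofReal, smul_apply,
    ContinuousLinearMap.adjoint_comp, ContinuousLinearMap.adjoint_adjoint, hD]
  rfl

theorem RegularCoeff.wt_mul_sqrt (ha : RegularCoeff a) (hm : 1 ≤ m) (α β : Word n) :
    wt a m α β * ((√(bCoeff a m β) : ℝ) : ℂ) = ((√(bCoeff a m α) : ℝ) : ℂ) := by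
  have h : ∀ α, ((√(bCoeff a m α) : ℝ) : ℂ) = wt a m α 1 := fun α => by
    rw [wt, bCoeff_one a hm, div_one]
  rw [h, h, ha.wt_mul_wt hm]

/-- `√b_α X_β X_α D` is `√b_{βα} X_{βα} D` times the weight with which `W_β` maps `e_α` to `e_{βα}`.
General coefficients `d` also cover `c_β r^{|β|}`. -/
theorem IsKernel.hasSum_apply (ha : RegularCoeff a) (hm : 1 ≤ m) {D : H →L[ℂ] H}
    {K : H →L[ℂ] HTensor (Fock n) H} (hD : ContinuousLinearMap.adjoint D = D)
    (hK : IsKernel a m X D K) {d : Word n → ℂ} {S : H →L[ℂ] H}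
    (hS : HasSum (fun β => d β • mon X β) S) (α : Word n) (h : H) :
    HasSum (fun β => (d β * wt a m α (β * α)) •
      ContinuousLinearMap.adjoint K (ten (e (β * α)) h))
      (S (ContinuousLinearMap.adjoint K (ten (e α) h))) := by
  have h1 := hS.mapL (ContinuousLinearMap.apply ℂ H (ContinuousLinearMap.adjoint K (ten (e α) h)))
  refine h1.congr_fun fun β => ?_
  rw [ContinuousLinearMap.apply_apply, smul_apply, hK.adjoint_ten hD, hK.adjoint_ten hD, map_smul,
    smul_smul, smul_smul, mul_assoc, ha.wt_mul_sqrt hm, mon_mul]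
  rfl

/-- `g(X) K* = K* (g ⊗ I)`. -/
theorem IsKernel.intertwine (ha : RegularCoeff a) (hm : 1 ≤ m) {D : H →L[ℂ] H}
    {K : H →L[ℂ] HTensor (Fock n) H} (hD : ContinuousLinearMap.adjoint D = D)
    (hK : IsKernel a m X D K) {S : H →L[ℂ] H} {g : Fock n →L[ℂ] Fock n}
    (hg : HasFourierSeries a m g c) (hS : HasSum (fun β => c β • mon X β) S) :
    S ∘L ContinuousLinearMap.adjoint K = ContinuousLinearMap.adjoint K ∘L tensorOp g 1 := by
  refine ext_ten_e fun α x => ?_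
  refine (hK.hasSum_apply ha hm hD hS α x).unique ?_
  rw [ContinuousLinearMap.comp_apply, tensorOp_ten]
  refine ((ha.hasSum_apply_e hm hg α).mapL
    (ContinuousLinearMap.adjoint K ∘L (ten (E := Fock n) (F := H)).flip x)).congr_fun fun β => ?_
  rw [map_smul]
  rfl

/-- `g(X) = K* (g ⊗ I) K` for an isometric kernel. -/
theorem IsKernel.eval_eq (ha : RegularCoeff a) (hm : 1 ≤ m) {D : H →L[ℂ] H}
    {K : H →L[ℂ] HTensor (Fock n) H} (hD : ContinuousLinearMap.adjoint D = D)
    (hK : IsKernel a m X D K) (hiso : ∀ x, ‖K x‖ = ‖x‖) {S : H →L[ℂ] H} {g : Fock n →L[ℂ] Fock n}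
    (hg : HasFourierSeries a m g c) (hS : HasSum (fun β => c β • mon X β) S) :
    S = ContinuousLinearMap.adjoint K ∘L tensorOp g 1 ∘L K := by
  rw [← ContinuousLinearMap.comp_assoc, ← hK.intertwine ha hm hD hg hS,
    ContinuousLinearMap.comp_assoc, (ContinuousLinearMap.norm_map_iff_adjoint_comp_self K).1 hiso]
  rfl

theorem norm_adjoint_apply_le {K : H →L[ℂ] HTensor (Fock n) H} (hiso : ∀ x, ‖K x‖ = ‖x‖)
    (z : HTensor (Fock n) H) : ‖ContinuousLinearMap.adjoint K z‖ ≤ ‖z‖ := by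
  have h : ‖K‖ ≤ 1 := K.opNorm_le_bound zero_le_one fun x => by rw [hiso, one_mul]
  have h2 := (ContinuousLinearMap.adjoint K).le_opNorm z
  rw [LinearIsometryEquiv.norm_map] at h2
  exact h2.trans (mul_le_of_le_one_left (norm_nonneg _) h)

/-- Compressing an amplification by an isometry is completely contractive. -/
theorem norm_matOp_compress_le {k : ℕ} {K : H →L[ℂ] HTensor (Fock n) H}
    (hiso : ∀ x, ‖K x‖ = ‖x‖) (g : Matrix (Fin k) (Fin k) (Fock n →L[ℂ] Fock n)) :
    ‖matOp (g.map fun A => ContinuousLinearMap.adjoint K ∘L tensorOp A 1 ∘L K)‖ ≤ ‖matOp g‖ := by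
  refine norm_matOp_le (norm_nonneg _) fun x => ?_
  have h := sum_norm_tensorOp_sq_le (F := H) g fun j => K (x j)
  simp only [hiso] at h
  refine le_trans (Finset.sum_le_sum fun i _ => ?_) h
  refine pow_le_pow_left₀ (norm_nonneg _) ?_ 2
  simp only [Matrix.map_apply, ContinuousLinearMap.comp_apply, ← map_sum]
  exact norm_adjoint_apply_le hiso _

theorem norm_compress_le {K : H →L[ℂ] HTensor (Fock n) H}
    (hiso : ∀ x, ‖K x‖ = ‖x‖) (g : Fock n →L[ℂ] Fock n) :
    ‖ContinuousLinearMap.adjoint K ∘L tensorOp g 1 ∘L K‖ ≤ ‖g‖ := by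
  refine ContinuousLinearMap.opNorm_le_bound _ (norm_nonneg _) fun x => ?_
  refine (norm_adjoint_apply_le hiso _).trans ?_
  refine (norm_tensorMap_apply_le g (1 : H →L[ℂ] H) (K x)).trans ?_
  rw [hiso]
  exact mul_le_mul_of_nonneg_right
    (mul_le_of_le_one_right (norm_nonneg _) ContinuousLinearMap.norm_id_le) (norm_nonneg _)

end Evaluation

/-! ### The pencil of the Berezin transform -/

section Pencil

variable {n : ℕ} {H : Type*} [NormedAddCommGroup H] [InnerProductSpace ℂ H] [CompleteSpace H]
  {a : Word n → ℝ} {m : ℕ} {X : Fin n → H →L[ℂ] H} {q : ℝ}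

theorem RegularCoeff.coord_mul_tensorOp_modelΛ (ha : RegularCoeff a) (hm : 1 ≤ m) (δ β : Word n)
    (B : H →L[ℂ] H) (z : HTensor (Fock n) H) :
    coord H (δ * β) (tensorOp (mon (modelΛ a m) β.reverse) B z) =
      wt a m δ (δ * β) • B (coord H δ z) := by
  classical
  have : coord H (δ * β) ∘L tensorOp (mon (modelΛ a m) β.reverse) B =
      wt a m δ (δ * β) • (B ∘L coord H δ) := by
    refine ext_ten_e fun α x => ?_
    simp only [ContinuousLinearMap.comp_apply, smul_apply, tensorOp_ten,
      ha.mon_modelΛ_reverse_e hm, coord_ten, map_smul, e_apply, mul_left_inj]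
    by_cases h : δ = α
    · simp [h]
    · simp [h]
  exact congrArg (fun L : HTensor (Fock n) H →L[ℂ] H => L z) this

theorem RegularCoeff.coord_tensorOp_modelΛ_of_ne (ha : RegularCoeff a) (hm : 1 ≤ m) {γ β : Word n}
    (h : ∀ δ, γ ≠ δ * β) (B : H →L[ℂ] H) (z : HTensor (Fock n) H) :
    coord H γ (tensorOp (mon (modelΛ a m) β.reverse) B z) = 0 := by
  classical
  have : coord H γ ∘L tensorOp (mon (modelΛ a m) β.reverse) B = 0 := by
    refine ext_ten_e fun α x => ?_
    simp only [ContinuousLinearMap.comp_apply, tensorOp_ten, ha.mon_modelΛ_reverse_e hm, coord_ten,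
      lp.coeFn_smul, Pi.smul_apply, e_apply]
    rw [if_neg (h α)]
    simp
  exact congrArg (fun L : HTensor (Fock n) H →L[ℂ] H => L z) this

theorem RegularCoeff.coord_adjoint_tensorOp_modelΛ (ha : RegularCoeff a) (hm : 1 ≤ m)
    (γ β : Word n) (z : HTensor (Fock n) H) :
    coord H γ (ContinuousLinearMap.adjoint (tensorOp (mon (modelΛ a m) β.reverse) 1) z) =
      wt a m γ (γ * β) • coord H (γ * β) z := by
  refine ext_inner_left ℂ fun x => ?_
  rw [coord, ContinuousLinearMap.adjoint_inner_right, ContinuousLinearMap.adjoint_inner_right,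
    tensorOp_ten, ha.mon_modelΛ_reverse_e hm, map_smul, smul_apply, inner_smul_left, coord,
    inner_smul_right, ContinuousLinearMap.adjoint_inner_right, wt, Complex.conj_ofReal]
  rfl

/-- In the coordinate `γ` the sum of squares is ((b * a)_γ / b_γ) ‖z_γ‖² with `*` the convolution,
and b * a ≤ b. -/
theorem RegularCoeff.isRow_modelΛ (ha : RegularCoeff a) (hm : 1 ≤ m) :
    IsRow (fun β : Word n => ((√(a β) : ℝ) : ℂ) •
      (tensorOp (mon (modelΛ a m) β.reverse) 1 :
        HTensor (Fock n) H →L[ℂ] HTensor (Fock n) H)) 1 := by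
  intro z
  have h1 : ∀ β, ENNReal.ofReal (‖ContinuousLinearMap.adjoint (((√(a β) : ℝ) : ℂ) •
      (tensorOp (mon (modelΛ a m) β.reverse) 1 :
        HTensor (Fock n) H →L[ℂ] HTensor (Fock n) H)) z‖ ^ 2) =
      ∑' γ, ENNReal.ofReal (bCoeff a m γ * a β *
        (‖coord H (γ * β) z‖ ^ 2 / bCoeff a m (γ * β))) := by
    intro β
    rw [map_smulₛₗ, Complex.conj_ofReal, smul_apply, norm_real_smul_sq (ha.nonneg β),
      ENNReal.ofReal_mul (ha.nonneg β), ← tsum_norm_coord_sq, ← ENNReal.tsum_mul_left]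
    refine tsum_congr fun γ => ?_
    rw [ha.coord_adjoint_tensorOp_modelΛ hm, wt, norm_real_smul_sq
      (div_nonneg (ha.bCoeff_pos hm _).le (ha.bCoeff_pos hm _).le),
      ← ENNReal.ofReal_mul (ha.nonneg β)]
    congr 1
    ring
  rw [tsum_congr h1, ENNReal.tsum_comm, tsum_tsum_mul_eq_tsum_conv
    (F := fun γ => ‖coord H γ z‖ ^ 2 / bCoeff a m γ) (fun α => (ha.bCoeff_pos hm α).le) ha.nonneg
    (fun γ => div_nonneg (by positivity) (ha.bCoeff_pos hm γ).le), one_mul, ← tsum_norm_coord_sq]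
  refine ENNReal.tsum_le_tsum fun γ => ENNReal.ofReal_le_ofReal ?_
  rw [mul_div_left_comm]
  exact mul_le_of_le_one_right (by positivity)
    ((div_le_one (ha.bCoeff_pos hm γ)).2 (ha.conv_bCoeff_le hm γ))

theorem PhiLe.tsum_tensorOp_one_le (ha : RegularCoeff a) (hX : PhiLe a X q) (hq : 0 ≤ q)
    (z : HTensor (Fock n) H) :
    ∑' β, ENNReal.ofReal (‖(((√(a β) : ℝ) : ℂ) •
      tensorOp (1 : Fock n →L[ℂ] Fock n) (ContinuousLinearMap.adjoint (mon X β))) z‖ ^ 2) ≤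
        ENNReal.ofReal (q * ‖z‖ ^ 2) := by
  have h1 : ∀ β, ENNReal.ofReal (‖(((√(a β) : ℝ) : ℂ) •
      tensorOp (1 : Fock n →L[ℂ] Fock n) (ContinuousLinearMap.adjoint (mon X β))) z‖ ^ 2) =
      ∑' γ, ENNReal.ofReal
        (a β * ‖ContinuousLinearMap.adjoint (mon X β) (coord H γ z)‖ ^ 2) := by
    intro β
    rw [smul_apply, norm_real_smul_sq (ha.nonneg β), ENNReal.ofReal_mul (ha.nonneg β),
      ← tsum_norm_coord_sq, ← ENNReal.tsum_mul_left]
    refine tsum_congr fun γ => ?_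
    rw [coord_tensorOp_one, ← ENNReal.ofReal_mul (ha.nonneg β)]
  rw [tsum_congr h1, ENNReal.tsum_comm, ENNReal.ofReal_mul hq, ← tsum_norm_coord_sq,
    ← ENNReal.tsum_mul_left]
  refine ENNReal.tsum_le_tsum fun γ => ?_
  rw [← ENNReal.ofReal_mul hq]
  exact hX _

/-- Reversal of words as a permutation. -/
def reverseEquiv (n : ℕ) : Word n ≃ Word n where
  toFun := FreeMonoid.reverse
  invFun := FreeMonoid.reverse
  left_inv _ := FreeMonoid.reverse_reverse
  right_inv _ := FreeMonoid.reverse_reverse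

/-- Each term factors into an entry `√a_β Λ_β̃ ⊗ 1` of a contractive row and an entry `√a_β 1 ⊗
X_β*` of a column of norm at most √q. The form indexed by `β` instead of its reverse is the one
suited to coordinates. -/
theorem PhiLe.exists_berezin_sum (ha : RegularCoeff a) (hm : 1 ≤ m) (hX : PhiLe a X q)
    (hq : 0 ≤ q) :
    ∃ M : HTensor (Fock n) H →L[ℂ] HTensor (Fock n) H, ‖M‖ ^ 2 ≤ q ∧
      (∀ z, HasSum (fun α => berezinTerm a m X α z) (M z)) ∧
      ∀ z, HasSum (fun β => (a β : ℂ) • tensorOp (mon (modelΛ a m) β.reverse)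
        (ContinuousLinearMap.adjoint (mon X β)) z) (M z) := by
  obtain ⟨M, hM, hnorm⟩ := (ha.isRow_modelΛ (H := H) hm).exists_sum_comp zero_le_one hq
    (hX.tsum_tensorOp_one_le ha hq)
  rw [one_mul] at hnorm
  have h : ∀ z, HasSum (fun β => (a β : ℂ) • tensorOp (mon (modelΛ a m) β.reverse)
        (ContinuousLinearMap.adjoint (mon X β)) z) (M z) := by
    intro z
    refine (hM z).congr_fun fun β => ?_
    have h1 : tensorOp (mon (modelΛ a m) β.reverse) 1 ∘L
        tensorOp (1 : Fock n →L[ℂ] Fock n) (ContinuousLinearMap.adjoint (mon X β)) =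
        tensorOp (mon (modelΛ a m) β.reverse) (ContinuousLinearMap.adjoint (mon X β)) :=
      tensorMap_comp _ _ _ _
    rw [smul_apply, smul_apply, map_smul, smul_smul, ← Complex.ofReal_mul,
      Real.mul_self_sqrt (ha.nonneg β), ← h1]
    rfl
  refine ⟨M, hnorm, fun z => ?_, h⟩
  refine (reverseEquiv n).hasSum_iff.1 ((h z).congr_fun fun β => ?_)
  change berezinTerm a m X β.reverse z = _
  rw [berezinTerm, FreeMonoid.reverse_reverse, smul_apply]

theorem isUnit_one_sub_of_norm_lt {E : Type*} [NormedAddCommGroup E] [NormedSpace ℂ E]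
    [CompleteSpace E] {M : E →L[ℂ] E} (h : ‖M‖ < 1) : IsUnit (1 - M) :=
  isUnit_one_sub_of_norm_lt_one h

/-- The pencil is `1 - M` with ‖M‖² ≤ q < 1, so a Neumann series inverts it. -/
theorem PhiLe.berezinDefined (ha : RegularCoeff a) (hm : 1 ≤ m) (hXd : X ∈ domain a m H)
    (hX : PhiLe a X q) (hq : 0 ≤ q) (hq1 : q < 1) : BerezinDefined a m X := by
  obtain ⟨M, hnorm, hM, -⟩ := hX.exists_berezin_sum ha hm hq
  refine ⟨hXd, ⟨M, hasSum_sot hM⟩, ?_⟩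
  rw [berezinPencil, sotSum_eq hM]
  have hlt : ‖M‖ < 1 := (sq_lt_one_iff₀ (norm_nonneg M)).1 (hnorm.trans_lt hq1)
  exact isUnit_one_sub_of_norm_lt hlt

/-- The coordinates of the sum `∑ a_β Λ_β̃ ⊗ X_β*`. -/
theorem RegularCoeff.coord_berezin_sum (ha : RegularCoeff a) (hm : 1 ≤ m)
    {M : HTensor (Fock n) H →L[ℂ] HTensor (Fock n) H} {z : HTensor (Fock n) H}
    (hM : HasSum (fun β => (a β : ℂ) • tensorOp (mon (modelΛ a m) β.reverse)
        (ContinuousLinearMap.adjoint (mon X β)) z) (M z)) (γ : Word n) :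
    coord H γ (M z) = ∑ i ∈ Finset.range (γ.length + 1),
      ((a (FreeMonoid.ofList (γ.toList.drop i)) : ℂ) *
        wt a m (FreeMonoid.ofList (γ.toList.take i)) γ) •
        ContinuousLinearMap.adjoint (mon X (FreeMonoid.ofList (γ.toList.drop i)))
          (coord H (FreeMonoid.ofList (γ.toList.take i)) z) := by
  classical
  have hinj : Set.InjOn (fun i => FreeMonoid.ofList (γ.toList.drop i))
      (Finset.range (γ.length + 1)) := by
    intro i hi j hj h
    have h2 := congrArg FreeMonoid.length h
    simp only [FreeMonoid.length, FreeMonoid.toList_ofList, List.length_drop, Finset.coe_range,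
      Set.mem_Iio] at h2 hi hj
    omega
  refine (hM.mapL (coord H γ)).unique ?_
  have h1 : ∀ β ∉ (Finset.range (γ.length + 1)).image
      (fun i => FreeMonoid.ofList (γ.toList.drop i)),
      coord H γ ((a β : ℂ) • tensorOp (mon (modelΛ a m) β.reverse)
        (ContinuousLinearMap.adjoint (mon X β)) z) = 0 := by
    intro β hβ
    rw [map_smul, ha.coord_tensorOp_modelΛ_of_ne hm, smul_zero]
    rintro δ rfl
    refine hβ (Finset.mem_image.2 ⟨δ.length, ?_, ?_⟩)
    · rw [Finset.mem_range, FreeMonoid.length_mul]; omega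
    · exact List.drop_left' rfl
  convert hasSum_sum_of_ne_finset_zero (L := .unconditional _) h1 using 1
  rw [Finset.sum_image hinj]
  refine Finset.sum_congr rfl fun i _ => ?_
  have h2 : FreeMonoid.ofList (γ.toList.take i) * FreeMonoid.ofList (γ.toList.drop i) = γ :=
    List.take_append_drop i γ.toList
  have h3 := ha.coord_mul_tensorOp_modelΛ hm (FreeMonoid.ofList (γ.toList.take i))
    (FreeMonoid.ofList (γ.toList.drop i))
    (ContinuousLinearMap.adjoint (mon X (FreeMonoid.ofList (γ.toList.drop i)))) z
  rw [h2] at h3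
  rw [map_smul, h3, smul_smul]

/-- The powers of the inverse pencil send `1 ⊗ x` to `∑ √b_α e_α ⊗ X_α* x`. -/
theorem IsKernel.inverse_pencil_pow (ha : RegularCoeff a) (hm : 1 ≤ m) (hXd : X ∈ domain a m H)
    (hX : PhiLe a X q) (hq : 0 ≤ q) (hq1 : q < 1) {L : H →L[ℂ] HTensor (Fock n) H}
    (hL : IsKernel a m X 1 L) :
    (Ring.inverse (berezinPencil a m X) ^ m) ∘L vacuumTensor n H = L := by
  obtain ⟨M, -, hM, hM'⟩ := hX.exists_berezin_sum ha hm hq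
  have hpen : berezinPencil a m X = 1 - M := by rw [berezinPencil, sotSum_eq hM]
  have hunit := (hX.berezinDefined ha hm hXd hq hq1).2.2
  have hb := fun α => ha.bCoeff_pos hm α
  ext1 x
  -- The vectors `ξ p` with these coordinates run from `1 ⊗ x` at `p = 0` to `L x` at `p = m`. They
  -- are square summable because the coefficients of (1 - f)^{-p} are at most `b_α`.
  have hsum : ∀ p ≤ m, Summable fun α =>
      ‖((powCoeff a p α / √(bCoeff a m α) : ℝ) : ℂ) •
        ContinuousLinearMap.adjoint (mon X α) x‖ ^ 2 := by
    intro p hp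
    refine Summable.of_nonneg_of_le (fun _ => by positivity) (fun α => ?_)
      (summable_of_tsum_ofReal_le (fun α => mul_nonneg (powCoeff_nonneg ha.nonneg m α)
        (by positivity)) (hX.tsum_powCoeff_norm_le ha hq hq1 m x))
    rw [norm_smul, mul_pow, Complex.norm_real, Real.norm_eq_abs, sq_abs, div_pow,
      Real.sq_sqrt (hb α).le]
    refine mul_le_mul_of_nonneg_right ?_ (by positivity)
    rw [div_le_iff₀ (hb α), bCoeff_eq_powCoeff a hm, sq]
    have := powCoeff_mono ha.nonneg ha.map_one α hp
    exact mul_le_mul this this (powCoeff_nonneg ha.nonneg p α) (powCoeff_nonneg ha.nonneg m α)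
  choose! ξ hξ using fun p hp => exists_coord_eq (hsum p hp)
  have h0 : ξ 0 = vacuumTensor n H x := by
    classical
    refine ext_coord fun α => ?_
    rw [hξ 0 (Nat.zero_le m)]
    change _ = coord H α (ten (e 1) x)
    rw [coord_ten, e_apply]
    by_cases hα : α = 1
    · simp [hα, powCoeff_one, bCoeff_one a hm, adjoint_mon_one]
    · simp [hα, powCoeff_zero a hα]
  have hm' : ξ m = L x := by
    refine ext_coord fun α => ?_
    rw [hξ m le_rfl, hL, ← bCoeff_eq_powCoeff a hm, Real.div_sqrt]
    rfl
  -- In coordinates this is `powCoeff_succ`: the pencil acts as multiplication by 1 - f.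
  have hstep : ∀ p, p + 1 ≤ m → berezinPencil a m X (ξ (p + 1)) = ξ p := by
    intro p hp
    refine ext_coord fun γ => ?_
    rw [hpen, sub_apply, one_apply_eq_self, map_sub, hξ _ hp, hξ _ (by omega),
      ha.coord_berezin_sum hm (hM' _) γ, sub_eq_iff_eq_add]
    have h1 : ∀ i, ((a (FreeMonoid.ofList (γ.toList.drop i)) : ℂ) *
        wt a m (FreeMonoid.ofList (γ.toList.take i)) γ) •
        ContinuousLinearMap.adjoint (mon X (FreeMonoid.ofList (γ.toList.drop i)))
          (coord H (FreeMonoid.ofList (γ.toList.take i)) (ξ (p + 1))) =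
        ((powCoeff a (p + 1) (FreeMonoid.ofList (γ.toList.take i)) *
          a (FreeMonoid.ofList (γ.toList.drop i)) / √(bCoeff a m γ) : ℝ) : ℂ) •
          ContinuousLinearMap.adjoint (mon X γ) x := by
      intro i
      have h2 : FreeMonoid.ofList (γ.toList.take i) * FreeMonoid.ofList (γ.toList.drop i) = γ :=
        List.take_append_drop i γ.toList
      have h3 := adjoint_mon_mul X (FreeMonoid.ofList (γ.toList.take i))
        (FreeMonoid.ofList (γ.toList.drop i)) x
      rw [h2] at h3
      rw [hξ _ hp, map_smul, ← h3, smul_smul, wt]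
      congr 1
      have h4 := (Real.sqrt_pos.2 (hb (FreeMonoid.ofList (γ.toList.take i)))).ne'
      have h5 := (Real.sqrt_pos.2 (hb γ)).ne'
      rw [← Complex.ofReal_mul, ← Complex.ofReal_mul, Real.sqrt_div (hb _).le]
      congr 1
      field_simp
    rw [Finset.sum_congr rfl fun i _ => h1 i, ← Finset.sum_smul, ← add_smul, ← Complex.ofReal_sum,
      ← Complex.ofReal_add, ← Finset.sum_div, ← add_div, powCoeff_succ ha.map_one]
    rfl
  have hpow : ∀ p ≤ m, (berezinPencil a m X ^ p) (ξ p) = ξ 0 := by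
    intro p
    induction p with
    | zero => intro _; rfl
    | succ p ih =>
      intro hp
      rw [pow_succ, mul_apply_eq_comp, hstep p hp, ih (by omega)]
  have hinv : Ring.inverse (berezinPencil a m X) ^ m * berezinPencil a m X ^ m = 1 := by
    rw [Ring.inverse_pow]
    exact Ring.inverse_mul_cancel _ (hunit.pow m)
  rw [ContinuousLinearMap.comp_apply, ← h0, ← hpow m le_rfl, ← mul_apply_eq_comp, hinv, hm']
  rfl

theorem adjoint_tensorOp_one {D : H →L[ℂ] H} (hD : ContinuousLinearMap.adjoint D = D) :
    ContinuousLinearMap.adjoint (tensorOp (1 : Fock n →L[ℂ] Fock n) D) = tensorOp 1 D := by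
  refine ((ContinuousLinearMap.eq_adjoint_iff _ _).2 fun z w => ?_).symm
  have h1 : ∀ u v : Fock n, inner ℂ ((1 : Fock n →L[ℂ] Fock n) u) v =
      inner ℂ u ((1 : Fock n →L[ℂ] Fock n) v) := fun u v => by simp only [one_apply_eq_self]
  have h2 : ∀ u v : H, inner ℂ (D u) v = inner ℂ u (D v) := fun u v => by
    nth_rw 1 [← hD]
    exact ContinuousLinearMap.adjoint_inner_left _ _ _
  exact inner_tensorMap_left h1 h2 z w

theorem IsKernel.eq_tensorOp_comp {D : H →L[ℂ] H} {K L : H →L[ℂ] HTensor (Fock n) H}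
    (hK : IsKernel a m X D K) (hL : IsKernel a m X 1 L) : K = tensorOp 1 D ∘L L := by
  ext1 x
  refine ext_coord fun α => ?_
  rw [ContinuousLinearMap.comp_apply, coord_tensorOp_one, hK, hL, smul_apply, smul_apply,
    map_smul, ContinuousLinearMap.comp_apply, ContinuousLinearMap.comp_apply, one_apply_eq_self]

theorem berezin_eq_of_kernel (ha : RegularCoeff a) (hm : 1 ≤ m) (hXd : X ∈ domain a m H)
    (hX : PhiLe a X q) (hq : 0 ≤ q) (hq1 : q < 1) {L : H →L[ℂ] HTensor (Fock n) H}
    (hL : IsKernel a m X 1 L) (g : Fock n →L[ℂ] Fock n) :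
    berezin a m X g = ContinuousLinearMap.adjoint L ∘L tensorOp g (defect a X m) ∘L L := by
  have h1 := hL.inverse_pencil_pow ha hm hXd hX hq hq1
  rw [berezin, ← ContinuousLinearMap.comp_assoc (ContinuousLinearMap.adjoint _),
    ← ContinuousLinearMap.adjoint_comp, h1]

/-- Split g ⊗ D² as (1 ⊗ D)(g ⊗ 1)(1 ⊗ D) and use K = (1 ⊗ D) L on both sides. -/
theorem IsKernel.compress_eq {D : H →L[ℂ] H} {K L : H →L[ℂ] HTensor (Fock n) H}
    (hK : IsKernel a m X D K) (hL : IsKernel a m X 1 L) (hD : ContinuousLinearMap.adjoint D = D)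
    (g : Fock n →L[ℂ] Fock n) :
    ContinuousLinearMap.adjoint L ∘L tensorOp g (D ∘L D) ∘L L =
      ContinuousLinearMap.adjoint K ∘L tensorOp g 1 ∘L K := by
  have h : K = tensorOp 1 D ∘L L := hK.eq_tensorOp_comp hL
  have h1 : ContinuousLinearMap.adjoint K = ContinuousLinearMap.adjoint L ∘L tensorOp 1 D := by
    rw [h, ContinuousLinearMap.adjoint_comp, adjoint_tensorOp_one hD]
  rw [comp_conj (ContinuousLinearMap.adjoint L) L (tensorOp_comp_self g D), h1, h]

/-- The Berezin transform at `X` is the evaluation at `X`. -/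
theorem berezin_eq_eval (ha : RegularCoeff a) (hm : 1 ≤ m) (hXd : X ∈ domain a m H)
    (hX : PhiLe a X q) (hq : 0 ≤ q) (hq1 : q < 1) {c : Word n → ℂ} {S : H →L[ℂ] H}
    {g : Fock n →L[ℂ] Fock n} (hg : HasFourierSeries a m g c)
    (hS : HasSum (fun β => c β • mon X β) S) : berezin a m X g = S := by
  obtain ⟨L, hL⟩ := exists_kernel_one ha hm hX hq hq1
  obtain ⟨D, K, hD, hD2, hK⟩ := exists_kernel_of_mem_domain ha hm hXd
  have hiso := hK.isometry ha hm hXd hX hq hq1 hD hD2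
  have h1 := hK.compress_eq hL hD g
  rw [hD2] at h1
  exact (berezin_eq_of_kernel ha hm hXd hX hq hq1 hL g).trans
    (h1.trans (hK.eval_eq ha hm hD hiso hg hS).symm)

end Pencil

/-! ### Limits of bounded families of operators -/

section Limits

variable {E G : Type*} [NormedAddCommGroup E] [NormedSpace ℂ E] [NormedAddCommGroup G]
  [NormedSpace ℂ G] {ι : Type*} {l : Filter ι} {F : ι → E →L[ℂ] G} {C : ℝ}

/-- A bounded family of operators which converges on a total set converges pointwise. -/
theorem tendsto_apply_of_dense_span (hF : ∀ᶠ i in l, ‖F i‖ ≤ C) {A : E →L[ℂ] G} {s : Set E}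
    (hs : Dense (Submodule.span ℂ s : Set E))
    (h : ∀ x ∈ s, Tendsto (fun i => F i x) l (𝓝 (A x))) (x : E) :
    Tendsto (fun i => F i x) l (𝓝 (A x)) := by
  have hspan : ∀ y ∈ Submodule.span ℂ s, Tendsto (fun i => F i y) l (𝓝 (A y)) := by
    intro y hy
    induction hy using Submodule.span_induction with
    | mem y hy => exact h y hy
    | zero => simpa using tendsto_const_nhds
    | add y z _ _ hy hz => simpa only [map_add] using hy.add hz
    | smul c y _ hy => simpa only [map_smul] using hy.const_smul c
  rw [Metric.tendsto_nhds]
  intro ε hε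
  have hδ : 0 < ε / (|C| + ‖A‖ + 2) := by positivity
  obtain ⟨y, hy, hxy⟩ := Metric.mem_closure_iff.1 (hs x) _ hδ
  filter_upwards [hF, (Metric.tendsto_nhds.1 (hspan y hy)) _ hδ] with i hi hiy
  rw [dist_eq_norm] at *
  have h1 : F i x - A x = F i (x - y) + (F i y - A y) - A (x - y) := by
    simp only [map_sub]; abel
  have h2 : ‖F i (x - y)‖ ≤ |C| * ‖x - y‖ :=
    (F i).le_of_opNorm_le (hi.trans (le_abs_self C)) _
  have h3 : ‖A (x - y)‖ ≤ ‖A‖ * ‖x - y‖ := A.le_opNorm _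
  have h4 : ‖F i x - A x‖ ≤ ‖F i (x - y)‖ + ‖F i y - A y‖ + ‖A (x - y)‖ := by
    rw [h1]
    exact (norm_sub_le _ _).trans (add_le_add_left (norm_add_le _ _) _)
  have h5 : (|C| + ‖A‖ + 2) * (ε / (|C| + ‖A‖ + 2)) = ε := by
    field_simp
  nlinarith [abs_nonneg C, norm_nonneg A, norm_nonneg (x - y)]

/-- A bounded family of operators which converges on a dense set has a pointwise limit. -/
theorem exists_tendsto_of_dense [CompleteSpace E] [CompleteSpace G] [l.NeBot]
    [l.IsCountablyGenerated] (hF : ∀ᶠ i in l, ‖F i‖ ≤ C) {s : Set E} (hs : Dense s)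
    (h : ∀ x ∈ s, ∃ y, Tendsto (fun i => F i x) l (𝓝 y)) :
    ∃ A : E →L[ℂ] G, ∀ x, Tendsto (fun i => F i x) l (𝓝 (A x)) := by
  have hlim : ∀ x, ∃ y, Tendsto (fun i => F i x) l (𝓝 y) := by
    intro x
    rw [← cauchy_map_iff_exists_tendsto, Metric.cauchy_iff]
    refine ⟨inferInstance, fun ε hε => ?_⟩
    have hδ : 0 < ε / (4 * (|C| + 1)) := by positivity
    obtain ⟨z, hz, hxz⟩ := Metric.mem_closure_iff.1 (hs x) _ hδ
    obtain ⟨y, hy⟩ := h z hz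
    have hev : ∀ᶠ i in l, dist (F i x) y < ε / 2 := by
      filter_upwards [hF, Metric.tendsto_nhds.1 hy (ε / 4) (by positivity)] with i hi hiy
      have h1 : dist (F i x) (F i z) ≤ |C| * dist x z := by
        rw [dist_eq_norm, dist_eq_norm, ← map_sub]
        exact (F i).le_of_opNorm_le (hi.trans (le_abs_self C)) _
      have h2 := dist_triangle (F i x) (F i z) y
      have h3 : (|C| + 1) * (ε / (4 * (|C| + 1))) = ε / 4 := by field_simp
      have h4 : |C| * dist x z ≤ (|C| + 1) * (ε / (4 * (|C| + 1))) :=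
        mul_le_mul (by linarith) hxz.le dist_nonneg (by positivity)
      linarith
    refine ⟨_, image_mem_map hev, ?_⟩
    rintro _ ⟨i, hi, rfl⟩ _ ⟨j, hj, rfl⟩
    have h1 := dist_triangle_right (F i x) (F j x) y
    have h2 : dist (F i x) y < ε / 2 := hi
    have h3 : dist (F j x) y < ε / 2 := hj
    linarith
  choose f hf using hlim
  -- Boundedness of the pointwise limit is Banach–Steinhaus, for which the filter is countably
  -- generated.
  exact ⟨continuousLinearMapOfTendsto F (tendsto_pi_nhds.2 hf), hf⟩

end Limits

/-! ### Radial dilations of the Fock space -/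

section Dilation

variable {n : ℕ}

theorem abs_pow_length_le {r : ℝ} (h0 : 0 ≤ r) (h1 : r ≤ 1) (α : Word n) :
    |r ^ α.length| ≤ 1 := by
  rw [abs_of_nonneg (by positivity)]
  exact pow_le_one₀ h0 h1

theorem tendsto_diagOp_pow (φ : Fock n) :
    Tendsto (fun r : ℝ => diagOp (fun α : Word n => r ^ α.length) φ) (𝓝[<] 1) (𝓝 φ) := by
  have hev : ∀ᶠ r : ℝ in 𝓝[<] 1, 0 < r ∧ r < 1 := by
    filter_upwards [Ioo_mem_nhdsLT (zero_lt_one (α := ℝ))] with r hr using hr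
  have hF : ∀ᶠ r : ℝ in 𝓝[<] 1, ‖diagOp (fun α : Word n => r ^ α.length)‖ ≤ 1 := by
    filter_upwards [hev] with r hr
    exact ContinuousLinearMap.opNorm_le_bound _ zero_le_one
      (norm_diagOp_apply_le (abs_pow_length_le hr.1.le hr.2.le))
  refine tendsto_apply_of_dense_span (A := ContinuousLinearMap.id ℂ (Fock n)) hF dense_span_e ?_ φ
  rintro _ ⟨α, rfl⟩
  have h1 : Tendsto (fun r : ℝ => ((r ^ α.length : ℝ) : ℂ) • (e α : Fock n)) (𝓝[<] 1)
      (𝓝 (((1 ^ α.length : ℝ) : ℂ) • (e α : Fock n))) := by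
    refine Tendsto.mono_left (Continuous.tendsto ?_ 1) nhdsWithin_le_nhds
    fun_prop
  rw [one_pow, Complex.ofReal_one, one_smul] at h1
  refine h1.congr' ?_
  filter_upwards [hev] with r hr
  rw [diagOp_e (abs_pow_length_le hr.1.le hr.2.le)]

end Dilation

/-! ### The functional calculus -/

section Calculus

variable {n : ℕ} {H : Type*} [NormedAddCommGroup H] [InnerProductSpace ℂ H]

theorem dense_span_ten_e : Dense (Submodule.span ℂ
    {z : HTensor (Fock n) H | ∃ α x, z = ten (e α) x} : Set (HTensor (Fock n) H)) := by
  rw [Submodule.dense_iff_topologicalClosure_eq_top, Submodule.topologicalClosure_eq_top_iff,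
    Submodule.eq_bot_iff]
  intro z hz
  have h0 : innerSL ℂ z = 0 := by
    refine ext_ten_e fun α x => ?_
    rw [Submodule.mem_orthogonal'] at hz
    exact hz _ (Submodule.subset_span ⟨α, x, rfl⟩)
  have := congrArg (fun L : HTensor (Fock n) H →L[ℂ] ℂ => L z) h0
  simpa using this

variable [CompleteSpace H] {a : Word n → ℝ} {m : ℕ} {T : Fin n → H →L[ℂ] H}

/-- The adjoint of the kernel of a completely non-coisometric tuple has dense range. -/
theorem IsKernel.denseRange_adjoint (ha : RegularCoeff a) (hm : 1 ≤ m) (hT : T ∈ domain a m H)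
    (hcnc : IsCNC a T) {D : H →L[ℂ] H} {K : H →L[ℂ] HTensor (Fock n) H}
    (hD : ContinuousLinearMap.adjoint D = D) (hD2 : D ∘L D = defect a T m)
    (hK : IsKernel a m T D K) : DenseRange (ContinuousLinearMap.adjoint K) := by
  -- Since `√b_α ≠ 0`, `K x = 0` says that `D X_α* x = 0` for all `α`.
  have hker : ∀ x, K x = 0 → x = 0 := by
    intro x hx
    refine eq_zero_of_quad_defect_eq_zero ha hm hT hcnc fun α => ?_
    have h1 := hK x α
    rw [hx, map_zero, smul_apply, eq_comm, smul_eq_zero] at h1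
    rcases h1 with h1 | h1
    · exact absurd h1 (Complex.ofReal_ne_zero.2 (Real.sqrt_pos.2 (ha.bCoeff_pos hm α)).ne')
    · rw [← norm_sqrt_sq hD hD2, ← ContinuousLinearMap.comp_apply, h1]
      simp
  have h : ((ContinuousLinearMap.adjoint K).range.topologicalClosure) = ⊤ := by
    rw [Submodule.topologicalClosure_eq_top_iff, ContinuousLinearMap.orthogonal_range,
      ContinuousLinearMap.adjoint_adjoint, Submodule.eq_bot_iff]
    exact fun x hx => hker x hx
  exact Submodule.dense_iff_topologicalClosure_eq_top.2 h

/-- For `r < 1` close to `1`, the evaluation at `rT` is a compression of an amplification. -/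
theorem eventually_evalRadial_eq (ha : RegularCoeff a) (hm : 1 ≤ m) (hT : T ∈ domain a m H)
    (hTr : HasRadialProperty a m T) :
    ∀ᶠ r in 𝓝[<] (1 : ℝ), 0 < r ∧ r < 1 ∧ BerezinDefined a m (scale r T) ∧
      (∀ g c, HasFourierSeries a m g c → berezin a m (scale r T) g = evalRadial c T r) ∧
      ∃ K : H →L[ℂ] HTensor (Fock n) H, (∀ x, ‖K x‖ = ‖x‖) ∧
        ∀ g c, HasFourierSeries a m g c →
          evalRadial c T r = ContinuousLinearMap.adjoint K ∘L tensorOp g 1 ∘L K := by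
  obtain ⟨δ, hδ0, hδ1, hδ⟩ := hTr
  filter_upwards [Ioo_mem_nhdsLT hδ1] with r hr
  have h0 : 0 < r := hδ0.trans hr.1
  have hT1 := phiLe_of_mem_domain ha hm hT
  have hX := hT1.phiLe_scale ha h0.le hr.2.le
  have hq1 : r ^ 2 < 1 := pow_lt_one₀ h0.le hr.2 two_ne_zero
  have hd := hδ r hr.1 hr.2
  obtain ⟨D, K, hD, hD2, hK⟩ := exists_kernel_of_mem_domain ha hm hd
  have hiso := hK.isometry ha hm hd hX (by positivity) hq1 hD hD2
  refine ⟨h0, hr.2, hX.berezinDefined ha hm hd (by positivity) hq1, fun g c hg => ?_,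
    K, hiso, fun g c hg => ?_⟩
  · exact berezin_eq_eval ha hm hd hX (by positivity) hq1 hg
      (hT1.hasSum_evalRadial ha hm h0.le hr.2 hg.1)
  · exact hK.eval_eq ha hm hD hiso hg (hT1.hasSum_evalRadial ha hm h0.le hr.2 hg.1)

/-- From r^{|β|} = r^{-|α|} r^{|βα|}: scaling the coefficients of `g` amounts to dilating the vector
`g (e α)`. Here the kernel is that of `T`, not of `rT`, so the radius enters only through this
dilation. -/
theorem IsKernel.evalRadial_apply (ha : RegularCoeff a) (hm : 1 ≤ m) (hT : PhiLe a T 1)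
    {D : H →L[ℂ] H} {K : H →L[ℂ] HTensor (Fock n) H} (hD : ContinuousLinearMap.adjoint D = D)
    (hK : IsKernel a m T D K) {g : Fock n →L[ℂ] Fock n} {c : Word n → ℂ}
    (hg : HasFourierSeries a m g c) {r : ℝ} (h0 : 0 < r) (h1 : r < 1) (α : Word n) (x : H) :
    evalRadial c T r (ContinuousLinearMap.adjoint K (ten (e α) x)) =
      ContinuousLinearMap.adjoint K (ten ((((r ^ α.length)⁻¹ : ℝ) : ℂ) •
        diagOp (fun β : Word n => r ^ β.length) (g (e α))) x) := by
  have hS := hT.hasSum_evalRadial ha hm h0.le h1 hg.1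
  simp only [← smul_mon_scale] at hS
  refine (hK.hasSum_apply ha hm hD hS α x).unique ?_
  have h2 := (((ha.hasSum_apply_e hm hg α).mapL
    (diagOp fun β : Word n => r ^ β.length)).const_smul (((r ^ α.length)⁻¹ : ℝ) : ℂ)).mapL
    (ContinuousLinearMap.adjoint K ∘L (ten (E := Fock n) (F := H)).flip x)
  refine h2.congr_fun fun β => ?_
  have hr : (r : ℂ) ^ α.length ≠ 0 := pow_ne_zero _ (Complex.ofReal_ne_zero.2 h0.ne')
  simp only [map_smul, diagOp_e (abs_pow_length_le h0.le h1.le), smul_smul, FreeMonoid.length_mul]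
  refine congrArg (· • ContinuousLinearMap.adjoint K (ten (e (β * α)) x)) ?_
  push_cast
  rw [pow_add]
  field_simp

/-- The limit of `g(rT)` exists and is intertwined with `g` by the kernel. -/
theorem IsKernel.exists_limit (ha : RegularCoeff a) (hm : 1 ≤ m) (hT : T ∈ domain a m H)
    (hTr : HasRadialProperty a m T)
    {D : H →L[ℂ] H} {K : H →L[ℂ] HTensor (Fock n) H} (hD : ContinuousLinearMap.adjoint D = D)
    (hK : IsKernel a m T D K) (hdense : DenseRange (ContinuousLinearMap.adjoint K))
    {g : Fock n →L[ℂ] Fock n} {c : Word n → ℂ} (hg : HasFourierSeries a m g c) :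
    ∃ A : H →L[ℂ] H, SOTLimOne (fun r => evalRadial c T r) A ∧
      A ∘L ContinuousLinearMap.adjoint K = ContinuousLinearMap.adjoint K ∘L tensorOp g 1 := by
  have hev := eventually_evalRadial_eq ha hm hT hTr
  have hT1 := phiLe_of_mem_domain ha hm hT
  have hb : ∀ᶠ r in 𝓝[<] (1 : ℝ), ‖evalRadial c T r‖ ≤ ‖g‖ := by
    filter_upwards [hev] with r ⟨_, _, _, _, K', hiso, h⟩
    rw [h g c hg]
    exact norm_compress_le hiso g
  -- By the uniform bound it suffices to take `z = e_α ⊗ x`, where `IsKernel.evalRadial_apply`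
  -- reduces the limit to that of the dilations.
  have hz : ∀ z, Tendsto (fun r => evalRadial c T r (ContinuousLinearMap.adjoint K z)) (𝓝[<] 1)
      (𝓝 (ContinuousLinearMap.adjoint K (tensorOp g 1 z))) := by
    have hb' : ∀ᶠ r in 𝓝[<] (1 : ℝ), ‖evalRadial c T r ∘L ContinuousLinearMap.adjoint K‖ ≤
        ‖g‖ * ‖ContinuousLinearMap.adjoint K‖ := by
      filter_upwards [hb] with r hr
      exact (ContinuousLinearMap.opNorm_comp_le _ _).trans
        (mul_le_mul_of_nonneg_right hr (norm_nonneg _))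
    refine tendsto_apply_of_dense_span (A := ContinuousLinearMap.adjoint K ∘L tensorOp g 1) hb'
      dense_span_ten_e ?_
    rintro _ ⟨α, x, rfl⟩
    rw [ContinuousLinearMap.comp_apply, tensorOp_ten, one_apply_eq_self]
    have h1 : Tendsto (fun r : ℝ => (((r ^ α.length)⁻¹ : ℝ) : ℂ)) (𝓝[<] 1) (𝓝 1) := by
      have : Tendsto (fun r : ℝ => (r ^ α.length)⁻¹) (𝓝 1) (𝓝 (1 ^ α.length)⁻¹) :=
        ((continuous_pow α.length).tendsto 1).inv₀ (by simp)
      rw [one_pow, inv_one] at this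
      exact_mod_cast (Complex.continuous_ofReal.tendsto 1).comp
        (this.mono_left nhdsWithin_le_nhds)
    have h2 := h1.smul (tendsto_diagOp_pow (g (e α)))
    rw [one_smul] at h2
    have h3 := ((ContinuousLinearMap.adjoint K ∘L
      (ten (E := Fock n) (F := H)).flip x).continuous.tendsto _).comp h2
    refine h3.congr' ?_
    filter_upwards [hev] with r hr
    exact (hK.evalRadial_apply ha hm hT1 hD hg hr.1 hr.2.1 α x).symm
  obtain ⟨A, hA⟩ := exists_tendsto_of_dense hb hdense (by
    rintro _ ⟨z, rfl⟩
    exact ⟨_, hz z⟩)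
  refine ⟨A, tendsto_sot_iff.2 hA, ?_⟩
  ext1 z
  exact tendsto_nhds_unique (hA _) (hz z)

end Calculus

/-! ### Homomorphisms intertwined with the identity representation -/

section Intertwined

variable {K H : Type*} [NormedAddCommGroup K] [InnerProductSpace ℂ K]
  [NormedAddCommGroup H] [InnerProductSpace ℂ H] {F : Subalgebra ℂ (K →L[ℂ] K)}
  {V : HTensor K H →L[ℂ] H}

/-- This uniqueness is what gives linearity and multiplicativity of the calculus, and independence
of the choice of Fourier series. -/
theorem eq_of_comp_eq (hV : DenseRange V) {A B : H →L[ℂ] H} (h : A ∘L V = B ∘L V) : A = B :=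
  DFunLike.coe_injective <|
    hV.equalizer A.continuous B.continuous (congrArg DFunLike.coe h)

/-- Operators which are intertwined with the amplifications `g ⊗ 1` by an operator with dense range
form a representation of the algebra. -/
theorem exists_algHom_of_intertwine (hV : DenseRange V)
    (h : ∀ g : F, ∃ A : H →L[ℂ] H, A ∘L V = V ∘L tensorOp (g : K →L[ℂ] K) 1) :
    ∃ Φ : F →ₐ[ℂ] (H →L[ℂ] H), ∀ g : F, Φ g ∘L V = V ∘L tensorOp (g : K →L[ℂ] K) 1 := by
  choose f hf using h
  have hf' : ∀ (g : F) φ x, f g (V (ten φ x)) = V (ten ((g : K →L[ℂ] K) φ) x) := by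
    intro g φ x
    rw [← ContinuousLinearMap.comp_apply, hf, ContinuousLinearMap.comp_apply, tensorOp_ten,
      one_apply_eq_self]
  refine ⟨AlgHom.ofLinearMap
    { toFun := f
      map_add' := fun g₁ g₂ => eq_of_comp_eq hV (ext_ten fun φ x => ?_)
      map_smul' := fun c g => eq_of_comp_eq hV (ext_ten fun φ x => ?_) }
    (eq_of_comp_eq hV (ext_ten fun φ x => ?_))
    (fun g₁ g₂ => eq_of_comp_eq hV (ext_ten fun φ x => ?_)), hf⟩
  · simp [hf']
  · simp [hf']
  · simp [hf']
  · simp [hf']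

variable {Φ : F → H →L[ℂ] H}

theorem dense_span_range_ten (hV : DenseRange V) {s : Set (HTensor K H)}
    (hs : Dense (Submodule.span ℂ s : Set (HTensor K H))) :
    Dense (Submodule.span ℂ (V '' s) : Set H) := by
  rw [← ContinuousLinearMap.coe_coe, Submodule.span_image, Submodule.map_coe]
  exact hV.dense_image V.continuous hs

/-- On the total set of vectors V(φ ⊗ x) one has Φ(g) V(φ ⊗ x) = V(gφ ⊗ x), which is strongly
continuous in `g`; the norm bound on `S` extends this to all vectors. -/
theorem sotContinuousOnBounded_of_intertwine (hV : DenseRange V)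
    (hs : Dense (Submodule.span ℂ {z : HTensor K H | ∃ φ x, z = ten φ x} : Set (HTensor K H)))
    (h : ∀ g : F, Φ g ∘L V = V ∘L tensorOp (g : K →L[ℂ] K) 1)
    (hΦ : ∀ g : F, ‖Φ g‖ ≤ ‖(g : K →L[ℂ] K)‖) : SOTContinuousOnBounded F Φ := by
  intro S hS g₀ hg₀
  obtain ⟨C, hC⟩ := hS.exists_norm_le
  let _ : TopologicalSpace F := TopologicalSpace.induced Subtype.val (sot K)
  have hval : Tendsto (fun g : F => (g : K →L[ℂ] K)) (𝓝[S] g₀) (@nhds _ (sot K) g₀) :=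
    ((@continuous_iff_continuousAt _ _ _ (sot K) _).1
      (@continuous_induced_dom _ _ _ (sot K)) g₀).mono_left nhdsWithin_le_nhds
  refine tendsto_sot_iff.2 (tendsto_apply_of_dense_span (C := C)
    (eventually_of_mem self_mem_nhdsWithin fun g hg => (hΦ g).trans (hC g hg))
    (dense_span_range_ten hV hs) ?_)
  rintro _ ⟨_, ⟨φ, x, rfl⟩, rfl⟩
  have h1 : ∀ g : F, Φ g (V (ten φ x)) = (V ∘L ten.flip x) ((g : K →L[ℂ] K) φ) := fun g => by
    rw [← ContinuousLinearMap.comp_apply, h, ContinuousLinearMap.comp_apply, tensorOp_ten,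
      one_apply_eq_self]
    rfl
  simp only [h1]
  exact ((V ∘L ten.flip x).continuous.tendsto _).comp (tendsto_sot_iff.1 hval φ)

theorem wotContinuousOnBounded_of_intertwine [CompleteSpace K] [CompleteSpace H]
    (hV : DenseRange V)
    (hs : Dense (Submodule.span ℂ {z : HTensor K H | ∃ φ x, z = ten φ x} : Set (HTensor K H)))
    (h : ∀ g : F, Φ g ∘L V = V ∘L tensorOp (g : K →L[ℂ] K) 1)
    (hΦ : ∀ g : F, ‖Φ g‖ ≤ ‖(g : K →L[ℂ] K)‖) : WOTContinuousOnBounded F Φ := by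
  intro S hS g₀ hg₀
  obtain ⟨C, hC⟩ := hS.exists_norm_le
  let _ : TopologicalSpace F := TopologicalSpace.induced Subtype.val (wot K)
  have hval : Tendsto (fun g : F => (g : K →L[ℂ] K)) (𝓝[S] g₀) (@nhds _ (wot K) g₀) :=
    ((@continuous_iff_continuousAt _ _ _ (wot K) _).1
      (@continuous_induced_dom _ _ _ (wot K)) g₀).mono_left nhdsWithin_le_nhds
  refine tendsto_wot_iff.2 fun x y => ?_
  refine tendsto_apply_of_dense_span (F := fun g : F => innerSL ℂ y ∘L Φ g)
    (A := innerSL ℂ y ∘L Φ g₀) (C := ‖y‖ * C)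
    (eventually_of_mem self_mem_nhdsWithin fun g hg => ?_) (dense_span_range_ten hV hs) ?_ x
  · refine (ContinuousLinearMap.opNorm_comp_le _ _).trans ?_
    rw [innerSL_apply_norm]
    exact mul_le_mul_of_nonneg_left ((hΦ g).trans (hC g hg)) (norm_nonneg _)
  rintro _ ⟨_, ⟨φ, x, rfl⟩, rfl⟩
  -- The Riesz vector of φ' ↦ ⟨y, V(φ' ⊗ x)⟩ turns the matrix entry of Φ(g) into a matrix entry of
  -- `g`.
  set ψ := (InnerProductSpace.toDual ℂ K).symm (innerSL ℂ y ∘L V ∘L ten.flip x) with hψ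
  have h1 : ∀ g : F, (innerSL ℂ y ∘L Φ g) (V (ten φ x)) = inner ℂ ψ ((g : K →L[ℂ] K) φ) := by
    intro g
    rw [hψ, InnerProductSpace.toDual_symm_apply, ContinuousLinearMap.comp_apply,
      ← ContinuousLinearMap.comp_apply (Φ g), h, ContinuousLinearMap.comp_apply, tensorOp_ten,
      one_apply_eq_self]
    rfl
  simp only [h1]
  exact tendsto_wot_iff.1 hval φ ψ

end Intertwined

/-! ### Complete contractivity of the limit map. -/

section Calculus

variable {n : ℕ} {H : Type*} [NormedAddCommGroup H] [InnerProductSpace ℂ H] [CompleteSpace H]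
  {a : Word n → ℝ} {m : ℕ} {T : Fin n → H →L[ℂ] H}

/-- Near `r = 1` the evaluations at `rT` are compressions of amplifications, hence completely
contractive. For a fixed vector the matrix inequality involves finitely many strong limits, so it is
preserved. -/
theorem isCompletelyContractive_of_sotLimOne (ha : RegularCoeff a) (hm : 1 ≤ m)
    (hT : T ∈ domain a m H) (hTr : HasRadialProperty a m T)
    {F : Subalgebra ℂ (Fock n →L[ℂ] Fock n)} {Φ : F → H →L[ℂ] H}
    (h : ∀ g : F, ∃ c, HasFourierSeries a m (g : Fock n →L[ℂ] Fock n) c ∧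
      SOTLimOne (fun r => evalRadial c T r) (Φ g)) : IsCompletelyContractive F Φ := by
  choose c hc hlim using h
  intro k g
  refine norm_matOp_le (norm_nonneg _) fun x => ?_
  have h1 : Tendsto (fun r => ∑ i, ‖∑ j, evalRadial (c (g i j)) T r (x j)‖ ^ 2) (𝓝[<] 1)
      (𝓝 (∑ i, ‖∑ j, g.map Φ i j (x j)‖ ^ 2)) :=
    tendsto_finsetSum _ fun i _ => ((tendsto_finsetSum _ fun j _ =>
      tendsto_sot_iff.1 (hlim (g i j)) (x j)).norm).pow 2
  refine le_of_tendsto h1 ?_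
  filter_upwards [eventually_evalRadial_eq ha hm hT hTr] with r ⟨_, _, _, _, K, hiso, hK⟩
  have h2 := norm_matOp_compress_le hiso (g.map fun y => (y : Fock n →L[ℂ] Fock n))
  simp only [fun y : F => hK y (c y) (hc y)]
  refine (sum_norm_matOp_sq_le ((g.map fun y => (y : Fock n →L[ℂ] Fock n)).map
    fun A => ContinuousLinearMap.adjoint K ∘L tensorOp A 1 ∘L K) x).trans ?_
  exact mul_le_mul_of_nonneg_right (pow_le_pow_left₀ (norm_nonneg _) h2 2)
    (Finset.sum_nonneg fun _ _ => by positivity)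

end Calculus

end NCDomain

end

/-! ### The functional calculus theorem. -/

open NCDomain Filter Topology in
theorem theorem3p6 {n m : ℕ} (hn : 1 ≤ n) (hm : 1 ≤ m)
    {H : Type*} [NormedAddCommGroup H] [InnerProductSpace ℂ H] [CompleteSpace H]
    (a : Word n → ℝ) (ρ : ℝ) (hρ : 0 < ρ) (hf : IsPositiveRegular H a ρ)
    (hW : HasRadialProperty a m (modelW a m))
    (T : Fin n → H →L[ℂ] H) (hT : T ∈ domain a m H)
    (hTr : HasRadialProperty a m T) (hcnc : IsCNC a T) :
    ∃ F : Subalgebra ℂ (Fock n →L[ℂ] Fock n), (F : Set (Fock n →L[ℂ] Fock n)) = hardySet a m ∧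
      ∃ Φ : F →ₐ[ℂ] (H →L[ℂ] H),
        (∀ (g : F) (c : Word n → ℂ), HasFourierSeries a m (g : Fock n →L[ℂ] Fock n) c →
          (∀ r : ℝ, 0 ≤ r → r < 1 → Summable (homPart c T r)) ∧
            SOTLimOne (fun r => evalRadial c T r) (Φ g)) ∧
        ((∀ᶠ r in 𝓝[<] (1 : ℝ), BerezinDefined a m (scale r T)) ∧
          ∀ g : F, SOTLimOne (fun r => berezin a m (scale r T) (g : Fock n →L[ℂ] Fock n)) (Φ g)) ∧
        (WOTContinuousOnBounded F Φ ∧ SOTContinuousOnBounded F Φ) ∧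
        IsCompletelyContractive F Φ := by
  have ha : RegularCoeff a := ⟨hf.nonneg, hf.map_one, hf.pos⟩
  have hF := ha.hardySet_eq_centralizer (m := m) hm
  obtain ⟨D, K, hD, hD2, hK⟩ := exists_kernel_of_mem_domain ha hm hT
  have hdense := hK.denseRange_adjoint ha hm hT hcnc hD hD2
  have hev := eventually_evalRadial_eq ha hm hT hTr
  set F := Subalgebra.centralizer ℂ (Set.range (modelΛ a m)) with hFdef
  have hmem : ∀ g : F, ∃ c, HasFourierSeries a m (g : Fock n →L[ℂ] Fock n) c := fun g =>
    hF.subset g.2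
  obtain ⟨Φ, hΦ⟩ := exists_algHom_of_intertwine (F := F) hdense fun g => by
    obtain ⟨c, hc⟩ := hmem g
    obtain ⟨A, -, hA⟩ := hK.exists_limit ha hm hT hTr hD hdense hc
    exact ⟨A, hA⟩
  have hlim : ∀ (g : F) (c : Word n → ℂ), HasFourierSeries a m (g : Fock n →L[ℂ] Fock n) c →
      SOTLimOne (fun r => evalRadial c T r) (Φ g) := by
    intro g c hc
    obtain ⟨A, hA, hA'⟩ := hK.exists_limit ha hm hT hTr hD hdense hc
    -- The strong limit and Φ(g) satisfy the same intertwining relation with K*, so they coincide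
    -- for every admissible `c`.
    rwa [eq_of_comp_eq hdense (hΦ g |>.trans hA'.symm)]
  have hnorm : ∀ g : F, ‖Φ g‖ ≤ ‖(g : Fock n →L[ℂ] Fock n)‖ := by
    intro g
    obtain ⟨c, hc⟩ := hmem g
    refine ContinuousLinearMap.opNorm_le_bound _ (norm_nonneg _) fun x => ?_
    refine le_of_tendsto (tendsto_sot_iff.1 (hlim g c hc) x).norm ?_
    filter_upwards [hev] with r ⟨_, _, _, _, K', hiso, h⟩
    rw [h g c hc]
    exact (norm_compress_le hiso g.1 |> ContinuousLinearMap.le_of_opNorm_le _) x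
  have hs : Dense (Submodule.span ℂ {z : HTensor (Fock n) H | ∃ φ x, z = ten φ x} :
      Set (HTensor (Fock n) H)) :=
    dense_span_ten_e.mono (Submodule.span_mono (by rintro _ ⟨α, x, rfl⟩; exact ⟨e α, x, rfl⟩))
  refine ⟨F, hF, Φ, fun g c hc => ⟨fun r h0 h1 => ?_, hlim g c hc⟩,
    ⟨hev.mono fun r hr => hr.2.2.1, fun g => ?_⟩,
    ⟨wotContinuousOnBounded_of_intertwine hdense hs hΦ hnorm,
      sotContinuousOnBounded_of_intertwine hdense hs hΦ hnorm⟩,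
    isCompletelyContractive_of_sotLimOne ha hm hT hTr fun g => ?_⟩
  · exact ((phiLe_of_mem_domain ha hm hT).hasSum_homPart ha hm h0 h1 hc.1).summable
  · obtain ⟨c, hc⟩ := hmem g
    -- For `r` close to 1 the Berezin transform at `rT` equals g(rT), so the two limits agree.
    refine (hlim g c hc).congr' ?_
    filter_upwards [hev] with r hr
    exact (hr.2.2.2.1 g c hc).symm
  · obtain ⟨c, hc⟩ := hmem g
    exact ⟨c, hc, hlim g c hc⟩
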